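/- Let $K$ be a field of characteristic $0$ and let $(\alpha_0,\alpha_1)$ be one of $(\frac12,\frac12),(\frac13,\frac23),(\frac14,\frac34),(\frac16,\frac56)$. Put $$T=\operatorname{Spec}K[t,(t-t^2)^{-1}],\qquad S=\operatorname{Spec}K[s,t,(t-t^2)^{-1}],\quad t=4s(1-s)\ \ \bigl(\text{i.e. } s=\tfrac12(1-\sqrt{1-t})\bigr),$$ and let $\mathscr D_T=\mathscr O(T)\langle\frac{d}{dt}\rangle$, $\mathscr D_S=\mathscr O(S)\langle\frac{d}{dt}\rangle$ be their rings of differential operators, $D=t\frac{d}{dt}$, $D_s=s\frac{d}{ds}=4s(1-2s)\frac{d}{dt}$. Let $$P_{\alpha_0\alpha_1}=D_s^2-s(D_s+\alpha_0)(D_s+\alpha_1)\in\mathscr D_S,\qquad P_{\underline\alpha}=D^3-t(D+\alpha_0)(D+\alpha_1)(D+\tfrac12)\in\mathscr D_T,$$ and let $V_{\underline\alpha}=\mathscr D_T/\mathscr D_TP_{\underline\alpha}$, with generator $\omega_{\underline\alpha}=1+\mathscr D_TP_{\underline\alpha}$. Let $\mathscr E_{\underline\alpha}\to S$ be the family of elliptic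 curves $$y^2=x(x-1)(x-s),\quad y^2=x^3+(3x+4-4s)^2,\quad y^2=x(x^2-2x+1-s),\quad y^2=4x^3-3x+1-2s$$ in the four cases respectively. Let $Y^2=4X^3-g_2X-g_3$ with $g_2,g_3\in\mathscr O(S)$ be a Weierstrass equation of $\mathscr E_{\underline\alpha}$ obtained by a substitution $X=ux+r$, $Y=vy$ with constants $u,v\in K^\times$ and $r\in\mathscr O(S)$. Then $dX/Y$ extends to a global relative $1$-form on $\mathscr E_{\underline\alpha}/S$, which has a well-defined class $\omega_{\mathscr E}\in H^1_{\mathrm{dR}}(\mathscr E_{\underline\alpha}/S)$. Regard $H^1_{\mathrm{dR}}(\mathscr E_{\underline\alpha}/S)$ as a left $\mathscr D_S$-module by the Gauss--Manin connection, its symmetric square over $\mathscr O(S)$ by the induced connection, and $\mathscr O(S)\otimes_{\mathscr O(T)}V_{\underline\alpha}$ by the pullback connection. Then: 1. there is an isomorphism of left $\mathscr D_S$-modules $\mathscr D_S/\mathscr D_SP_{\alpha_0\alpha_1}\xrightarrow{\ \cong\ }H^1_{\mathrm{dR}}(\mathscr E_{\underline\alpha}/S)$ with $1\mapsto\omega_{\mathscr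 E}$; 2. $\mathscr O(S)\otimes_{\mathscr O(T)}V_{\underline\alpha}$ is generated by $1\otimes\omega_{\underline\alpha}$ as a left $\mathscr D_S$-module, and there is an isomorphism of left $\mathscr D_S$-modules $\mathscr O(S)\otimes_{\mathscr O(T)}V_{\underline\alpha}\xrightarrow{\ \cong\ }\operatorname{Sym}^2H^1_{\mathrm{dR}}(\mathscr E_{\underline\alpha}/S)$ with $1\otimes\omega_{\underline\alpha}\mapsto\omega_{\mathscr E}^2$. -/

import Mathlib

noncomputable section

namespace HGClausen

open Polynomial TensorProduct KaehlerDifferential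

/-! ### Derivations -/

section Derivations

variable {k A : Type*} [CommRing k] [CommRing A] [Algebra k A]

/-- The derivation of `A[X]` that applies `d` to each coefficient. -/
def coeffDer (d : Derivation k A A) : Derivation k A[X] A[X] :=
  PolynomialModule.equivPolynomialSelf.compDer d.mapCoeffs

theorem coeff_coeffDer (d : Derivation k A A) (p : A[X]) (i : ℕ) :
    (coeffDer d p).coeff i = d (p.coeff i) := rfl

theorem coeffDer_C (d : Derivation k A A) (a : A) : coeffDer d (C a) = C (d a) := by
  ext i
  rw [coeff_coeffDer, coeff_C, coeff_C]
  split_ifs <;> simp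

theorem coeffDer_X (d : Derivation k A A) : coeffDer d (X : A[X]) = 0 := by
  ext i
  rw [coeff_coeffDer, coeff_X]
  split_ifs <;> simp

/-- The partial derivative with respect to the inner variable of `A[X][Y]`. -/
def innerDer : Derivation A A[X][X] A[X][X] := coeffDer Polynomial.derivative'

/-- A lift of a derivation `θ` of `A` to an `A`-algebra `B`. -/
structure DerivLift (θ : Derivation k A A) (B : Type*) [CommRing B] [Algebra k B]
    [Algebra A B] where
  toDer : Derivation k B B
  lift_algebraMap : ∀ a : A, toDer (algebraMap A B a) = algebraMap A B (θ a)

/-- The affine plane curve `F = 0` is smooth over `A`: `F` and its two partial derivatives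
generate the unit ideal. -/
def IsSmoothPlane (F : A[X][X]) : Prop :=
  ∃ p q : A[X][X], AdjoinRoot.mk F (p * innerDer F + q * derivative F) = 1

theorem IsSmoothPlane.nonempty_lift {F : A[X][X]} (hF : IsSmoothPlane F)
    (θ : Derivation k A A) : Nonempty (DerivLift θ (AdjoinRoot F)) := by
  obtain ⟨p, q, h⟩ := hF
  let Θ : Derivation k A[X][X] A[X][X] := coeffDer (coeffDer θ)
  let D : Derivation k A[X][X] A[X][X] :=
    Θ - (Θ F * p) • (innerDer (A := A)).restrictScalars k
      - (Θ F * q) • (Polynomial.derivative' (R := A[X])).restrictScalars k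
  have hDF : AdjoinRoot.mk F (D F) = 0 := by
    have : D F = Θ F * (1 - (p * innerDer F + q * derivative F)) := by
      simp only [D, Derivation.sub_apply, Derivation.smul_apply, smul_eq_mul,
        Derivation.restrictScalars_apply]
      change Θ F - Θ F * p * innerDer F - Θ F * q * derivative F = _
      ring
    rw [this, map_mul, map_sub, h, map_one, sub_self, mul_zero]
  let f : A[X][X] →ₐ[k] AdjoinRoot F := (AdjoinRoot.mkₐ F).restrictScalars k
  have hf : Function.Surjective f := AdjoinRoot.mk_surjective
  have hd : ∀ x, f x = 0 → f (D x) = 0 := by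
    intro x hx
    have hx' : AdjoinRoot.mk F x = 0 := hx
    obtain ⟨y, rfl⟩ := AdjoinRoot.mk_eq_zero.1 hx'
    change AdjoinRoot.mk F (D (F * y)) = 0
    rw [Derivation.leibniz, map_add, smul_eq_mul, smul_eq_mul, map_mul, map_mul, hDF,
      AdjoinRoot.mk_self]
    simp
  refine ⟨⟨D.liftOfSurjective hf hd, fun a => ?_⟩⟩
  have h1 : ∀ b : A, algebraMap A (AdjoinRoot F) b = f (C (C b)) := fun b => rfl
  rw [h1, h1, Derivation.liftOfSurjective_apply hf hd]
  congr 1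
  have h2 : Θ (C (C a)) = C (C (θ a)) := by
    simp only [Θ, coeffDer_C]
  have h3 : innerDer (C (C a)) = 0 := by
    simp only [innerDer, coeffDer_C]
    change C (derivative (C a)) = 0
    simp
  have h4 : (Polynomial.derivative' (R := A[X])) (C (C a)) = 0 := by
    change derivative (C (C a)) = 0
    simp
  simp [D, Derivation.sub_apply, h2, h3, h4]

theorem der_mk_eq {F : A[X][X]} {N : Type*} [AddCommGroup N] [Module A N]
    [Module (AdjoinRoot F) N] (δ : Derivation A (AdjoinRoot F) N) (P : A[X][X]) :
    δ (AdjoinRoot.mk F P) = AdjoinRoot.mk F (innerDer P) • δ (AdjoinRoot.of F X)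
      + AdjoinRoot.mk F (derivative P) • δ (AdjoinRoot.root F) := by
  have hmul : ∀ P Q : A[X][X],
      δ (AdjoinRoot.mk F P) = AdjoinRoot.mk F (innerDer P) • δ (AdjoinRoot.of F X)
        + AdjoinRoot.mk F (derivative P) • δ (AdjoinRoot.root F) →
      δ (AdjoinRoot.mk F Q) = AdjoinRoot.mk F (innerDer Q) • δ (AdjoinRoot.of F X)
        + AdjoinRoot.mk F (derivative Q) • δ (AdjoinRoot.root F) →
      δ (AdjoinRoot.mk F (P * Q)) = AdjoinRoot.mk F (innerDer (P * Q)) • δ (AdjoinRoot.of F X)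
        + AdjoinRoot.mk F (derivative (P * Q)) • δ (AdjoinRoot.root F) := by
    intro P Q hP hQ
    rw [map_mul, Derivation.leibniz, hP, hQ, Derivation.leibniz, derivative_mul]
    simp only [smul_eq_mul, map_add, map_mul]
    module
  have hadd : ∀ P Q : A[X][X],
      δ (AdjoinRoot.mk F P) = AdjoinRoot.mk F (innerDer P) • δ (AdjoinRoot.of F X)
        + AdjoinRoot.mk F (derivative P) • δ (AdjoinRoot.root F) →
      δ (AdjoinRoot.mk F Q) = AdjoinRoot.mk F (innerDer Q) • δ (AdjoinRoot.of F X)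
        + AdjoinRoot.mk F (derivative Q) • δ (AdjoinRoot.root F) →
      δ (AdjoinRoot.mk F (P + Q)) = AdjoinRoot.mk F (innerDer (P + Q)) • δ (AdjoinRoot.of F X)
        + AdjoinRoot.mk F (derivative (P + Q)) • δ (AdjoinRoot.root F) := by
    intro P Q hP hQ
    simp only [map_add, hP, hQ]
    module
  have hY : δ (AdjoinRoot.mk F X) = AdjoinRoot.mk F (innerDer X) • δ (AdjoinRoot.of F X)
        + AdjoinRoot.mk F (derivative X) • δ (AdjoinRoot.root F) := by
    simp [innerDer, coeffDer_X]
  have hX : δ (AdjoinRoot.mk F (C X)) =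
      AdjoinRoot.mk F (innerDer (C X)) • δ (AdjoinRoot.of F X)
        + AdjoinRoot.mk F (derivative (C X)) • δ (AdjoinRoot.root F) := by
    have : innerDer (C (X : A[X])) = 1 := by
      simp only [innerDer, coeffDer_C]
      change C (derivative X) = 1
      simp
    simp [this]
  have hA : ∀ a : A, δ (AdjoinRoot.mk F (C (C a))) =
      AdjoinRoot.mk F (innerDer (C (C a))) • δ (AdjoinRoot.of F X)
        + AdjoinRoot.mk F (derivative (C (C a))) • δ (AdjoinRoot.root F) := by
    intro a
    have h1 : innerDer (C (C a)) = 0 := by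
      simp only [innerDer, coeffDer_C]
      change C (derivative (C a)) = 0
      simp
    have h2 : δ (AdjoinRoot.mk F (C (C a))) = 0 := δ.map_algebraMap a
    rw [h1, h2]
    simp
  have hC : ∀ p : A[X], δ (AdjoinRoot.mk F (C p)) =
      AdjoinRoot.mk F (innerDer (C p)) • δ (AdjoinRoot.of F X)
        + AdjoinRoot.mk F (derivative (C p)) • δ (AdjoinRoot.root F) := by
    intro p
    induction p using Polynomial.induction_on with
    | C a => exact hA a
    | add p q hp hq => rw [C_add]; exact hadd _ _ hp hq
    | monomial n a h =>
      rw [pow_succ, ← mul_assoc, C_mul]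
      exact hmul _ _ h hX
  induction P using Polynomial.induction_on with
  | C a => exact hC a
  | add p q hp hq => exact hadd _ _ hp hq
  | monomial n a h =>
    rw [pow_succ, ← mul_assoc]
    exact hmul _ _ h hY

/-- A smooth affine plane curve has relative dimension one: contracting `δ a ∧ δ b` with a
vertical vector field `v` gives zero. -/
theorem IsSmoothPlane.symm {F : A[X][X]} (hF : IsSmoothPlane F) {R N : Type*} [CommRing R]
    [AddCommGroup N] [Algebra A R] [Algebra (AdjoinRoot F) R] [Module A N] [Module R N]
    [Module (AdjoinRoot F) N] [IsScalarTower (AdjoinRoot F) R N]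
    (v : Derivation A (AdjoinRoot F) R) (δ : Derivation A (AdjoinRoot F) N)
    (a b : AdjoinRoot F) : v a • δ b = v b • δ a := by
  obtain ⟨p, q, h⟩ := hF
  have hv := der_mk_eq v F
  have hδ := der_mk_eq δ F
  rw [AdjoinRoot.mk_self, map_zero] at hv hδ
  simp only [Algebra.smul_def] at hv
  have hsm : ∀ (x : AdjoinRoot F) (n : N), x • n = algebraMap (AdjoinRoot F) R x • n :=
    fun x n => (algebraMap_smul R x n).symm
  rw [hsm, hsm] at hδ
  have h1 := congrArg (algebraMap (AdjoinRoot F) R) h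
  simp only [map_add, map_mul, map_one] at h1
  generalize algebraMap (AdjoinRoot F) R (AdjoinRoot.mk F (innerDer F)) = FX at *
  generalize algebraMap (AdjoinRoot F) R (AdjoinRoot.mk F (derivative F)) = FY at *
  generalize algebraMap (AdjoinRoot F) R (AdjoinRoot.mk F p) = P at *
  generalize algebraMap (AdjoinRoot F) R (AdjoinRoot.mk F q) = Q at *
  have key : v (AdjoinRoot.of F X) • δ (AdjoinRoot.root F)
      = v (AdjoinRoot.root F) • δ (AdjoinRoot.of F X) := by
    generalize v (AdjoinRoot.of F X) = vX at *
    generalize v (AdjoinRoot.root F) = vY at *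
    generalize δ (AdjoinRoot.of F X) = dX at *
    generalize δ (AdjoinRoot.root F) = dY at *
    have e1 : vX • dY - vY • dX = (P * FX + Q * FY) • (vX • dY - vY • dX) := by
      rw [h1, one_smul]
    have e2 : (P * FX + Q * FY) • (vX • dY - vY • dX) =
        (FX * vX + FY * vY) • (P • dY - Q • dX)
          + (Q * vX - P * vY) • (FX • dX + FY • dY) := by
      module
    rw [← hv, ← hδ, zero_smul, smul_zero, add_zero] at e2
    exact sub_eq_zero.1 (e1.trans e2)
  obtain ⟨a, rfl⟩ := AdjoinRoot.mk_surjective a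
  obtain ⟨b, rfl⟩ := AdjoinRoot.mk_surjective b
  rw [der_mk_eq v a, der_mk_eq v b, der_mk_eq δ a, der_mk_eq δ b]
  simp only [Algebra.smul_def, hsm]
  generalize algebraMap (AdjoinRoot F) R (AdjoinRoot.mk F (innerDer a)) = aX
  generalize algebraMap (AdjoinRoot F) R (AdjoinRoot.mk F (derivative a)) = aY
  generalize algebraMap (AdjoinRoot F) R (AdjoinRoot.mk F (innerDer b)) = bX
  generalize algebraMap (AdjoinRoot F) R (AdjoinRoot.mk F (derivative b)) = bY
  generalize v (AdjoinRoot.of F X) = vX at *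
  generalize v (AdjoinRoot.root F) = vY at *
  generalize δ (AdjoinRoot.of F X) = dX at *
  generalize δ (AdjoinRoot.root F) = dY at *
  have e : (aX * vX + aY * vY) • (bX • dX + bY • dY) - (bX * vX + bY * vY) • (aX • dX + aY • dY)
      = (aX * bY - aY * bX) • (vX • dY - vY • dX) := by module
  rw [key, sub_self, smul_zero] at e
  exact sub_eq_zero.1 e

theorem exists_localizeDer (f : A) (L : Type*) [CommRing L] [Algebra A L] [Algebra k L]
    [IsScalarTower k A L] [IsLocalization.Away f L] (d : Derivation k A A) :
    ∃ D : Derivation k L L, ∀ a, D (algebraMap A L a) = algebraMap A L (d a) := by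
  let φ₀ : A →+* TrivSqZeroExt L L :=
    { toFun := fun a => (algebraMap A L a, algebraMap A L (d a))
      map_one' := TrivSqZeroExt.ext (map_one (algebraMap A L)) (by
        change algebraMap A L (d 1) = 0
        rw [d.map_one_eq_zero, map_zero])
      map_zero' := TrivSqZeroExt.ext (map_zero (algebraMap A L)) (by
        change algebraMap A L (d 0) = 0
        rw [map_zero, map_zero])
      map_mul' := fun a b => TrivSqZeroExt.ext (map_mul (algebraMap A L) a b) (by
        change algebraMap A L (d (a * b)) = algebraMap A L a * algebraMap A L (d b)
          + algebraMap A L (d a) * algebraMap A L b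
        rw [d.leibniz, map_add, smul_eq_mul, smul_eq_mul, map_mul, map_mul]
        ring)
      map_add' := fun a b => TrivSqZeroExt.ext (map_add (algebraMap A L) a b) (by
        change algebraMap A L (d (a + b)) = algebraMap A L (d a) + algebraMap A L (d b)
        rw [map_add, map_add]) }
  have h1 : ∀ a, (φ₀ a).fst = algebraMap A L a := fun a => rfl
  have h2 : ∀ a, (φ₀ a).snd = algebraMap A L (d a) := fun a => rfl
  clear_value φ₀
  have hu : IsUnit (φ₀ f) := by
    rw [TrivSqZeroExt.isUnit_iff_isUnit_fst, h1]
    exact IsLocalization.Away.algebraMap_isUnit f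
  let φ : L →+* TrivSqZeroExt L L := IsLocalization.Away.lift f hu
  have hφ : ∀ a, φ (algebraMap A L a) = φ₀ a := fun a => IsLocalization.Away.lift_eq f hu a
  clear_value φ
  have hfst : ∀ x, (φ x).fst = x := by
    have : (TrivSqZeroExt.fstHom L L L).toRingHom.comp φ = RingHom.id L := by
      refine IsLocalization.ringHom_ext (Submonoid.powers f) (RingHom.ext fun a => ?_)
      change (φ (algebraMap A L a)).fst = algebraMap A L a
      rw [hφ, h1]
    intro x
    exact congrArg (fun g => g x) this
  refine ⟨Derivation.mk'
    { toFun := fun x => (φ x).snd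
      map_add' := fun x y => by rw [map_add, TrivSqZeroExt.snd_add]
      map_smul' := fun c x => ?_ } ?_, fun a => ?_⟩
  · rw [Algebra.smul_def, IsScalarTower.algebraMap_apply k A L c, map_mul, TrivSqZeroExt.snd_mul,
      hφ, h1, h2, d.map_algebraMap, map_zero, RingHom.id_apply, algebra_compatible_smul L c,
      IsScalarTower.algebraMap_apply k A L c]
    simp
  · intro x y
    change (φ (x * y)).snd = x • (φ y).snd + y • (φ x).snd
    rw [map_mul, TrivSqZeroExt.snd_mul, hfst, hfst]
    simp [mul_comm]
  · change (φ (algebraMap A L a)).snd = _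
    rw [hφ, h2]

/-- The unique extension of a derivation to the localization away from one element. -/
def localizeDer (f : A) (d : Derivation k A A) :
    Derivation k (Localization.Away f) (Localization.Away f) :=
  (exists_localizeDer f (Localization.Away f) d).choose

theorem localizeDer_algebraMap (f : A) (d : Derivation k A A) (a : A) :
    localizeDer f d (algebraMap A (Localization.Away f) a)
      = algebraMap A (Localization.Away f) (d a) :=
  (exists_localizeDer f (Localization.Away f) d).choose_spec a

end Derivations

/-! ### Connections along a derivation, and modules over rings of differential operators -/

section Connections

variable {k A : Type*} [CommRing k] [CommRing A] [Algebra k A]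

/-- A connection on the `A`-module `M` along the derivation `θ`: an additive map satisfying the
Leibniz rule. -/
structure Connection (θ : Derivation k A A) (M : Type*) [AddCommGroup M] [Module A M] where
  toHom : M →+ M
  leibniz : ∀ (a : A) (m : M), toHom (a • m) = a • toHom m + θ a • m

/-- The defining relations of the ring `A⟨∂⟩`; `some a` is the generator attached to `a : A`
and `none` is the generator `∂`. -/
inductive DiffOp.Rel (θ : Derivation k A A) :
    FreeAlgebra ℤ (Option A) → FreeAlgebra ℤ (Option A) → Prop
  | one : DiffOp.Rel θ (FreeAlgebra.ι ℤ (some 1)) 1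
  | add (a b : A) : DiffOp.Rel θ (FreeAlgebra.ι ℤ (some (a + b)))
      (FreeAlgebra.ι ℤ (some a) + FreeAlgebra.ι ℤ (some b))
  | mul (a b : A) : DiffOp.Rel θ (FreeAlgebra.ι ℤ (some (a * b)))
      (FreeAlgebra.ι ℤ (some a) * FreeAlgebra.ι ℤ (some b))
  | comm (a : A) : DiffOp.Rel θ (FreeAlgebra.ι ℤ none * FreeAlgebra.ι ℤ (some a))
      (FreeAlgebra.ι ℤ (some a) * FreeAlgebra.ι ℤ none + FreeAlgebra.ι ℤ (some (θ a)))

/-- The ring `A⟨∂⟩` of differential operators generated by `A` and `∂`, subject to the relations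
of `A` and `∂ a = a ∂ + θ(a)`. -/
def DiffOp (θ : Derivation k A A) : Type _ := RingQuot (DiffOp.Rel θ)

namespace DiffOp

variable (θ : Derivation k A A)

instance : Ring (DiffOp θ) := inferInstanceAs (Ring (RingQuot (DiffOp.Rel θ)))

/-- The quotient map from the free ring. -/
def mk : FreeAlgebra ℤ (Option A) →+* DiffOp θ := RingQuot.mkRingHom (DiffOp.Rel θ)

/-- The operator `∂`. -/
def partial_ : DiffOp θ := mk θ (FreeAlgebra.ι ℤ none)

/-- The operators of order zero. -/
def coeff : A →+* DiffOp θ where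
  toFun a := mk θ (FreeAlgebra.ι ℤ (some a))
  map_one' := (RingQuot.mkRingHom_rel (DiffOp.Rel.one (θ := θ))).trans (map_one _)
  map_mul' a b := (RingQuot.mkRingHom_rel (DiffOp.Rel.mul (θ := θ) a b)).trans (map_mul _ _ _)
  map_add' a b := (RingQuot.mkRingHom_rel (DiffOp.Rel.add (θ := θ) a b)).trans (map_add _ _ _)
  map_zero' := by
    have h := (RingQuot.mkRingHom_rel (DiffOp.Rel.add (θ := θ) 0 0)).trans (map_add _ _ _)
    rw [add_zero] at h
    exact left_eq_add.1 h

theorem partial_mul_coeff (a : A) :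
    partial_ θ * coeff θ a = coeff θ a * partial_ θ + coeff θ (θ a) := by
  have h := RingQuot.mkRingHom_rel (DiffOp.Rel.comm (θ := θ) a)
  rw [map_mul, map_add, map_mul] at h
  exact h

instance : Module A (DiffOp θ) := Module.compHom _ (coeff θ)

theorem smul_def (a : A) (x : DiffOp θ) : a • x = coeff θ a * x := rfl

instance : IsScalarTower A (DiffOp θ) (DiffOp θ) :=
  ⟨fun a x y => by simp only [smul_def, smul_eq_mul, mul_assoc]⟩

variable {θ}

/-- The generators of `A⟨∂⟩` as additive endomorphisms of a module with connection. -/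
def actionGen {M : Type*} [AddCommGroup M] [Module A M] (c : Connection θ M) :
    Option A → AddMonoid.End M
  | none => c.toHom
  | some a => DistribSMul.toAddMonoidHom M a

/-- The action of `A⟨∂⟩` on a module with connection: `A` acts by scalars and `∂` by the
connection. -/
def action {M : Type*} [AddCommGroup M] [Module A M] (c : Connection θ M) :
    DiffOp θ →+* AddMonoid.End M :=
  RingQuot.lift ⟨((FreeAlgebra.lift ℤ (actionGen c) :
      FreeAlgebra ℤ (Option A) →ₐ[ℤ] AddMonoid.End M) : FreeAlgebra ℤ (Option A) →+* _), by
    intro x y h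
    change FreeAlgebra.lift ℤ (actionGen c) x = FreeAlgebra.lift ℤ (actionGen c) y
    cases h with
    | one =>
      rw [map_one, FreeAlgebra.lift_ι_apply]
      exact AddMonoidHom.ext fun m => one_smul A m
    | add a b =>
      rw [map_add]
      simp only [FreeAlgebra.lift_ι_apply]
      exact AddMonoidHom.ext fun m => add_smul a b m
    | mul a b =>
      rw [map_mul]
      simp only [FreeAlgebra.lift_ι_apply]
      exact AddMonoidHom.ext fun m => mul_smul a b m
    | comm a =>
      rw [map_mul, map_add, map_mul]
      simp only [FreeAlgebra.lift_ι_apply]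
      exact AddMonoidHom.ext fun m => c.leibniz a m⟩

theorem action_partial {M : Type*} [AddCommGroup M] [Module A M] (c : Connection θ M) (m : M) :
    action c (partial_ θ) m = c.toHom m := by
  have : action c (partial_ θ) = actionGen c none :=
    (RingQuot.lift_mkRingHom_apply _ _ _).trans (FreeAlgebra.lift_ι_apply _ _)
  rw [this]
  rfl

theorem action_coeff {M : Type*} [AddCommGroup M] [Module A M] (c : Connection θ M) (a : A)
    (m : M) : action c (coeff θ a) m = a • m := by
  have : action c (coeff θ a) = actionGen c (some a) :=
    (RingQuot.lift_mkRingHom_apply _ _ _).trans (FreeAlgebra.lift_ι_apply _ _)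
  rw [this]
  rfl

/-- The left `A⟨∂⟩`-module attached to a module with connection. -/
abbrev module {M : Type*} [AddCommGroup M] [Module A M] (c : Connection θ M) :
    Module (DiffOp θ) M := Module.compHom M (action c)

end DiffOp

/-- The connection of a left `A⟨∂⟩`-module. -/
def Connection.ofDiffOp (θ : Derivation k A A) (M : Type*) [AddCommGroup M] [Module A M]
    [Module (DiffOp θ) M] [IsScalarTower A (DiffOp θ) M] : Connection θ M where
  toHom := DistribSMul.toAddMonoidHom M (DiffOp.partial_ θ)
  leibniz a m := by
    have h : ∀ (b : A) (n : M), b • n = DiffOp.coeff θ b • n := fun b n => by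
      rw [← one_smul (DiffOp θ) n, ← smul_assoc, DiffOp.smul_def, mul_one, one_smul]
    simp only [DistribSMul.toAddMonoidHom_apply, h, ← mul_smul, ← add_smul,
      DiffOp.partial_mul_coeff]

/-- The pullback connection on `A' ⊗ M`: `∇(f ⊗ m) = f ⊗ ∇ m + θ'(f) ⊗ m`. -/
def Connection.baseChange {A' : Type*} [CommRing A'] [Algebra k A'] [Algebra A A']
    {θ : Derivation k A A} {M : Type*} [AddCommGroup M] [Module A M] (c : Connection θ M)
    (θ' : Derivation k A' A') (h : ∀ a, θ' (algebraMap A A' a) = algebraMap A A' (θ a)) :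
    Connection θ' (A' ⊗[A] M) where
  toHom := TensorProduct.liftAddHom
    { toFun := fun f =>
        { toFun := fun m => f ⊗ₜ[A] c.toHom m + θ' f ⊗ₜ[A] m
          map_zero' := by simp
          map_add' := fun m n => by
            simp only [map_add, tmul_add]
            abel }
      map_zero' := by ext; simp
      map_add' := fun f g => by
        ext m
        simp only [map_add, add_tmul, AddMonoidHom.coe_mk, ZeroHom.coe_mk, AddMonoidHom.add_apply]
        abel }
    (fun a f m => by
      have h1 : θ' (a • f) = a • θ' f + θ a • f := by
        rw [Algebra.smul_def, Derivation.leibniz, h, smul_eq_mul, smul_eq_mul, mul_comm f,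
          Algebra.smul_def, Algebra.smul_def]
      simp only [AddMonoidHom.coe_mk, ZeroHom.coe_mk, c.leibniz, tmul_add, tmul_smul, h1,
        add_tmul, smul_tmul']
      abel)
  leibniz f x := by
    induction x using TensorProduct.induction_on with
    | zero => simp
    | add x y hx hy =>
      simp only [smul_add, map_add, hx, hy]
      abel
    | tmul g m =>
      simp only [smul_tmul', smul_eq_mul, liftAddHom_tmul, AddMonoidHom.coe_mk, ZeroHom.coe_mk,
        Derivation.leibniz, add_tmul, smul_add, mul_comm g]
      abel

/-- The module `N × N` with `a • (x, y) = (a x, a y + θ(a) x)`: additive maps `∇ : M → N` that are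
Leibniz over a linear map `M → N` are linear maps into it. -/
def Twist (_θ : Derivation k A A) (N : Type*) : Type _ := N × N

namespace Twist

variable (θ : Derivation k A A) (N : Type*) [AddCommGroup N] [Module A N]

instance : AddCommGroup (Twist θ N) := inferInstanceAs (AddCommGroup (N × N))

instance : Module A (Twist θ N) where
  smul a p := (a • p.1, a • p.2 + θ a • p.1)
  one_smul p := Prod.ext (one_smul A p.1) (by
    change (1 : A) • p.2 + θ 1 • p.1 = p.2
    simp)
  mul_smul a b p := Prod.ext (mul_smul a b p.1) (by
    change (a * b) • p.2 + θ (a * b) • p.1 = a • (b • p.2 + θ b • p.1) + θ a • b • p.1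
    rw [Derivation.leibniz, smul_eq_mul, smul_eq_mul]
    module)
  smul_zero a := Prod.ext (smul_zero a) (by
    change a • (0 : N) + θ a • (0 : N) = 0
    simp)
  smul_add a p q := Prod.ext (smul_add a p.1 q.1) (by
    change a • (p.2 + q.2) + θ a • (p.1 + q.1) = a • p.2 + θ a • p.1 + (a • q.2 + θ a • q.1)
    module)
  add_smul a b p := Prod.ext (add_smul a b p.1) (by
    change (a + b) • p.2 + θ (a + b) • p.1 = a • p.2 + θ a • p.1 + (b • p.2 + θ b • p.1)
    rw [map_add]
    module)
  zero_smul p := Prod.ext (zero_smul A p.1) (by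
    change (0 : A) • p.2 + θ 0 • p.1 = 0
    simp)

/-- The two components, as additive maps. -/
def fstHom : Twist θ N →+ N := AddMonoidHom.fst N N
/-- The two components, as additive maps. -/
def sndHom : Twist θ N →+ N := AddMonoidHom.snd N N

end Twist

end Connections

/-! ### The symmetric square of a module with connection -/

section SymSq

variable {A : Type} [CommRing A] {M : Type*} [AddCommGroup M] [Module A M]

/-- The product of two elements in the symmetric square. -/
def symMul (x y : M) : Sym[A]^2 M := SymmetricPower.tprod A ![x, y]

theorem symMul_comm (x y : M) : symMul (A := A) x y = symMul y x := by
  have := SymmetricPower.tprod_equiv (R := A) (Equiv.swap (0 : Fin 2) 1) ![y, x]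
  rw [symMul, symMul, ← this]
  congr 1
  ext i
  fin_cases i <;> simp

theorem symMul_add (x y z : M) : symMul (A := A) (x + y) z = symMul x z + symMul y z :=
  (SymmetricPower.tprod A (M := M)).cons_add ![z] x y

theorem symMul_smul (a : A) (x z : M) : symMul (A := A) (a • x) z = a • symMul x z :=
  (SymmetricPower.tprod A (M := M)).cons_smul ![z] a x

theorem add_symMul (x y z : M) : symMul (A := A) z (x + y) = symMul z x + symMul z y := by
  rw [symMul_comm, symMul_add, symMul_comm x, symMul_comm y]

theorem smul_symMul (a : A) (x z : M) : symMul (A := A) z (a • x) = a • symMul z x := by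
  rw [symMul_comm, symMul_smul, symMul_comm x]

theorem tprod_two (m : Fin 2 → M) : SymmetricPower.tprod A m = symMul (m 0) (m 1) := by
  rw [symMul]
  congr 1
  ext i
  fin_cases i <;> simp

variable {k : Type*} [CommRing k] [Algebra k A] {θ : Derivation k A A}

/-- `(x, y) ↦ (x y, ∇x y + x ∇y)` as a multilinear map. -/
def symSqMulti (c : Connection θ M) :
    MultilinearMap A (fun _ : Fin 2 => M) (Twist θ (Sym[A]^2 M)) where
  toFun m := (symMul (m 0) (m 1),
    symMul (c.toHom (m 0)) (m 1) + symMul (m 0) (c.toHom (m 1)))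
  map_update_add' {dec} m i x y := by
    rw [Subsingleton.elim dec (instDecidableEqFin 2)]
    fin_cases i
    · refine Prod.ext ?_ ?_
      · change symMul (x + y) (m 1) = symMul x (m 1) + symMul y (m 1)
        rw [symMul_add]
      · change symMul (c.toHom (x + y)) (m 1) + symMul (x + y) (c.toHom (m 1)) =
          (symMul (c.toHom x) (m 1) + symMul x (c.toHom (m 1)))
            + (symMul (c.toHom y) (m 1) + symMul y (c.toHom (m 1)))
        simp only [map_add, symMul_add]
        abel
    · refine Prod.ext ?_ ?_
      · change symMul (m 0) (x + y) = symMul (m 0) x + symMul (m 0) y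
        rw [add_symMul]
      · change symMul (c.toHom (m 0)) (x + y) + symMul (m 0) (c.toHom (x + y)) =
          (symMul (c.toHom (m 0)) x + symMul (m 0) (c.toHom x))
            + (symMul (c.toHom (m 0)) y + symMul (m 0) (c.toHom y))
        simp only [map_add, add_symMul]
        abel
  map_update_smul' {dec} m i a x := by
    rw [Subsingleton.elim dec (instDecidableEqFin 2)]
    fin_cases i
    · refine Prod.ext ?_ ?_
      · change symMul (a • x) (m 1) = a • symMul x (m 1)
        rw [symMul_smul]
      · change symMul (c.toHom (a • x)) (m 1) + symMul (a • x) (c.toHom (m 1)) =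
          a • (symMul (c.toHom x) (m 1) + symMul x (c.toHom (m 1))) + θ a • symMul x (m 1)
        simp only [c.leibniz, symMul_add, symMul_smul]
        module
    · refine Prod.ext ?_ ?_
      · change symMul (m 0) (a • x) = a • symMul (m 0) x
        rw [smul_symMul]
      · change symMul (c.toHom (m 0)) (a • x) + symMul (m 0) (c.toHom (a • x)) =
          a • (symMul (c.toHom (m 0)) x + symMul (m 0) (c.toHom x)) + θ a • symMul (m 0) x
        simp only [c.leibniz, add_symMul, smul_symMul]
        module

/-- The map `x y ↦ (x y, ∇x y + x ∇y)` on the symmetric square. -/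
def symSqHom (c : Connection θ M) : Sym[A]^2 M →+ Twist θ (Sym[A]^2 M) :=
  AddCon.lift (addConGen (SymmetricPower.Rel A (Fin 2) M))
    (PiTensorProduct.lift (symSqMulti c)).toAddMonoidHom (by
      refine AddCon.addConGen_le.2 ?_
      rintro _ _ ⟨e, f⟩
      rw [AddCon.ker_rel, LinearMap.toAddMonoidHom_coe, PiTensorProduct.lift.tprod,
        PiTensorProduct.lift.tprod]
      have h2 : (e 0 = 0 ∧ e 1 = 1) ∨ (e 0 = 1 ∧ e 1 = 0) := by
        have h := e.injective.ne (show (0 : Fin 2) ≠ 1 by decide)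
        generalize e 0 = i at *
        generalize e 1 = j at *
        revert i j
        decide
      refine Prod.ext ?_ ?_
      · change symMul (f 0) (f 1) = symMul (f (e 0)) (f (e 1))
        rcases h2 with ⟨h0, h1⟩ | ⟨h0, h1⟩
        · rw [h0, h1]
        · rw [h0, h1, symMul_comm]
      · change symMul (c.toHom (f 0)) (f 1) + symMul (f 0) (c.toHom (f 1))
          = symMul (c.toHom (f (e 0))) (f (e 1)) + symMul (f (e 0)) (c.toHom (f (e 1)))
        rcases h2 with ⟨h0, h1⟩ | ⟨h0, h1⟩
        · rw [h0, h1]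
        · rw [h0, h1, symMul_comm, add_comm, symMul_comm (f 0)])

theorem symSqHom_mk (c : Connection θ M) (x : ⨂[A] _ : Fin 2, M) :
    symSqHom c (SymmetricPower.mk A (Fin 2) M x) = PiTensorProduct.lift (symSqMulti c) x := rfl

theorem symSqHom_smul (c : Connection θ M) (a : A) (x : Sym[A]^2 M) :
    symSqHom c (a • x) = a • symSqHom c x := by
  obtain ⟨x, rfl⟩ := LinearMap.range_eq_top.1 (SymmetricPower.range_mk A (Fin 2) M) x
  rw [← map_smul, symSqHom_mk, symSqHom_mk, map_smul]

theorem symSqHom_fst (c : Connection θ M) (x : Sym[A]^2 M) : (symSqHom c x).1 = x := by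
  obtain ⟨x, rfl⟩ := LinearMap.range_eq_top.1 (SymmetricPower.range_mk A (Fin 2) M) x
  rw [symSqHom_mk]
  induction x using PiTensorProduct.induction_on with
  | smul_tprod r f =>
    rw [map_smul, map_smul, PiTensorProduct.lift.tprod]
    change r • symMul (f 0) (f 1) = r • SymmetricPower.tprod A f
    rw [tprod_two]
  | add x y hx hy =>
    rw [map_add, map_add]
    exact congrArg₂ (· + ·) hx hy

/-- The connection on the symmetric square: `∇(x y) = ∇x y + x ∇y`. -/
def Connection.symSq (c : Connection θ M) : Connection θ (Sym[A]^2 M) where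
  toHom := (Twist.sndHom θ _).comp (symSqHom c)
  leibniz a x := by
    change (symSqHom c (a • x)).2 = a • (symSqHom c x).2 + θ a • x
    rw [symSqHom_smul]
    change a • (symSqHom c x).2 + θ a • (symSqHom c x).1 = _
    rw [symSqHom_fst]

theorem Connection.symSq_symMul (c : Connection θ M) (x y : M) :
    c.symSq.toHom (symMul x y) = symMul (c.toHom x) y + symMul x (c.toHom y) := by
  change (PiTensorProduct.lift (symSqMulti c) (PiTensorProduct.tprod A ![x, y])).2 = _
  rw [PiTensorProduct.lift.tprod]
  rfl

end SymSq

/-! ### Lie derivatives of relative differential forms -/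

section Lie

variable {k A : Type*} [CommRing k] [CommRing A] [Algebra k A] {θ : Derivation k A A}
variable {B : Type*} [CommRing B] [Algebra k B] [Algebra A B]

namespace DerivLift

/-- `b dc ↦ (b dc, L(b) dc + b d(L c))`. -/
def lieTwist (L : DerivLift θ B) : Ω[B⁄A] →ₗ[B] Twist L.toDer (Ω[B⁄A]) :=
  letI : Module A (Twist L.toDer (Ω[B⁄A])) := Module.compHom _ (algebraMap A B)
  haveI : IsScalarTower A B (Twist L.toDer (Ω[B⁄A])) :=
    ⟨fun a b x => by
      rw [Algebra.smul_def, mul_smul]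
      rfl⟩
  Derivation.liftKaehlerDifferential (Derivation.mk'
    { toFun := fun b => ((D A B b, D A B (L.toDer b)) : Ω[B⁄A] × Ω[B⁄A])
      map_add' := fun b c => by
        simp only [map_add]
        rfl
      map_smul' := fun a b => by
        refine Prod.ext ?_ ?_
        · change D A B (a • b) = algebraMap A B a • D A B b
          rw [Derivation.map_smul, algebraMap_smul]
        · change D A B (L.toDer (a • b)) = algebraMap A B a • D A B (L.toDer b)
            + L.toDer (algebraMap A B a) • D A B b
          rw [Algebra.smul_def, Derivation.leibniz, L.lift_algebraMap, map_add]
          simp only [smul_eq_mul, Derivation.leibniz, Derivation.map_algebraMap, smul_zero,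
            add_zero, zero_add] }
    (fun b c => by
      refine Prod.ext ?_ ?_
      · change D A B (b * c) = b • D A B c + c • D A B b
        rw [Derivation.leibniz]
      · change D A B (L.toDer (b * c)) = (b • D A B (L.toDer c) + L.toDer b • D A B c)
          + (c • D A B (L.toDer b) + L.toDer c • D A B b)
        simp only [Derivation.leibniz, map_add, smul_eq_mul]
        abel))

/-- The Lie derivative of relative forms along a lift `L` of `θ`:
`b dc ↦ L(b) dc + b d(L c)`. -/
def lie (L : DerivLift θ B) : Ω[B⁄A] →+ Ω[B⁄A] :=
  (Twist.sndHom L.toDer _).comp L.lieTwist.toAddMonoidHom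

theorem lieTwist_D (L : DerivLift θ B) (b : B) :
    L.lieTwist (D A B b) = (D A B b, D A B (L.toDer b)) := by
  let _ : Module A (Twist L.toDer (Ω[B⁄A])) := Module.compHom _ (algebraMap A B)
  have : IsScalarTower A B (Twist L.toDer (Ω[B⁄A])) :=
    ⟨fun a b x => by
      rw [Algebra.smul_def, mul_smul]
      rfl⟩
  exact Derivation.liftKaehlerDifferential_comp_D _ b

theorem lie_D (L : DerivLift θ B) (b : B) : L.lie (D A B b) = D A B (L.toDer b) := by
  change (L.lieTwist (D A B b)).2 = _
  rw [lieTwist_D]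

theorem lieTwist_fst (L : DerivLift θ B) (w : Ω[B⁄A]) : (L.lieTwist w).1 = w := by
  have hw : w ∈ Submodule.span B (Set.range (D A B)) := by
    rw [span_range_derivation]
    trivial
  induction hw using Submodule.span_induction with
  | mem x h =>
    obtain ⟨b, rfl⟩ := h
    rw [lieTwist_D]
  | zero =>
    rw [map_zero]
    rfl
  | add x y _ _ hx hy =>
    rw [map_add]
    exact congrArg₂ (· + ·) hx hy
  | smul b x _ hx =>
    rw [map_smul]
    exact congrArg (b • ·) hx

theorem lie_smul (L : DerivLift θ B) (b : B) (w : Ω[B⁄A]) :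
    L.lie (b • w) = b • L.lie w + L.toDer b • w := by
  change (L.lieTwist (b • w)).2 = b • (L.lieTwist w).2 + L.toDer b • w
  rw [map_smul]
  change b • (L.lieTwist w).2 + L.toDer b • (L.lieTwist w).1 = _
  rw [lieTwist_fst]

end DerivLift

end Lie

/-! ### Čech–de Rham cohomology of a curve covered by two affine charts -/

section Cech

variable (A B₀ B₁ B₀₁ : Type*) [CommRing A] [CommRing B₀] [CommRing B₁] [CommRing B₀₁]
  [Algebra A B₀] [Algebra A B₁] [Algebra A B₀₁] [Algebra B₀ B₀₁] [Algebra B₁ B₀₁]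
  [IsScalarTower A B₀ B₀₁] [IsScalarTower A B₁ B₀₁]

/-- `(ω₀, ω₁, f) ↦ ω₁ - ω₀ - df`, on the overlap. -/
def cechD₁ : (Ω[B₀⁄A] × Ω[B₁⁄A] × B₀₁) →ₗ[A] Ω[B₀₁⁄A] where
  toFun c := KaehlerDifferential.map A A B₁ B₀₁ c.2.1 - KaehlerDifferential.map A A B₀ B₀₁ c.1
    - D A B₀₁ c.2.2
  map_add' c c' := by
    simp only [Prod.fst_add, Prod.snd_add, map_add]
    abel
  map_smul' a c := by
    simp only [Prod.smul_fst, Prod.smul_snd, LinearMap.map_smul_of_tower,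
      Derivation.map_smul, RingHom.id_apply, smul_sub]

/-- The degree one cocycles of the total Čech–de Rham complex of the cover: triples
`(ω₀, ω₁, f)` of a relative form on each chart and a function on the overlap with `ω₁ - ω₀ = df`.
In relative dimension one there are no 2-forms, so `ω₀` and `ω₁` are closed. -/
def CechCocycle : Submodule A (Ω[B₀⁄A] × Ω[B₁⁄A] × B₀₁) := LinearMap.ker (cechD₁ A B₀ B₁ B₀₁)

variable {A B₀ B₁ B₀₁} in
theorem mem_cechCocycle (c : Ω[B₀⁄A] × Ω[B₁⁄A] × B₀₁) : c ∈ CechCocycle A B₀ B₁ B₀₁ ↔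
    KaehlerDifferential.map A A B₁ B₀₁ c.2.1 - KaehlerDifferential.map A A B₀ B₀₁ c.1
      = D A B₀₁ c.2.2 := by
  rw [CechCocycle, LinearMap.mem_ker, ← sub_eq_zero (b := D A B₀₁ c.2.2)]
  rfl

/-- `(g₀, g₁) ↦ (dg₀, dg₁, g₁ - g₀)`. -/
def cechD₀ : (B₀ × B₁) →ₗ[A] CechCocycle A B₀ B₁ B₀₁ where
  toFun g := ⟨(D A B₀ g.1, D A B₁ g.2, algebraMap B₁ B₀₁ g.2 - algebraMap B₀ B₀₁ g.1), by
    rw [mem_cechCocycle]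
    simp only [KaehlerDifferential.map_D, map_sub]⟩
  map_add' g h := Subtype.ext (by
    refine Prod.ext ?_ (Prod.ext ?_ ?_)
    · exact map_add _ _ _
    · exact map_add _ _ _
    · change algebraMap B₁ B₀₁ (g.2 + h.2) - algebraMap B₀ B₀₁ (g.1 + h.1)
        = (algebraMap B₁ B₀₁ g.2 - algebraMap B₀ B₀₁ g.1)
          + (algebraMap B₁ B₀₁ h.2 - algebraMap B₀ B₀₁ h.1)
      rw [map_add, map_add]
      ring)
  map_smul' a g := Subtype.ext (by
    refine Prod.ext ?_ (Prod.ext ?_ ?_)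
    · exact Derivation.map_smul _ _ _
    · exact Derivation.map_smul _ _ _
    · change algebraMap B₁ B₀₁ (a • g.2) - algebraMap B₀ B₀₁ (a • g.1)
        = a • (algebraMap B₁ B₀₁ g.2 - algebraMap B₀ B₀₁ g.1)
      rw [← IsScalarTower.coe_toAlgHom' A B₁ B₀₁, ← IsScalarTower.coe_toAlgHom' A B₀ B₀₁,
        map_smul, map_smul, smul_sub])

/-- The first Čech–de Rham cohomology of the cover. -/
def CechH1 : Type _ := CechCocycle A B₀ B₁ B₀₁ ⧸ LinearMap.range (cechD₀ A B₀ B₁ B₀₁)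

instance : AddCommGroup (CechH1 A B₀ B₁ B₀₁) :=
  inferInstanceAs (AddCommGroup (CechCocycle A B₀ B₁ B₀₁ ⧸ LinearMap.range (cechD₀ A B₀ B₁ B₀₁)))

instance : Module A (CechH1 A B₀ B₁ B₀₁) :=
  inferInstanceAs (Module A (CechCocycle A B₀ B₁ B₀₁ ⧸ LinearMap.range (cechD₀ A B₀ B₁ B₀₁)))

variable {A B₀ B₁ B₀₁}

/-- The cohomology class of a cocycle. -/
def cechClass : CechCocycle A B₀ B₁ B₀₁ →ₗ[A] CechH1 A B₀ B₁ B₀₁ := Submodule.mkQ _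

variable {k : Type*} [CommRing k] [Algebra k A] [Algebra k B₀] [Algebra k B₁] [Algebra k B₀₁]
  {θ : Derivation k A A}

/-- The vertical vector field `L₁ - L₀₁`, for lifts `L₁`, `L₀₁` of `θ` to a chart and to the
overlap. -/
def vertDiff (L₁ : DerivLift θ B₁) (L₀₁ : DerivLift θ B₀₁) : Derivation A B₁ B₀₁ :=
  Derivation.mk'
    { toFun := fun b => algebraMap B₁ B₀₁ (L₁.toDer b) - L₀₁.toDer (algebraMap B₁ B₀₁ b)
      map_add' := fun b c => by
        simp only [map_add]
        ring
      map_smul' := fun a b => by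
        rw [Algebra.smul_def, map_mul (algebraMap B₁ B₀₁), Derivation.leibniz, Derivation.leibniz,
          L₁.lift_algebraMap,
          ← IsScalarTower.algebraMap_apply A B₁ B₀₁, L₀₁.lift_algebraMap, RingHom.id_apply,
          Algebra.smul_def a]
        simp only [smul_eq_mul, map_add, map_mul, ← IsScalarTower.algebraMap_apply A B₁ B₀₁]
        ring }
    (fun b c => by
      simp only [LinearMap.coe_mk, AddHom.coe_mk, map_mul, Derivation.leibniz,
        smul_eq_mul, map_add]
      rw [Algebra.smul_def, Algebra.smul_def]
      ring)

theorem vertDiff_apply (L₁ : DerivLift θ B₁) (L₀₁ : DerivLift θ B₀₁) (b : B₁) :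
    vertDiff L₁ L₀₁ b = algebraMap B₁ B₀₁ (L₁.toDer b) - L₀₁.toDer (algebraMap B₁ B₀₁ b) := rfl

/-- Contraction of relative forms with `L₁ - L₀₁`. -/
def contract (L₁ : DerivLift θ B₁) (L₀₁ : DerivLift θ B₀₁) : Ω[B₁⁄A] →ₗ[B₁] B₀₁ :=
  (vertDiff L₁ L₀₁).liftKaehlerDifferential

theorem contract_D (L₁ : DerivLift θ B₁) (L₀₁ : DerivLift θ B₀₁) (b : B₁) :
    contract L₁ L₀₁ (D A B₁ b) = vertDiff L₁ L₀₁ b :=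
  Derivation.liftKaehlerDifferential_comp_D _ b

theorem map_lie (L₁ : DerivLift θ B₁) (L₀₁ : DerivLift θ B₀₁)
    (h : ∀ b, L₀₁.toDer (algebraMap B₁ B₀₁ b) = algebraMap B₁ B₀₁ (L₁.toDer b)) (w : Ω[B₁⁄A]) :
    KaehlerDifferential.map A A B₁ B₀₁ (L₁.lie w)
      = L₀₁.lie (KaehlerDifferential.map A A B₁ B₀₁ w) := by
  have hw : w ∈ Submodule.span B₁ (Set.range (D A B₁)) := by
    rw [span_range_derivation]
    trivial
  induction hw using Submodule.span_induction with
  | mem x hx =>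
    obtain ⟨b, rfl⟩ := hx
    rw [DerivLift.lie_D, map_D, map_D, DerivLift.lie_D, h]
  | zero => simp only [map_zero]
  | add x y _ _ hx hy => simp only [map_add, hx, hy]
  | smul b x _ hx =>
    rw [DerivLift.lie_smul, map_add, map_smul, map_smul, map_smul, hx,
      ← algebraMap_smul B₀₁ b (KaehlerDifferential.map A A B₁ B₀₁ x), DerivLift.lie_smul, h,
      algebraMap_smul, algebraMap_smul]

/-- Cartan's formula for the vertical vector field `v = L₁ - L₀₁`, in relative dimension one. -/
theorem cartan (L₁ : DerivLift θ B₁) (L₀₁ : DerivLift θ B₀₁)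
    (hv : ∀ (v : Derivation A B₁ B₀₁) (a b : B₁),
      v a • D A B₀₁ (algebraMap B₁ B₀₁ b) = v b • D A B₀₁ (algebraMap B₁ B₀₁ a))
    (w : Ω[B₁⁄A]) :
    KaehlerDifferential.map A A B₁ B₀₁ (L₁.lie w)
      = L₀₁.lie (KaehlerDifferential.map A A B₁ B₀₁ w) + D A B₀₁ (contract L₁ L₀₁ w) := by
  have hc : ∀ (b : B₁) (w : Ω[B₁⁄A]), vertDiff L₁ L₀₁ b • KaehlerDifferential.map A A B₁ B₀₁ w
      = contract L₁ L₀₁ w • D A B₀₁ (algebraMap B₁ B₀₁ b) := by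
    intro b w
    have hw : w ∈ Submodule.span B₁ (Set.range (D A B₁)) := by
      rw [span_range_derivation]
      trivial
    induction hw using Submodule.span_induction with
    | mem x hx =>
      obtain ⟨c, rfl⟩ := hx
      rw [map_D, contract_D, hv]
    | zero => simp only [map_zero, smul_zero, zero_smul]
    | add x y _ _ hx hy => simp only [map_add, smul_add, add_smul, hx, hy]
    | smul c x _ hx =>
      rw [map_smul, map_smul, smul_assoc, ← hx, smul_comm]
  have hw : w ∈ Submodule.span B₁ (Set.range (D A B₁)) := by
    rw [span_range_derivation]
    trivial
  induction hw using Submodule.span_induction with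
  | mem x hx =>
    obtain ⟨b, rfl⟩ := hx
    rw [DerivLift.lie_D, map_D, map_D, DerivLift.lie_D, contract_D, vertDiff_apply, map_sub]
    abel
  | zero => simp only [map_zero, add_zero]
  | add x y _ _ hx hy =>
    simp only [map_add, hx, hy]
    abel
  | smul b x _ hx =>
    have h1 := hc b x
    rw [vertDiff_apply, sub_smul, sub_eq_iff_eq_add] at h1
    rw [DerivLift.lie_smul, map_add, map_smul, map_smul, map_smul, hx,
      ← algebraMap_smul B₀₁ b (KaehlerDifferential.map A A B₁ B₀₁ x), DerivLift.lie_smul,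
      ← algebraMap_smul B₀₁ (L₁.toDer b), h1, map_smul,
      ← algebraMap_smul B₀₁ b (contract L₁ L₀₁ x), smul_eq_mul, Derivation.leibniz,
      ← algebraMap_smul B₀₁ b, smul_add]
    abel

/-- The Gauss–Manin connection on cocycles:
`(ω₀, ω₁, f) ↦ (L₀ ω₀, L₁ ω₁, L₀₁ f + ι_{L₁ - L₀₁} ω₁)`, where `L₀`, `L₁` are the Lie derivatives
along lifts of `θ` to the charts and `L₀₁` is the extension of `L₀` to the overlap. -/
def cocycleNabla (L₀ : DerivLift θ B₀) (L₁ : DerivLift θ B₁) (L₀₁ : DerivLift θ B₀₁)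
    (h : ∀ b, L₀₁.toDer (algebraMap B₀ B₀₁ b) = algebraMap B₀ B₀₁ (L₀.toDer b))
    (hv : ∀ (v : Derivation A B₁ B₀₁) (a b : B₁),
      v a • D A B₀₁ (algebraMap B₁ B₀₁ b) = v b • D A B₀₁ (algebraMap B₁ B₀₁ a)) :
    CechCocycle A B₀ B₁ B₀₁ →+ CechCocycle A B₀ B₁ B₀₁ where
  toFun c := ⟨(L₀.lie c.1.1, L₁.lie c.1.2.1, L₀₁.toDer c.1.2.2 + contract L₁ L₀₁ c.1.2.1), by
    have hc := (mem_cechCocycle c.1).1 c.2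
    rw [mem_cechCocycle]
    dsimp only
    rw [cartan L₁ L₀₁ hv, map_lie L₀ L₀₁ h, map_add, ← DerivLift.lie_D, ← hc, map_sub]
    abel⟩
  map_zero' := Subtype.ext (by
    refine Prod.ext ?_ (Prod.ext ?_ ?_)
    · exact map_zero _
    · exact map_zero _
    · change L₀₁.toDer 0 + contract L₁ L₀₁ 0 = 0
      rw [map_zero, map_zero, add_zero])
  map_add' c c' := Subtype.ext (by
    refine Prod.ext ?_ (Prod.ext ?_ ?_)
    · exact map_add _ _ _
    · exact map_add _ _ _
    · change L₀₁.toDer (c.1.2.2 + c'.1.2.2) + contract L₁ L₀₁ (c.1.2.1 + c'.1.2.1)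
        = (L₀₁.toDer c.1.2.2 + contract L₁ L₀₁ c.1.2.1)
          + (L₀₁.toDer c'.1.2.2 + contract L₁ L₀₁ c'.1.2.1)
      rw [map_add, map_add]
      abel)

/-- The Gauss–Manin connection on cohomology. -/
def cechNabla (L₀ : DerivLift θ B₀) (L₁ : DerivLift θ B₁) (L₀₁ : DerivLift θ B₀₁)
    (h : ∀ b, L₀₁.toDer (algebraMap B₀ B₀₁ b) = algebraMap B₀ B₀₁ (L₀.toDer b))
    (hv : ∀ (v : Derivation A B₁ B₀₁) (a b : B₁),
      v a • D A B₀₁ (algebraMap B₁ B₀₁ b) = v b • D A B₀₁ (algebraMap B₁ B₀₁ a)) :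
    Connection θ (CechH1 A B₀ B₁ B₀₁) where
  toHom := QuotientAddGroup.map (LinearMap.range (cechD₀ A B₀ B₁ B₀₁)).toAddSubgroup
    (LinearMap.range (cechD₀ A B₀ B₁ B₀₁)).toAddSubgroup (cocycleNabla L₀ L₁ L₀₁ h hv) (by
      rintro _ ⟨g, rfl⟩
      refine ⟨(L₀.toDer g.1, L₁.toDer g.2), Subtype.ext ?_⟩
      refine Prod.ext ?_ (Prod.ext ?_ ?_)
      · exact (L₀.lie_D g.1).symm
      · exact (L₁.lie_D g.2).symm
      · change algebraMap B₁ B₀₁ (L₁.toDer g.2) - algebraMap B₀ B₀₁ (L₀.toDer g.1)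
          = L₀₁.toDer (algebraMap B₁ B₀₁ g.2 - algebraMap B₀ B₀₁ g.1)
            + contract L₁ L₀₁ (D A B₁ g.2)
        rw [contract_D, vertDiff_apply, map_sub, h]
        abel)
  leibniz a x := by
    obtain ⟨c, rfl⟩ := Submodule.mkQ_surjective _ x
    change cechClass (cocycleNabla L₀ L₁ L₀₁ h hv (a • c))
      = a • cechClass (cocycleNabla L₀ L₁ L₀₁ h hv c) + θ a • cechClass c
    rw [← LinearMap.map_smul, ← LinearMap.map_smul, ← LinearMap.map_add]
    congr 1
    refine Subtype.ext (Prod.ext ?_ (Prod.ext ?_ ?_))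
    · change L₀.lie (a • c.1.1) = a • L₀.lie c.1.1 + θ a • c.1.1
      rw [← algebraMap_smul B₀ a, DerivLift.lie_smul, L₀.lift_algebraMap, algebraMap_smul,
        algebraMap_smul]
    · change L₁.lie (a • c.1.2.1) = a • L₁.lie c.1.2.1 + θ a • c.1.2.1
      rw [← algebraMap_smul B₁ a, DerivLift.lie_smul, L₁.lift_algebraMap, algebraMap_smul,
        algebraMap_smul]
    · change L₀₁.toDer (a • c.1.2.2) + contract L₁ L₀₁ (a • c.1.2.1)
        = a • (L₀₁.toDer c.1.2.2 + contract L₁ L₀₁ c.1.2.1) + θ a • c.1.2.2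
      rw [LinearMap.map_smul_of_tower, Algebra.smul_def, Derivation.leibniz,
        L₀₁.lift_algebraMap]
      simp only [smul_eq_mul]
      simp only [Algebra.smul_def]
      ring

end Cech

/-! ### Relative de Rham cohomology of a smooth plane cubic `y² = a x³ + b x² + c x + d` -/

/-- A family of elliptic curves `y² = a x³ + b x² + c x + d` over `Spec A`: the number `6`, the
leading coefficient and the discriminant of the cubic are units. -/
structure CubicCurve (A : Type*) [CommRing A] extends Cubic A where
  isUnit_six : IsUnit (6 : A)
  isUnit_a : IsUnit a
  isUnit_discr : IsUnit toCubic.discr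

namespace CubicCurve

variable {A : Type*} [CommRing A] (E : CubicCurve A)

/-- The equation of the curve on the chart `Z ≠ 0`, as a polynomial in `A[y][x]`. -/
def eq₀ : A[X][X] := E.toPoly.map C - C (X ^ 2)

/-- The equation of the curve on the chart `Y ≠ 0`, as a polynomial in `A[z][x]`:
`a x³ + b x² z + c x z² + d z³ = z`, in the coordinates `x = X/Y`, `z = Z/Y`. -/
def eq₁ : A[X][X] :=
  C (C E.a) * X ^ 3 + C (C E.b * X) * X ^ 2 + C (C E.c * X ^ 2) * X + C (C E.d * X ^ 3 - X)

/-- The ring of functions on the chart `Z ≠ 0` of the projective curve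
`Y² Z = a X³ + b X² Z + c X Z² + d Z³`. -/
abbrev Chart₀ : Type _ := AdjoinRoot E.eq₀

/-- The ring of functions on the chart `Y ≠ 0`. As `a` is a unit, the two charts cover the
curve. -/
abbrev Chart₁ : Type _ := AdjoinRoot E.eq₁

/-- The coordinate `x = X/Z`. -/
def x₀ : E.Chart₀ := AdjoinRoot.root E.eq₀
/-- The coordinate `y = Y/Z`. -/
def y₀ : E.Chart₀ := AdjoinRoot.of E.eq₀ X
/-- The coordinate `X/Y`. -/
def x₁ : E.Chart₁ := AdjoinRoot.root E.eq₁
/-- The coordinate `Z/Y`. -/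
def z₁ : E.Chart₁ := AdjoinRoot.of E.eq₁ X

/-- The ring of functions on the overlap `Y Z ≠ 0`. -/
abbrev Overlap : Type _ := Localization.Away E.y₀

/-- The function `1/y` on the overlap. -/
def yInv : E.Overlap := IsLocalization.Away.invSelf E.y₀

theorem y_mul_yInv : algebraMap E.Chart₀ E.Overlap E.y₀ * E.yInv = 1 :=
  IsLocalization.Away.mul_invSelf E.y₀

theorem eq_chart₀ : algebraMap A E.Chart₀ E.a * E.x₀ ^ 3 + algebraMap A E.Chart₀ E.b * E.x₀ ^ 2
    + algebraMap A E.Chart₀ E.c * E.x₀ + algebraMap A E.Chart₀ E.d = E.y₀ ^ 2 := by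
  have h : AdjoinRoot.mk E.eq₀ (E.toPoly.map C - C (X ^ 2)) = 0 := AdjoinRoot.mk_self
  rw [Cubic.toPoly] at h
  simp only [Polynomial.map_add, Polynomial.map_mul, Polynomial.map_pow, map_C, map_X, map_sub,
    map_add, map_mul, map_pow, AdjoinRoot.mk_X, AdjoinRoot.mk_C] at h
  exact sub_eq_zero.1 h

theorem eq_chart₁ : algebraMap A E.Chart₁ E.a * E.x₁ ^ 3
    + algebraMap A E.Chart₁ E.b * E.x₁ ^ 2 * E.z₁ + algebraMap A E.Chart₁ E.c * E.x₁ * E.z₁ ^ 2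
    + algebraMap A E.Chart₁ E.d * E.z₁ ^ 3 = E.z₁ := by
  have h : AdjoinRoot.mk E.eq₁ (C (C E.a) * X ^ 3 + C (C E.b * X) * X ^ 2 + C (C E.c * X ^ 2) * X
    + C (C E.d * X ^ 3 - X)) = 0 := AdjoinRoot.mk_self
  simp only [map_sub, map_add, map_mul, map_pow, AdjoinRoot.mk_X, AdjoinRoot.mk_C] at h
  change algebraMap A E.Chart₁ E.a * E.x₁ ^ 3 + algebraMap A E.Chart₁ E.b * E.z₁ * E.x₁ ^ 2
    + algebraMap A E.Chart₁ E.c * E.z₁ ^ 2 * E.x₁ + (algebraMap A E.Chart₁ E.d * E.z₁ ^ 3 - E.z₁)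
    = 0 at h
  linear_combination h

/-- The restriction from the chart `Y ≠ 0` to the overlap: `X/Y ↦ x/y`, `Z/Y ↦ 1/y`. -/
def restrict₁ : E.Chart₁ →+* E.Overlap :=
  AdjoinRoot.lift (eval₂RingHom (algebraMap A E.Overlap) E.yInv)
    (algebraMap E.Chart₀ E.Overlap E.x₀ * E.yInv) (by
      have h := congrArg (algebraMap E.Chart₀ E.Overlap) E.eq_chart₀
      simp only [map_add, map_mul, map_pow, ← IsScalarTower.algebraMap_apply A E.Chart₀ E.Overlap]
        at h
      have h2 := E.y_mul_yInv
      simp only [eq₁, eval₂_add, eval₂_mul, eval₂_C, eval₂_pow, eval₂_X, coe_eval₂RingHom,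
        eval₂_sub]
      linear_combination (E.yInv ^ 3) * h
        + (algebraMap E.Chart₀ E.Overlap E.y₀ * E.yInv + 1) * E.yInv * h2)

instance : Algebra E.Chart₁ E.Overlap := E.restrict₁.toAlgebra

instance : IsScalarTower A E.Chart₁ E.Overlap := IsScalarTower.of_algebraMap_eq fun a => by
  change _ = E.restrict₁ (AdjoinRoot.of E.eq₁ (C a))
  rw [restrict₁, AdjoinRoot.lift_of, coe_eval₂RingHom, eval₂_C]

theorem isSmooth₀ : IsSmoothPlane E.eq₀ := by
  obtain ⟨t, ht⟩ := E.isUnit_six.exists_right_inv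
  obtain ⟨δ, hδ⟩ := E.isUnit_discr.exists_right_inv
  have hy : AdjoinRoot.mk E.eq₀ (innerDer E.eq₀) = -2 * E.y₀ := by
    have : innerDer E.eq₀ = -2 * C X := by
      simp only [eq₀, map_sub, innerDer, coeffDer_C]
      have h1 : coeffDer (Polynomial.derivative' (R := A)) (E.toPoly.map C) = 0 := by
        ext i : 1
        rw [coeff_coeffDer, coeff_map]
        change derivative (C _) = _
        simp
      rw [h1]
      change 0 - C (derivative (X ^ 2)) = _
      simp
      ring
    rw [this]
    simp [y₀, map_ofNat]
  have hx : AdjoinRoot.mk E.eq₀ (derivative E.eq₀) = 3 * algebraMap A E.Chart₀ E.a * E.x₀ ^ 2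
      + 2 * algebraMap A E.Chart₀ E.b * E.x₀ + algebraMap A E.Chart₀ E.c := by
    have : derivative E.eq₀ = 3 * C (C E.a) * X ^ 2 + 2 * C (C E.b) * X + C (C E.c) := by
      simp only [eq₀, Cubic.toPoly, Polynomial.map_add, Polynomial.map_mul, Polynomial.map_pow,
        map_C, map_X, derivative_add, derivative_sub, derivative_mul, derivative_C,
        derivative_X_pow, derivative_X]
      simp
      have e2 : (C (2 : A[X]) : A[X][X]) = 2 := map_ofNat C 2
      have e3 : (C (3 : A[X]) : A[X][X]) = 3 := map_ofNat C 3
      linear_combination (C (C E.a) * X ^ 2) * e3 + (X * C (C E.b)) * e2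
    rw [this]
    simp only [map_add, map_mul, map_pow, AdjoinRoot.mk_X, AdjoinRoot.mk_C, map_ofNat]
    rfl
  let w : A := 2 * E.b ^ 2 - 6 * E.a * E.c
  let α₀ : A := -4 * E.b ^ 3 + 15 * E.a * E.b * E.c - 27 * E.a ^ 2 * E.d
  let β₁ : A := 2 * E.b ^ 3 - 7 * E.a * E.b * E.c + 9 * E.a ^ 2 * E.d
  let β₀ : A := E.b ^ 2 * E.c - 4 * E.a * E.c ^ 2 + 3 * E.a * E.b * E.d
  refine ⟨C (C (-3 * t * δ)) * (C (C (-3 * E.a * w)) * X + C (C α₀)) * C X,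
    C (C δ) * (C (C (E.a * w)) * X ^ 2 + C (C β₁) * X + C (C β₀)), ?_⟩
  rw [map_add, map_mul _ _ (innerDer E.eq₀), map_mul _ _ (derivative E.eq₀), hx, hy]
  simp only [map_add, map_mul, map_pow, AdjoinRoot.mk_X, AdjoinRoot.mk_C]
  have h := E.eq_chart₀
  have ht' := congrArg (algebraMap A E.Chart₀) ht
  have hδ' := congrArg (algebraMap A E.Chart₀) hδ
  have hc : ∀ a : A, AdjoinRoot.of E.eq₀ (C a) = algebraMap A E.Chart₀ a := fun a => rfl
  rw [Cubic.discr] at hδ'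
  simp only [w, α₀, β₁, β₀, map_add, map_sub, map_neg, map_mul, map_pow, map_ofNat, map_one, hc]
    at h ht' hδ' ⊢
  change _ * _ * E.y₀ * _ + _ = _
  rw [show AdjoinRoot.root E.eq₀ = E.x₀ from rfl]
  generalize algebraMap A E.Chart₀ E.a = a at *
  generalize algebraMap A E.Chart₀ E.b = b at *
  generalize algebraMap A E.Chart₀ E.c = c at *
  generalize algebraMap A E.Chart₀ E.d = d at *
  generalize algebraMap A E.Chart₀ t = t at *
  generalize algebraMap A E.Chart₀ δ = δ at *
  generalize E.x₀ = x at *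
  generalize E.y₀ = y at *
  linear_combination hδ' + (δ * (-3 * a * (2 * b ^ 2 - 6 * a * c) * x
    + (-4 * b ^ 3 + 15 * a * b * c - 27 * a ^ 2 * d))) * (y ^ 2 * ht' - h)

theorem isSmooth₁ : IsSmoothPlane E.eq₁ := by
  obtain ⟨t, ht⟩ := E.isUnit_six.exists_right_inv
  obtain ⟨ai, hai⟩ := E.isUnit_a.exists_right_inv
  have hz : AdjoinRoot.mk E.eq₁ (innerDer E.eq₁) = algebraMap A E.Chart₁ E.b * E.x₁ ^ 2
      + 2 * algebraMap A E.Chart₁ E.c * E.x₁ * E.z₁ + 3 * algebraMap A E.Chart₁ E.d * E.z₁ ^ 2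
      - 1 := by
    have hX : innerDer (X : A[X][X]) = 0 := coeffDer_X _
    have hC : ∀ p : A[X], innerDer (C p) = C (derivative p) := fun p => coeffDer_C _ _
    have : innerDer E.eq₁ = C (C E.b) * X ^ 2 + 2 * C (C E.c) * X * C X
        + 3 * C (C E.d) * C X ^ 2 - 1 := by
      simp only [eq₁, map_add, Derivation.leibniz, Derivation.leibniz_pow, hX, hC]
      simp [C_ofNat]
      ring
    rw [this]
    simp only [map_add, map_sub, map_mul, map_pow, AdjoinRoot.mk_X, AdjoinRoot.mk_C, map_ofNat,
      map_one]
    rfl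
  have hx : AdjoinRoot.mk E.eq₁ (derivative E.eq₁) = 3 * algebraMap A E.Chart₁ E.a * E.x₁ ^ 2
      + 2 * algebraMap A E.Chart₁ E.b * E.x₁ * E.z₁ + algebraMap A E.Chart₁ E.c * E.z₁ ^ 2 := by
    have : derivative E.eq₁ = 3 * C (C E.a) * X ^ 2 + 2 * C (C E.b) * X * C X
        + C (C E.c) * C X ^ 2 := by
      simp only [eq₁, derivative_add, derivative_mul, derivative_C, derivative_X_pow, derivative_X]
      simp
      have e2 : (C (2 : A[X]) : A[X][X]) = 2 := map_ofNat C 2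
      have e3 : (C (3 : A[X]) : A[X][X]) = 3 := map_ofNat C 3
      linear_combination (C (C E.a) * X ^ 2) * e3 + (X * C (C E.b) * C X) * e2
    rw [this]
    simp only [map_add, map_mul, map_pow, AdjoinRoot.mk_X, AdjoinRoot.mk_C, map_ofNat]
    rfl
  have h := E.eq_chart₁
  have ht' := congrArg (algebraMap A E.Chart₁) ht
  have hai' := congrArg (algebraMap A E.Chart₁) hai
  simp only [map_mul, map_ofNat, map_one] at ht' hai'
  suffices H : ∃ p q : E.Chart₁, p * AdjoinRoot.mk E.eq₁ (innerDer E.eq₁)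
      + q * AdjoinRoot.mk E.eq₁ (derivative E.eq₁) = 1 by
    obtain ⟨p, q, hpq⟩ := H
    obtain ⟨p, rfl⟩ := AdjoinRoot.mk_surjective p
    obtain ⟨q, rfl⟩ := AdjoinRoot.mk_surjective q
    exact ⟨p, q, by rw [map_add, map_mul, map_mul, hpq]⟩
  rw [hx, hz]
  generalize algebraMap A E.Chart₁ E.a = a at *
  generalize algebraMap A E.Chart₁ E.b = b at *
  generalize algebraMap A E.Chart₁ E.c = c at *
  generalize algebraMap A E.Chart₁ E.d = d at *
  generalize algebraMap A E.Chart₁ t = t at *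
  generalize algebraMap A E.Chart₁ ai = ai at *
  generalize E.x₁ = x at *
  generalize E.z₁ = z at *
  refine ⟨-1 + 3 * t * ((2 * c * x + 3 * d * z) - 2 * t * ai * b * (2 * b * x + c * z)) * z,
    2 * t * ai * b
      + 3 * t * ((2 * c * x + 3 * d * z) - 2 * t * ai * b * (2 * b * x + c * z)) * x, ?_⟩
  linear_combination (((2 * c * x + 3 * d * z) - 2 * t * ai * b * (2 * b * x + c * z)) * z
    + b * x ^ 2 * a * ai) * ht' + b * x ^ 2 * hai'
    + 9 * t * ((2 * c * x + 3 * d * z) - 2 * t * ai * b * (2 * b * x + c * z)) * h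

/-- The first relative algebraic de Rham cohomology `H¹_dR(E / Spec A)` of the projective curve,
as the Čech–de Rham cohomology of its cover by the affine charts `Z ≠ 0` and `Y ≠ 0`. -/
abbrev H1dR : Type _ := CechH1 A E.Chart₀ E.Chart₁ E.Overlap

variable {k : Type*} [CommRing k] [Algebra k A] (θ : Derivation k A A)

/-- A lift of `θ` to the chart `Z ≠ 0`. -/
def lift₀ : DerivLift θ E.Chart₀ := (E.isSmooth₀.nonempty_lift θ).some

/-- A lift of `θ` to the chart `Y ≠ 0`. -/
def lift₁ : DerivLift θ E.Chart₁ := (E.isSmooth₁.nonempty_lift θ).some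

/-- The extension of `lift₀` to the overlap. -/
def lift₀₁ : DerivLift θ E.Overlap where
  toDer := localizeDer E.y₀ (E.lift₀ θ).toDer
  lift_algebraMap a := by
    rw [IsScalarTower.algebraMap_apply A E.Chart₀ E.Overlap, localizeDer_algebraMap,
      (E.lift₀ θ).lift_algebraMap, ← IsScalarTower.algebraMap_apply A E.Chart₀ E.Overlap]

theorem overlap_symm (v : Derivation A E.Chart₁ E.Overlap) (a b : E.Chart₁) :
    v a • D A E.Overlap (algebraMap E.Chart₁ E.Overlap b)
      = v b • D A E.Overlap (algebraMap E.Chart₁ E.Overlap a) :=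
  E.isSmooth₁.symm v ((D A E.Overlap).compAlgebraMap E.Chart₁) a b

/-- The Gauss–Manin connection along `θ` on `H¹_dR(E / Spec A)`; on cohomology it does not depend
on the lifts of `θ`. -/
def gaussManin : Connection θ E.H1dR :=
  cechNabla (E.lift₀ θ) (E.lift₁ θ) (E.lift₀₁ θ) (localizeDer_algebraMap _ _) E.overlap_symm

/-- `c` is the class of a global relative 1-form on the curve (a form on each chart, agreeing on
the overlap) which on the overlap is `dX / Y`, for functions `X`, `Y` on the chart `Z ≠ 0`, with
`Y` invertible on the overlap. -/
def IsFormClass (X Y : E.Chart₀) (c : E.H1dR) : Prop :=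
  ∃ w : CechCocycle A E.Chart₀ E.Chart₁ E.Overlap, w.1.2.2 = 0 ∧
    algebraMap E.Chart₀ E.Overlap Y • KaehlerDifferential.map A A E.Chart₀ E.Overlap w.1.1
      = D A E.Overlap (algebraMap E.Chart₀ E.Overlap X) ∧
    cechClass w = c

end CubicCurve

/-! ### The base, the hypergeometric operators and the elliptic families -/

section Hypergeometric

section Base

variable (K : Type) [Field K]

/-- `O(T) = K[t, (t - t²)⁻¹]`. -/
abbrev OT : Type := Localization.Away (X - X ^ 2 : K[X])

/-- `t = 4 s (1 - s)` in `K[s]`, that is `s = (1 - √(1 - t)) / 2`. -/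
def tOfS : K[X] := 4 * X * (1 - X)

/-- `O(S) = K[s, t, (t - t²)⁻¹]`, where `t = 4 s (1 - s)`. -/
abbrev OS : Type := Localization.Away (tOfS K - tOfS K ^ 2)

/-- The coordinate `t` of `T`. -/
def tT : OT K := algebraMap K[X] (OT K) X

/-- The coordinate `s` of `S`. -/
def sS : OS K := algebraMap K[X] (OS K) X

theorem isUnit_prod : IsUnit (4 * sS K * (1 - sS K) * (1 - 2 * sS K) ^ 2) := by
  have h := IsLocalization.Away.algebraMap_isUnit (S := OS K) (tOfS K - tOfS K ^ 2)
  have e : algebraMap K[X] (OS K) (tOfS K - tOfS K ^ 2)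
      = 4 * sS K * (1 - sS K) * (1 - 2 * sS K) ^ 2 := by
    simp only [tOfS, sS, map_sub, map_mul, map_pow, map_ofNat, map_one]
    ring
  rwa [e] at h

theorem isUnit_four : IsUnit (4 : OS K) :=
  isUnit_of_mul_isUnit_left (isUnit_of_mul_isUnit_left (isUnit_of_mul_isUnit_left (isUnit_prod K)))

theorem isUnit_s : IsUnit (sS K) :=
  isUnit_of_mul_isUnit_right (isUnit_of_mul_isUnit_left (isUnit_of_mul_isUnit_left (isUnit_prod K)))

theorem isUnit_one_sub_s : IsUnit (1 - sS K) :=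
  isUnit_of_mul_isUnit_right (isUnit_of_mul_isUnit_left (isUnit_prod K))

theorem isUnit_one_sub_two_s : IsUnit (1 - 2 * sS K) :=
  (isUnit_pow_iff two_ne_zero).1 (isUnit_of_mul_isUnit_right (isUnit_prod K))

theorem isUnit_mapTS : IsUnit (((algebraMap K[X] (OS K)).comp
    ((aeval (tOfS K) : K[X] →ₐ[K] K[X]) : K[X] →+* K[X])) (X - X ^ 2)) := by
  have h := IsLocalization.Away.algebraMap_isUnit (S := OS K) (tOfS K - tOfS K ^ 2)
  simpa using h

/-- The map `O(T) → O(S)`, `t ↦ 4 s (1 - s)`. -/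
def mapTS : OT K →+* OS K := IsLocalization.Away.lift (X - X ^ 2 : K[X]) (isUnit_mapTS K)

instance : Algebra (OT K) (OS K) := (mapTS K).toAlgebra

theorem algebraMap_OT (p : K[X]) : algebraMap (OT K) (OS K) (algebraMap K[X] (OT K) p)
    = algebraMap K[X] (OS K) (aeval (tOfS K) p) :=
  IsLocalization.Away.lift_eq (X - X ^ 2 : K[X]) (isUnit_mapTS K) p

/-- The derivation `d/dt` of `O(T)`. -/
def ddtT : Derivation K (OT K) (OT K) := localizeDer _ Polynomial.derivative'

/-- The derivation `d/ds` of `O(S)`. -/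
def ddsS : Derivation K (OS K) (OS K) := localizeDer _ Polynomial.derivative'

/-- The derivation `d/dt = (dt/ds)⁻¹ d/ds` of `O(S)`, where `dt/ds = 4 (1 - 2 s)`. -/
def ddtS : Derivation K (OS K) (OS K) := Ring.inverse (4 * (1 - 2 * sS K)) • ddsS K

theorem ddtS_algebraMap (a : OT K) :
    ddtS K (algebraMap (OT K) (OS K) a) = algebraMap (OT K) (OS K) (ddtT K a) := by
  have hp : ∀ p : K[X], ddtS K (algebraMap (OT K) (OS K) (algebraMap K[X] (OT K) p))
      = algebraMap (OT K) (OS K) (ddtT K (algebraMap K[X] (OT K) p)) := by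
    intro p
    rw [algebraMap_OT, ddtS, Derivation.smul_apply, ddsS, ddtT, localizeDer_algebraMap,
      localizeDer_algebraMap, algebraMap_OT]
    change _ • algebraMap K[X] (OS K) (derivative (aeval (tOfS K) p))
      = algebraMap K[X] (OS K) (aeval (tOfS K) (derivative p))
    have h1 : derivative (aeval (tOfS K) p) = 4 * (1 - 2 * X) * aeval (tOfS K) (derivative p) := by
      have e4 : (C 4 : K[X]) = 4 := map_ofNat C 4
      have : derivative (tOfS K) = 4 * (1 - 2 * X) := by
        rw [tOfS, ← e4, derivative_mul, derivative_mul]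
        simp
        ring
      change derivative (p.comp (tOfS K)) = _ * (derivative p).comp (tOfS K)
      rw [derivative_comp, this]
    rw [h1, map_mul]
    have h2 : algebraMap K[X] (OS K) (4 * (1 - 2 * X)) = 4 * (1 - 2 * sS K) := by
      simp only [sS, map_sub, map_mul, map_ofNat, map_one]
    rw [h2, smul_eq_mul, ← mul_assoc, Ring.inverse_mul_cancel, one_mul]
    exact (isUnit_four K).mul (isUnit_one_sub_two_s K)
  obtain ⟨n, p, h⟩ := IsLocalization.Away.surj (X - X ^ 2 : K[X]) a
  rw [← map_pow] at h
  have h1 := hp p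
  have h2 := hp ((X - X ^ 2) ^ n)
  rw [← h, map_mul, Derivation.leibniz, Derivation.leibniz, h2, map_add] at h1
  simp only [smul_eq_mul, map_mul] at h1
  have hu : IsUnit (algebraMap (OT K) (OS K) (algebraMap K[X] (OT K) ((X - X ^ 2) ^ n))) := by
    rw [map_pow]
    exact ((IsLocalization.Away.algebraMap_isUnit (X - X ^ 2 : K[X])).pow n).map _
  have h3 := add_left_cancel h1
  exact hu.mul_left_cancel h3

/-- The ring `D_T = O(T)⟨d/dt⟩` of differential operators on `T`. -/
abbrev DT : Type := DiffOp (ddtT K)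

/-- The ring `D_S = O(S)⟨d/dt⟩` of differential operators on `S`. -/
abbrev DS : Type := DiffOp (ddtS K)

/-- The Euler operator `D = t d/dt` in `D_T`. -/
def eulerT : DT K := DiffOp.coeff (ddtT K) (tT K) * DiffOp.partial_ (ddtT K)

/-- The operator `D_s = s d/ds = s (dt/ds) d/dt` in `D_S`. -/
def eulerS : DS K :=
  DiffOp.coeff (ddtS K) (sS K * (4 * (1 - 2 * sS K))) * DiffOp.partial_ (ddtS K)

/-- A constant, as an element of `D_T`. -/
def constT (c : K) : DT K := DiffOp.coeff (ddtT K) (algebraMap K (OT K) c)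

/-- A constant, as an element of `D_S`. -/
def constS (c : K) : DS K := DiffOp.coeff (ddtS K) (algebraMap K (OS K) c)

end Base

/-- The four hypergeometric types `(α₀, α₁, 1/2)` with `α₀ = 1/2, 1/3, 1/4, 1/6` and
`α₁ = 1 - α₀`. -/
inductive HGType
  | half
  | third
  | quarter
  | sixth

/-- The parameter `α₀`. -/
def HGType.α₀ : HGType → ℚ
  | half => 1 / 2
  | third => 1 / 3
  | quarter => 1 / 4
  | sixth => 1 / 6

/-- The parameter `α₁`. -/
def HGType.α₁ : HGType → ℚ
  | half => 1 / 2
  | third => 2 / 3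
  | quarter => 3 / 4
  | sixth => 5 / 6

variable (K : Type) [Field K] [CharZero K] (α : HGType)

/-- The operator `P = D_s² - s (D_s + α₀) (D_s + α₁)` in `D_S`. -/
def opS : DS K := eulerS K ^ 2 - DiffOp.coeff (ddtS K) (sS K)
  * (eulerS K + constS K α.α₀) * (eulerS K + constS K α.α₁)

/-- The operator `P = D³ - t (D + α₀) (D + α₁) (D + 1/2)` in `D_T`. -/
def opT : DT K := eulerT K ^ 3 - DiffOp.coeff (ddtT K) (tT K)
  * (eulerT K + constT K α.α₀) * (eulerT K + constT K α.α₁) * (eulerT K + constT K (1 / 2))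

/-- The left `D_T`-module `V = D_T / D_T P`. -/
abbrev V : Type := DT K ⧸ Submodule.span (DT K) {opT K α}

/-- The generator `ω = 1 + D_T P` of `V`. -/
def ωV : V K α := Submodule.Quotient.mk 1

/-- The cubics `x (x - 1) (x - s)`, `x³ + (3 x + 4 - 4 s)²`, `x (x² - 2 x + 1 - s)` and
`4 x³ - 3 x + 1 - 2 s`. -/
def cubicOf : HGType → Cubic (OS K)
  | .half => ⟨1, -(1 + sS K), sS K, 0⟩
  | .third => ⟨1, 9, 6 * (4 - 4 * sS K), (4 - 4 * sS K) ^ 2⟩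
  | .quarter => ⟨1, -2, 1 - sS K, 0⟩
  | .sixth => ⟨4, 0, -3, 1 - 2 * sS K⟩

theorem isUnit_natCast (n : ℕ) (hn : n ≠ 0) : IsUnit (n : OS K) := by
  rw [← map_natCast (algebraMap K (OS K))]
  exact (Ne.isUnit (Nat.cast_ne_zero.2 hn)).map _

/-- The elliptic family `E → S` given by `y² = ` the cubic of type `α`. -/
def curve : CubicCurve (OS K) where
  toCubic := cubicOf K α
  isUnit_six := by exact_mod_cast isUnit_natCast K 6 (by norm_num)
  isUnit_a := by
    cases α
    · exact isUnit_one
    · exact isUnit_one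
    · exact isUnit_one
    · exact isUnit_four K
  isUnit_discr := by
    cases α
    · have : (cubicOf K .half).discr = sS K ^ 2 * (1 - sS K) ^ 2 := by
        simp only [cubicOf, Cubic.discr]
        ring
      rw [this]
      exact ((isUnit_s K).pow 2).mul ((isUnit_one_sub_s K).pow 2)
    · have : (cubicOf K .third).discr = (6912 : ℕ) * sS K * (1 - sS K) ^ 3 := by
        simp only [cubicOf, Cubic.discr]
        push_cast
        ring
      rw [this]
      exact ((isUnit_natCast K _ (by norm_num)).mul (isUnit_s K)).mul ((isUnit_one_sub_s K).pow 3)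
    · have : (cubicOf K .quarter).discr = 4 * sS K * (1 - sS K) ^ 2 := by
        simp only [cubicOf, Cubic.discr]
        ring
      rw [this]
      exact ((isUnit_four K).mul (isUnit_s K)).mul ((isUnit_one_sub_s K).pow 2)
    · have : (cubicOf K .sixth).discr = (1728 : ℕ) * sS K * (1 - sS K) := by
        simp only [cubicOf, Cubic.discr]
        push_cast
        ring
      rw [this]
      exact ((isUnit_natCast K _ (by norm_num)).mul (isUnit_s K)).mul (isUnit_one_sub_s K)

/-- `H¹_dR(E / S)`. -/
abbrev H1E : Type := (curve K α).H1dR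

/-- The `D_S`-module structure of `H¹_dR(E / S)`, by the Gauss–Manin connection. -/
instance : Module (DS K) (H1E K α) := DiffOp.module ((curve K α).gaussManin (ddtS K))

/-- The `D_S`-module structure of `Sym² H¹_dR(E / S)`. -/
instance : Module (DS K) (Sym[OS K]^2 (H1E K α)) :=
  DiffOp.module ((curve K α).gaussManin (ddtS K)).symSq

/-- The `D_S`-module structure of the pullback `O(S) ⊗ V`. -/
instance : Module (DS K) (OS K ⊗[OT K] V K α) :=
  DiffOp.module ((Connection.ofDiffOp (ddtT K) (V K α)).baseChange (ddtS K) (ddtS_algebraMap K))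

/-- A constant of `K`, as a function on the chart `Z ≠ 0` of the curve. -/
def constE (c : K) : (curve K α).Chart₀ :=
  algebraMap (OS K) (curve K α).Chart₀ (algebraMap K (OS K) c)

end Hypergeometric

end HGClausen

end

/-!
Both isomorphisms say that a module with connection is cyclic, generated by a solution of the
operator in question, and both follow from division with remainder in `A⟨∂⟩`. If an operator `P` of
order `n` has a unit as its leading coefficient and `P w = 0`, then `A⟨∂⟩ / A⟨∂⟩ P` is the module
generated by `w` as soon as `w, ∇w, …, ∇ⁿ⁻¹w` is a basis (`DiffOp.exists_quotient_equiv`), and the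
same holds for a pullback to a larger base (`DiffOp.exists_baseChange_equiv`). What remains is to
find the bases and the equations.

*The basis.* Let `v` be the vector field on the curve dual to `dx / 2y`. On the overlap of the two
charts, the functions `x ^ i y ^ j` with `0 ≤ i ≤ 2` form a basis indexed by the order
`n = 2 i + 3 j` of the pole at infinity, and `v` raises pole orders by one, acting on leading terms
of order `n` as `n` times a unit (`CubicCurve.exists_symbol`). In characteristic zero this gives
everything that is needed: a Čech class is determined by its form on the affine curve
(`CubicCurve.affineClass_injective`), and the forms on the affine curve modulo exact forms are free
on `dx / 2y` and `x dx / 2y`, as `1` is the only positive number that is not a pole order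
(`CubicCurve.exact₀_independent`, `CubicCurve.exists_sub_mem_exact₀`).

*The equations.* The Gauss–Manin connection is computed with a lift of `d/dt` to the affine curve of
the form `x ↦ σ(x)`, `y ↦ r(x) y`; any two lifts differ by a multiple of `v`, which changes the Lie
derivative of a form by an exact form (`CubicCurve.LiftData.affineClass_gaussManin`). For each of
the four families an explicit `σ` of degree two and `r` of degree one solve the equations for such a
lift. In the resulting matrix of the connection the entry from `dx / 2y` to `x dx / 2y` is a unit,
so that `ω` and `∇ω` are a basis, and the matrix gives the Picard–Fuchs equation (`picardFuchs`).

*The symmetric square.* If `w` solves the equation of order two, then `w²`, `w δw`, `(δw)²` with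
`δ = s d/ds` satisfy a linear system of order one, and eliminating the last two gives the
hypergeometric equation of order three for `w²` in the variable `t = 4 s (1 - s)`. This is Clausen's
identity in its differential form (`clausen`). As `2` is invertible, `ω²` and its first two
derivatives are a basis of the symmetric square (`symSq_cyclic`).
-/

noncomputable section

namespace HGClausen

open Polynomial TensorProduct KaehlerDifferential

/-! ### The Hamiltonian vector field of a smooth plane curve -/

section Hamiltonian

variable {A : Type*} [CommRing A] (F : A[X][X])

/-- The vector field `F_x ∂_y - F_y ∂_x` on the affine plane curve `F(y)(x) = 0`, where `x` is the
outer and `y` the inner variable. -/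
def ham : Derivation A (AdjoinRoot F) (AdjoinRoot F) :=
  let D : Derivation A A[X][X] A[X][X] := derivative F • innerDer (A := A)
      - innerDer F • (Polynomial.derivative' (R := A[X])).restrictScalars A
  Derivation.liftOfSurjective (f := (AdjoinRoot.mkₐ F).restrictScalars A)
    AdjoinRoot.mk_surjective (d := D) (by
    intro x hx
    have hx' : AdjoinRoot.mk F x = 0 := hx
    obtain ⟨y, rfl⟩ := AdjoinRoot.mk_eq_zero.1 hx'
    change AdjoinRoot.mk F (D (F * y)) = 0
    have hDF : D F = 0 := by
      change derivative F * innerDer F - innerDer F * derivative F = 0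
      ring
    rw [Derivation.leibniz, hDF, smul_zero, add_zero, smul_eq_mul, map_mul, AdjoinRoot.mk_self,
      zero_mul])

theorem ham_mk (P : A[X][X]) : ham F (AdjoinRoot.mk F P)
    = AdjoinRoot.mk F (derivative F * innerDer P - innerDer F * derivative P) := by
  rw [ham]
  exact Derivation.liftOfSurjective_apply (f := (AdjoinRoot.mkₐ F).restrictScalars A) _ _ P

theorem ham_root : ham F (AdjoinRoot.root F) = -AdjoinRoot.mk F (innerDer F) := by
  have h := ham_mk F X
  have h1 : innerDer (X : A[X][X]) = 0 := coeffDer_X _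
  rw [AdjoinRoot.mk_X, h1, derivative_X, mul_zero, mul_one, zero_sub, map_neg] at h
  exact h

theorem ham_of_X : ham F (AdjoinRoot.of F X) = AdjoinRoot.mk F (derivative F) := by
  have h := ham_mk F (C X)
  have h1 : innerDer (C (X : A[X])) = 1 := by
    simp only [innerDer, coeffDer_C]
    change C (derivative X) = 1
    simp
  rw [AdjoinRoot.mk_C, h1, derivative_C, mul_zero, mul_one, sub_zero] at h
  exact h

variable {F}

/-- On a smooth plane curve the relative differentials are free of rank one, with a generator `η`
dual to the Hamiltonian vector field. -/
theorem IsSmoothPlane.exists_form (hF : IsSmoothPlane F) : ∃ η : Ω[AdjoinRoot F⁄A],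
    (∀ b, D A (AdjoinRoot F) b = ham F b • η) ∧ (ham F).liftKaehlerDifferential η = 1 := by
  obtain ⟨p, q, h⟩ := hF
  have h0 := der_mk_eq (D A (AdjoinRoot F)) F
  rw [AdjoinRoot.mk_self, map_zero] at h0
  refine ⟨AdjoinRoot.mk F q • D A _ (AdjoinRoot.of F X)
    - AdjoinRoot.mk F p • D A _ (AdjoinRoot.root F), ?_, ?_⟩
  · intro b
    obtain ⟨b, rfl⟩ := AdjoinRoot.mk_surjective b
    rw [der_mk_eq, ham_mk]
    simp only [map_add, map_mul, map_sub] at h ⊢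
    generalize AdjoinRoot.mk F (innerDer F) = Fy at *
    generalize AdjoinRoot.mk F (derivative F) = Fx at *
    generalize AdjoinRoot.mk F (innerDer b) = By at *
    generalize AdjoinRoot.mk F (derivative b) = Bx at *
    generalize D A _ (AdjoinRoot.root F) = dx at *
    generalize D A _ (AdjoinRoot.of F X) = dy at *
    generalize AdjoinRoot.mk F p = p at *
    generalize AdjoinRoot.mk F q = q at *
    have e1 : By • dy + Bx • dx = (p * Fy + q * Fx) • (By • dy + Bx • dx) := by rw [h, one_smul]
    have e2 : (p * Fy + q * Fx) • (By • dy + Bx • dx) = (Fx * By - Fy * Bx) • (q • dy - p • dx)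
        + (p * By + q * Bx) • (Fy • dy + Fx • dx) := by module
    rw [e1, e2, ← h0, smul_zero, add_zero]
  · rw [map_sub, map_smul, map_smul, Derivation.liftKaehlerDifferential_comp_D,
      Derivation.liftKaehlerDifferential_comp_D, ham_root, ham_of_X, ← h]
    simp only [map_add, map_mul, smul_eq_mul]
    ring

/-- A generator of the relative differentials of a smooth plane curve, dual to `ham F`. -/
def IsSmoothPlane.form (hF : IsSmoothPlane F) : Ω[AdjoinRoot F⁄A] := hF.exists_form.choose

theorem IsSmoothPlane.D_eq (hF : IsSmoothPlane F) (b : AdjoinRoot F) :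
    D A (AdjoinRoot F) b = ham F b • hF.form := hF.exists_form.choose_spec.1 b

/-- The coefficient of a relative form on a smooth plane curve with respect to the generator dual
to `ham F`. -/
def formCoeff (F : A[X][X]) : Ω[AdjoinRoot F⁄A] →ₗ[AdjoinRoot F] AdjoinRoot F :=
  (ham F).liftKaehlerDifferential

theorem formCoeff_D (b : AdjoinRoot F) : formCoeff F (D A _ b) = ham F b :=
  Derivation.liftKaehlerDifferential_comp_D _ b

theorem IsSmoothPlane.formCoeff_form (hF : IsSmoothPlane F) : formCoeff F hF.form = 1 :=
  hF.exists_form.choose_spec.2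

theorem IsSmoothPlane.formCoeff_smul (hF : IsSmoothPlane F) (w : Ω[AdjoinRoot F⁄A]) :
    formCoeff F w • hF.form = w := by
  have hw : w ∈ Submodule.span (AdjoinRoot F) (Set.range (D A (AdjoinRoot F))) := by
    rw [span_range_derivation]
    trivial
  induction hw using Submodule.span_induction with
  | mem x hx =>
    obtain ⟨b, rfl⟩ := hx
    rw [formCoeff_D, hF.D_eq]
  | zero => rw [map_zero, zero_smul]
  | add x y _ _ hx hy => rw [map_add, add_smul, hx, hy]
  | smul b x _ hx => rw [map_smul, smul_assoc, hx]

theorem IsSmoothPlane.formCoeff_injective (hF : IsSmoothPlane F) :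
    Function.Injective (formCoeff F) := fun w w' h => by
  rw [← hF.formCoeff_smul w, h, hF.formCoeff_smul]

/-- For a lift `L` of a derivation of the base to a smooth plane curve, with generator `η` of the
differentials, `[L, v] = -μ v` on functions, where `v` is dual to `η` and the Lie derivative of `η`
is `μ η`. -/
theorem IsSmoothPlane.ham_lift {k : Type*} [CommRing k] [Algebra k A] {θ : Derivation k A A}
    (hF : IsSmoothPlane F) (L : DerivLift θ (AdjoinRoot F)) (b : AdjoinRoot F) :
    ham F (L.toDer b) = ham F b * formCoeff F (L.lie hF.form) + L.toDer (ham F b) := by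
  have h := congrArg (formCoeff F) (L.lie_D b)
  rw [hF.D_eq, DerivLift.lie_smul, formCoeff_D, map_add, map_smul, map_smul, hF.formCoeff_form,
    smul_eq_mul, smul_eq_mul, mul_one] at h
  exact h.symm

end Hamiltonian

/-! ### Rings obtained by adjoining a root of a cubic -/

section CubicRing

variable {R : Type*} [CommRing R] [Nontrivial R] {a b c d : R}

/-- Over `R`, the powers `1`, `z`, `z²` of a root `z` of a cubic with unit leading coefficient
generate; they are independent by the next lemma. The cubic is not assumed monic. -/
theorem adjoinRoot_cubic_exists (ha : IsUnit a) {F : R[X]}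
    (hF : F = C a * X ^ 3 + C b * X ^ 2 + C c * X + C d) (z : AdjoinRoot F) :
    ∃ p q r : R, z = AdjoinRoot.of F p + AdjoinRoot.of F q * AdjoinRoot.root F
      + AdjoinRoot.of F r * AdjoinRoot.root F ^ 2 := by
  obtain ⟨z, rfl⟩ := AdjoinRoot.mk_surjective z
  obtain ⟨i, hi⟩ := ha.exists_left_inv
  set G : R[X] := C i * F with hG
  have hG' : G = X ^ 3 + C (i * b) * X ^ 2 + C (i * c) * X + C (i * d) := by
    have : (C i * C a : R[X]) = 1 := by rw [← C_mul, hi, C_1]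
    simp only [hG, hF, C_mul]
    linear_combination X ^ 3 * this
  have hm : G.Monic := by
    rw [hG']
    monicity!
  have hd : G.natDegree = 3 := by
    rw [hG']
    compute_degree!
  have hz : AdjoinRoot.mk F z = AdjoinRoot.mk F (z %ₘ G) := by
    rw [AdjoinRoot.mk_eq_mk]
    refine ⟨C i * (z /ₘ G), ?_⟩
    linear_combination (-1 : R[X]) * modByMonic_add_div z G + (z /ₘ G) * hG
  have hlt : (z %ₘ G).natDegree < 3 := by
    rw [← hd]
    refine natDegree_modByMonic_lt z hm ?_
    rintro h
    rw [h, natDegree_one] at hd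
    omega
  rw [hz, (z %ₘ G).as_sum_range' 3 hlt]
  refine ⟨(z %ₘ G).coeff 0, (z %ₘ G).coeff 1, (z %ₘ G).coeff 2, ?_⟩
  simp [Finset.sum_range_succ, ← C_mul_X_pow_eq_monomial]

theorem adjoinRoot_cubic_unique (ha : IsUnit a) {F : R[X]}
    (hF : F = C a * X ^ 3 + C b * X ^ 2 + C c * X + C d) {p q r : R}
    (h : AdjoinRoot.of F p + AdjoinRoot.of F q * AdjoinRoot.root F
      + AdjoinRoot.of F r * AdjoinRoot.root F ^ 2 = 0) : p = 0 ∧ q = 0 ∧ r = 0 := by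
  obtain ⟨i, hi⟩ := ha.exists_left_inv
  have h1 : AdjoinRoot.mk F (C r * X ^ 2 + C q * X + C p) = 0 := by
    rw [← h]
    simp
    ring
  obtain ⟨g, hg⟩ := AdjoinRoot.mk_eq_zero.1 h1
  have hg0 : g = 0 := by
    by_contra hne
    have hl : F.leadingCoeff = a := by rw [hF, leadingCoeff_cubic ha.ne_zero]
    have hu : F.leadingCoeff * g.leadingCoeff ≠ 0 := by
      rw [hl, ne_eq, ha.mul_right_eq_zero]
      exact leadingCoeff_ne_zero.2 hne
    have h2 := natDegree_mul' hu
    have h3 : F.natDegree = 3 := by rw [hF, natDegree_cubic ha.ne_zero]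
    have h4 : (C r * X ^ 2 + C q * X + C p).natDegree ≤ 2 := natDegree_quadratic_le
    rw [hg, h2, h3] at h4
    omega
  rw [hg0, mul_zero] at hg
  have hc := fun n => congrArg (fun P => P.coeff n) hg
  have c0 := hc 0
  have c1 := hc 1
  have c2 := hc 2
  simp [coeff_X, coeff_C] at c0 c1 c2
  exact ⟨c0, c1, c2⟩

end CubicRing

namespace CubicCurve

/-! ### The pole-order basis of the functions on the overlap -/

section Basis

variable {A : Type*} [CommRing A] (E : CubicCurve A)

theorem eq₀_eq : E.eq₀ = C (C E.a) * X ^ 3 + C (C E.b) * X ^ 2 + C (C E.c) * X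
    + C (C E.d - X ^ 2) := by
  simp only [eq₀, Cubic.toPoly, Polynomial.map_add, Polynomial.map_mul, Polynomial.map_pow,
    map_C, map_X, map_sub]
  ring

theorem isUnit_C_a : IsUnit (C E.a : A[X]) := E.isUnit_a.map C

/-- The function `x` on the overlap. -/
def ovX : E.Overlap := algebraMap E.Chart₀ E.Overlap E.x₀

/-- The invertible function `y` on the overlap. -/
def ovY : E.Overlapˣ := Units.mkOfMulEqOne _ _ E.y_mul_yInv

theorem coe_ovY : (E.ovY : E.Overlap) = algebraMap E.Chart₀ E.Overlap E.y₀ := rfl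

theorem coe_ovY_inv : ((E.ovY⁻¹ : E.Overlapˣ) : E.Overlap) = E.yInv := rfl

/-- The function on the overlap with a pole of order `n = 2 i + 3 j` at infinity which is of the
form `x ^ i * y ^ j` with `0 ≤ i ≤ 2`, so that `i` is the residue of `-n` modulo `3`. -/
def ovE (n : ℤ) : E.Overlap := E.ovX ^ ((-n) % 3).toNat * ↑(E.ovY ^ ((n - 2 * ((-n) % 3)) / 3))

theorem ovE_eq {i : ℕ} (hi : i ≤ 2) (j : ℤ) :
    E.ovE (2 * i + 3 * j) = E.ovX ^ i * ↑(E.ovY ^ j) := by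
  have h1 : (-(2 * (i : ℤ) + 3 * j)) % 3 = i := by omega
  rw [ovE, h1, Int.toNat_natCast]
  congr 3
  omega

theorem exists_index (n : ℤ) : ∃ i : ℕ, i ≤ 2 ∧ ∃ j : ℤ, n = 2 * i + 3 * j :=
  ⟨((-n) % 3).toNat, by omega, (n - 2 * ((-n) % 3)) / 3, by omega⟩

theorem ovE_add_mul (n k : ℤ) : E.ovE (n + 3 * k) = ↑(E.ovY ^ k) * E.ovE n := by
  obtain ⟨i, hi, j, rfl⟩ := exists_index n
  rw [show 2 * (i : ℤ) + 3 * j + 3 * k = 2 * i + 3 * (j + k) by ring, E.ovE_eq hi, E.ovE_eq hi,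
    zpow_add, Units.val_mul]
  ring

/-- The linear map from sequences to polynomials in the functions `ovE n`. -/
def ovPsi : (ℤ →₀ A) →ₗ[A] E.Overlap := Finsupp.linearCombination A E.ovE

theorem ovPsi_single (n : ℤ) (a : A) : E.ovPsi (Finsupp.single n a) = a • E.ovE n :=
  Finsupp.linearCombination_single ..

theorem ovPsi_shift (k : ℤ) (φ : ℤ →₀ A) :
    E.ovPsi (φ.mapDomain (· + 3 * k)) = ↑(E.ovY ^ k) * E.ovPsi φ := by
  induction φ using Finsupp.induction_linear with
  | zero => simp
  | add f g hf hg => rw [Finsupp.mapDomain_add, map_add, map_add, hf, hg, mul_add]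
  | single n a =>
    rw [Finsupp.mapDomain_single, ovPsi_single, ovPsi_single, ovE_add_mul, mul_smul_comm]

/-- The coefficients of a polynomial, placed at the indices `g j`. -/
def place (g : ℕ → ℤ) : A[X] →ₗ[A] (ℤ →₀ A) := Polynomial.lsum fun j => Finsupp.lsingle (g j)

theorem place_monomial (g : ℕ → ℤ) (j : ℕ) (a : A) :
    place g (monomial j a) = Finsupp.single (g j) a := by
  simp [place, Polynomial.lsum_apply, sum_monomial_index]

theorem place_apply {g : ℕ → ℤ} (hg : Function.Injective g) (p : A[X]) (j : ℕ) :
    place g p (g j) = p.coeff j := by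
  induction p using Polynomial.induction_on' with
  | add p q hp hq => rw [map_add, Finsupp.add_apply, hp, hq, coeff_add]
  | monomial n a =>
    rw [place_monomial, Finsupp.single_apply, coeff_monomial]
    simp only [hg.eq_iff]

theorem place_apply_of_ne {g : ℕ → ℤ} (p : A[X]) {n : ℤ} (hn : ∀ j, g j ≠ n) :
    place g p n = 0 := by
  induction p using Polynomial.induction_on' with
  | add p q hp hq => rw [map_add, Finsupp.add_apply, hp, hq, add_zero]
  | monomial j a => rw [place_monomial, Finsupp.single_apply, if_neg (hn j)]

/-- The polynomials in `y`, where `ε = 1`, or in `z = 1 / y`, where `ε = -1`, times `x ^ i` or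
`(x / y) ^ i` respectively. -/
theorem ovPsi_place {g : ℕ → ℤ} {i : ℕ} {ε : ℤ} (hi : i ≤ 2)
    (hg : ∀ j : ℕ, g j = 2 * i + 3 * (ε * j - (1 - ε) / 2 * i)) (p : A[X]) :
    E.ovPsi (place g p) = eval₂ (algebraMap A E.Overlap) ↑(E.ovY ^ ε) p
      * (E.ovX ^ i * ↑(E.ovY ^ (-((1 - ε) / 2 * i)))) := by
  induction p using Polynomial.induction_on' with
  | add p q hp hq => rw [map_add, map_add, hp, hq, eval₂_add, add_mul]
  | monomial n a =>
    rw [place_monomial, ovPsi_single, hg, E.ovE_eq hi, eval₂_monomial, Algebra.smul_def,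
      sub_eq_add_neg, zpow_add, zpow_mul, zpow_natCast]
    push_cast
    ring

theorem eval₂_of₀ (p : A[X]) : eval₂ (algebraMap A E.Overlap) ↑E.ovY p
    = algebraMap E.Chart₀ E.Overlap (AdjoinRoot.of E.eq₀ p) := by
  induction p using Polynomial.induction_on' with
  | add p q hp hq => rw [eval₂_add, hp, hq, map_add, map_add]
  | monomial n a =>
    rw [eval₂_monomial, coe_ovY, ← C_mul_X_pow_eq_monomial, map_mul, map_pow, map_mul, map_pow]
    rfl

theorem restrict₁_x₁ : algebraMap E.Chart₁ E.Overlap E.x₁ = E.ovX * ↑(E.ovY ^ (-1 : ℤ)) := by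
  change E.restrict₁ (AdjoinRoot.root _) = _
  rw [restrict₁, AdjoinRoot.lift_root, zpow_neg_one, coe_ovY_inv]
  rfl

theorem restrict₁_z₁ : algebraMap E.Chart₁ E.Overlap E.z₁ = ↑(E.ovY ^ (-1 : ℤ)) := by
  change E.restrict₁ (AdjoinRoot.of _ _) = _
  rw [restrict₁, AdjoinRoot.lift_of, zpow_neg_one, coe_ovY_inv, coe_eval₂RingHom, eval₂_X]

theorem eval₂_of₁ (p : A[X]) : eval₂ (algebraMap A E.Overlap) ↑(E.ovY ^ (-1 : ℤ)) p
    = algebraMap E.Chart₁ E.Overlap (AdjoinRoot.of E.eq₁ p) := by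
  change _ = E.restrict₁ (AdjoinRoot.of _ _)
  rw [restrict₁, AdjoinRoot.lift_of, zpow_neg_one, coe_ovY_inv, coe_eval₂RingHom]

/-- The coordinates on the overlap of `p + q x + r x²` on the chart `Z ≠ 0`, for `p`, `q`, `r`
polynomials in `y`. -/
def coords₀ (p q r : A[X]) : ℤ →₀ A :=
  place (fun j => 3 * j) p + place (fun j => 2 + 3 * j) q + place (fun j => 4 + 3 * j) r

theorem ovPsi_coords₀ (p q r : A[X]) : E.ovPsi (coords₀ p q r)
    = algebraMap E.Chart₀ E.Overlap (AdjoinRoot.of E.eq₀ p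
      + AdjoinRoot.of E.eq₀ q * AdjoinRoot.root E.eq₀
      + AdjoinRoot.of E.eq₀ r * AdjoinRoot.root E.eq₀ ^ 2) := by
  rw [coords₀, map_add, map_add,
    E.ovPsi_place (i := 0) (ε := 1) (by omega) (fun j => by push_cast; ring),
    E.ovPsi_place (i := 1) (ε := 1) (by omega) (fun j => by push_cast; ring),
    E.ovPsi_place (i := 2) (ε := 1) (by omega) (fun j => by push_cast; ring)]
  simp only [zpow_one, eval₂_of₀, map_add, map_mul, map_pow, sub_self, Int.zero_ediv, zero_mul,
    neg_zero, zpow_zero, Units.val_one, mul_one, pow_zero, pow_one]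
  rfl

/-- The coordinates on the overlap of `p + q x + r x²` on the chart `Y ≠ 0`, for `p`, `q`, `r`
polynomials in `z`. -/
def coords₁ (p q r : A[X]) : ℤ →₀ A :=
  place (fun j => -3 * j) p + place (fun j => -1 - 3 * j) q + place (fun j => -2 - 3 * j) r

theorem ovPsi_coords₁ (p q r : A[X]) : E.ovPsi (coords₁ p q r)
    = algebraMap E.Chart₁ E.Overlap (AdjoinRoot.of E.eq₁ p
      + AdjoinRoot.of E.eq₁ q * AdjoinRoot.root E.eq₁
      + AdjoinRoot.of E.eq₁ r * AdjoinRoot.root E.eq₁ ^ 2) := by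
  have h2 : ((1 : ℤ) - -1) / 2 = 1 := by norm_num
  have hx : algebraMap E.Chart₁ E.Overlap (AdjoinRoot.root E.eq₁) = _ := E.restrict₁_x₁
  rw [coords₁, map_add, map_add,
    E.ovPsi_place (i := 0) (ε := -1) (by omega) (fun j => by rw [h2]; push_cast; ring),
    E.ovPsi_place (i := 1) (ε := -1) (by omega) (fun j => by rw [h2]; push_cast; ring),
    E.ovPsi_place (i := 2) (ε := -1) (by omega) (fun j => by rw [h2]; push_cast; ring), h2]
  simp only [eval₂_of₁, map_add, map_mul, map_pow, hx]
  simp only [mul_pow, one_mul, ← Units.val_pow_eq_pow_val, ← zpow_natCast, ← zpow_mul]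
  simp

theorem coords₁_eq_zero {p q r : A[X]} (h : coords₁ p q r = 0) : p = 0 ∧ q = 0 ∧ r = 0 := by
  have h' : ∀ n, coords₁ p q r n = 0 := fun n => by rw [h]; rfl
  simp only [coords₁, Finsupp.add_apply] at h'
  refine ⟨Polynomial.ext fun j => ?_, Polynomial.ext fun j => ?_, Polynomial.ext fun j => ?_⟩
  · have := h' (-3 * j)
    rw [place_apply (g := fun j : ℕ => -3 * (j : ℤ)) (fun a b h => by simp at h; exact h),
      place_apply_of_ne _ (by intro j; omega), place_apply_of_ne _ (by intro j; omega)] at this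
    simpa using this
  · have := h' (-1 - 3 * j)
    rw [place_apply (g := fun j : ℕ => -1 - 3 * (j : ℤ)) (fun a b h => by simp at h; exact h),
      place_apply_of_ne _ (by intro j; omega), place_apply_of_ne _ (by intro j; omega)] at this
    simpa using this
  · have := h' (-2 - 3 * j)
    rw [place_apply (g := fun j : ℕ => -2 - 3 * (j : ℤ)) (fun a b h => by simp at h; exact h),
      place_apply_of_ne _ (by intro j; omega), place_apply_of_ne _ (by intro j; omega)] at this
    simpa using this

/-- Every sequence becomes the coordinates of a function on the chart `Z ≠ 0` after multiplication
by a power of `y`. -/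
theorem exists_shift (φ : ℤ →₀ A) : ∃ K : ℕ, ∀ k : ℕ, K ≤ k → ∃ p q r : A[X],
    φ.mapDomain (· + 3 * (k : ℤ)) = coords₀ p q r := by
  induction φ using Finsupp.induction_linear with
  | zero => exact ⟨0, fun k _ => ⟨0, 0, 0, by simp [coords₀]⟩⟩
  | add f g hf hg =>
    obtain ⟨K, hK⟩ := hf
    obtain ⟨K', hK'⟩ := hg
    refine ⟨max K K', fun k hk => ?_⟩
    obtain ⟨p, q, r, h⟩ := hK k (le_trans (le_max_left _ _) hk)
    obtain ⟨p', q', r', h'⟩ := hK' k (le_trans (le_max_right _ _) hk)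
    refine ⟨p + p', q + q', r + r', ?_⟩
    rw [Finsupp.mapDomain_add, h, h']
    simp only [coords₀, map_add]
    abel
  | single n a =>
    obtain ⟨i, hi, j, rfl⟩ := exists_index n
    refine ⟨j.natAbs, fun k hk => ?_⟩
    rw [Finsupp.mapDomain_single]
    have hm : ∀ g : ℕ → ℤ, g (j + k).toNat = 2 * i + 3 * j + 3 * k →
        Finsupp.single (2 * (i : ℤ) + 3 * j + 3 * k) a = place g (monomial (j + k).toNat a) :=
      fun g hg => by rw [place_monomial, hg]
    interval_cases i
    · refine ⟨monomial (j + k).toNat a, 0, 0, ?_⟩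
      rw [coords₀, map_zero, map_zero, add_zero, add_zero]
      exact hm _ (by omega)
    · refine ⟨0, monomial (j + k).toNat a, 0, ?_⟩
      rw [coords₀, map_zero, map_zero, add_zero, zero_add]
      exact hm _ (by omega)
    · refine ⟨0, 0, monomial (j + k).toNat a, ?_⟩
      rw [coords₀, map_zero, map_zero, zero_add, zero_add]
      exact hm _ (by omega)

variable [Nontrivial A]

theorem exists_chart₀ (z : E.Chart₀) : ∃ p q r : A[X], z = AdjoinRoot.of E.eq₀ p
    + AdjoinRoot.of E.eq₀ q * AdjoinRoot.root E.eq₀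
    + AdjoinRoot.of E.eq₀ r * AdjoinRoot.root E.eq₀ ^ 2 :=
  adjoinRoot_cubic_exists E.isUnit_C_a E.eq₀_eq z

theorem exists_chart₁ (z : E.Chart₁) : ∃ p q r : A[X], z = AdjoinRoot.of E.eq₁ p
    + AdjoinRoot.of E.eq₁ q * AdjoinRoot.root E.eq₁
    + AdjoinRoot.of E.eq₁ r * AdjoinRoot.root E.eq₁ ^ 2 :=
  adjoinRoot_cubic_exists E.isUnit_C_a rfl z

theorem y₀_mul_eq_zero {b : E.Chart₀} (h : E.y₀ * b = 0) : b = 0 := by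
  obtain ⟨p, q, r, rfl⟩ := E.exists_chart₀ b
  have h' : AdjoinRoot.of E.eq₀ (X * p) + AdjoinRoot.of E.eq₀ (X * q) * AdjoinRoot.root E.eq₀
    + AdjoinRoot.of E.eq₀ (X * r) * AdjoinRoot.root E.eq₀ ^ 2 = 0 := by
    rw [← h, map_mul, map_mul, map_mul]
    change E.y₀ * _ + E.y₀ * _ * _ + E.y₀ * _ * _ = _
    ring
  obtain ⟨h1, h2, h3⟩ := adjoinRoot_cubic_unique E.isUnit_C_a E.eq₀_eq h'
  rw [monic_X.mul_right_eq_zero_iff] at h1 h2 h3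
  rw [h1, h2, h3]
  simp

theorem y₀_mem_nonZeroDivisors : E.y₀ ∈ nonZeroDivisors E.Chart₀ :=
  mem_nonZeroDivisors_iff.2 ⟨fun _ h => E.y₀_mul_eq_zero h,
    fun _ h => E.y₀_mul_eq_zero ((mul_comm _ _).trans h)⟩

theorem chart₀_injective : Function.Injective (algebraMap E.Chart₀ E.Overlap) :=
  IsLocalization.injective E.Overlap
    (Submonoid.powers_le.2 E.y₀_mem_nonZeroDivisors)

theorem ovPsi_injective : Function.Injective E.ovPsi := by
  rw [injective_iff_map_eq_zero]
  intro φ hφ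
  obtain ⟨K, hK⟩ := exists_shift φ
  obtain ⟨p, q, r, h⟩ := hK K le_rfl
  have h1 := E.ovPsi_shift K φ
  rw [h, hφ, mul_zero, ovPsi_coords₀] at h1
  obtain ⟨rfl, rfl, rfl⟩ := adjoinRoot_cubic_unique E.isUnit_C_a E.eq₀_eq
    ((injective_iff_map_eq_zero _).1 E.chart₀_injective _ h1)
  refine Finsupp.mapDomain_injective (f := (· + 3 * (K : ℤ))) (add_left_injective _) ?_
  rw [h]
  simp [coords₀]

theorem chart₁_injective : Function.Injective (algebraMap E.Chart₁ E.Overlap) := by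
  rw [injective_iff_map_eq_zero]
  intro b hb
  obtain ⟨p, q, r, rfl⟩ := E.exists_chart₁ b
  rw [← ovPsi_coords₁] at hb
  obtain ⟨rfl, rfl, rfl⟩ :=
    coords₁_eq_zero ((injective_iff_map_eq_zero _).1 E.ovPsi_injective _ hb)
  simp

theorem ovPsi_surjective : Function.Surjective E.ovPsi := by
  intro h
  obtain ⟨n, b, hb⟩ := IsLocalization.Away.surj E.y₀ h
  obtain ⟨p, q, r, rfl⟩ := E.exists_chart₀ b
  refine ⟨(coords₀ p q r).mapDomain (· + 3 * (-n : ℤ)), ?_⟩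
  rw [ovPsi_shift, ovPsi_coords₀, ← hb, ← coe_ovY, zpow_neg, zpow_natCast]
  rw [mul_comm h, ← Units.val_pow_eq_pow_val, Units.inv_mul_cancel_left]

/-- The functions `ovE n` are a basis of the functions on the overlap. -/
def ovBasis : Module.Basis ℤ A E.Overlap :=
  Module.Basis.ofRepr
    (LinearEquiv.ofBijective E.ovPsi ⟨E.ovPsi_injective, E.ovPsi_surjective⟩).symm

theorem ovBasis_repr_ovPsi (φ : ℤ →₀ A) : E.ovBasis.repr (E.ovPsi φ) = φ :=
  (LinearEquiv.ofBijective E.ovPsi ⟨E.ovPsi_injective, E.ovPsi_surjective⟩).symm_apply_apply φ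

theorem ovBasis_apply (n : ℤ) : E.ovBasis n = E.ovE n := by
  have h := E.ovBasis_repr_ovPsi (Finsupp.single n 1)
  rw [ovPsi_single, one_smul] at h
  exact Module.Basis.apply_eq_iff.2 h

theorem coe_ovBasis : ⇑E.ovBasis = E.ovE := funext E.ovBasis_apply

/-- The functions on the overlap with a pole of order at most `N` at infinity. -/
def ovF (N : ℤ) : Submodule A E.Overlap := Submodule.span A (E.ovE '' Set.Iic N)

theorem mem_ovF {N : ℤ} {h : E.Overlap} :
    h ∈ E.ovF N ↔ ∀ n, N < n → E.ovBasis.repr h n = 0 := by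
  rw [ovF, ← coe_ovBasis, Module.Basis.mem_span_image]
  constructor
  · intro hs n hn
    by_contra hne
    exact absurd (hs (Finsupp.mem_support_iff.2 hne)) (not_le.2 hn)
  · intro hs n hn
    by_contra hne
    exact (Finsupp.mem_support_iff.1 hn) (hs n (not_le.1 hne))

/-- The functions without a pole at infinity are those that extend to the chart `Y ≠ 0`. -/
theorem mem_ovF_zero {h : E.Overlap} :
    h ∈ E.ovF 0 ↔ ∃ b, algebraMap E.Chart₁ E.Overlap b = h := by
  constructor
  · intro hh
    have : E.ovF 0 ≤ LinearMap.range (IsScalarTower.toAlgHom A E.Chart₁ E.Overlap).toLinearMap := by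
      rw [ovF, Submodule.span_le]
      rintro _ ⟨n, hn, rfl⟩
      obtain ⟨i, hi, j, rfl⟩ := exists_index n
      rw [Set.mem_Iic] at hn
      refine ⟨E.x₁ ^ i * E.z₁ ^ (-(i + j)).toNat, ?_⟩
      rw [AlgHom.toLinearMap_apply, IsScalarTower.toAlgHom_apply, map_mul, map_pow, map_pow,
        restrict₁_x₁, restrict₁_z₁, E.ovE_eq hi, mul_pow, mul_assoc,
        ← pow_add, ← Units.val_pow_eq_pow_val, ← zpow_natCast, ← zpow_mul]
      congr 3
      push_cast
      omega
    exact this hh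
  · rintro ⟨b, rfl⟩
    obtain ⟨p, q, r, rfl⟩ := E.exists_chart₁ b
    rw [← ovPsi_coords₁, mem_ovF]
    intro n hn
    rw [ovBasis_repr_ovPsi, coords₁, Finsupp.add_apply, Finsupp.add_apply,
      place_apply_of_ne _ (by intro j; omega), place_apply_of_ne _ (by intro j; omega),
      place_apply_of_ne _ (by intro j; omega), add_zero, add_zero]

/-- A function on the affine curve involves no basis element vanishing at infinity, and none with a
simple pole there. -/
theorem repr_chart₀ (b : E.Chart₀) {n : ℤ} (hn : n < 0 ∨ n = 1) :
    E.ovBasis.repr (algebraMap E.Chart₀ E.Overlap b) n = 0 := by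
  obtain ⟨p, q, r, rfl⟩ := E.exists_chart₀ b
  rw [← ovPsi_coords₀, ovBasis_repr_ovPsi, coords₀, Finsupp.add_apply, Finsupp.add_apply,
      place_apply_of_ne _ (by intro j; omega), place_apply_of_ne _ (by intro j; omega),
      place_apply_of_ne _ (by intro j; omega), add_zero, add_zero]

end Basis

/-! ### The invariant vector field and pole orders -/

section Field

variable {A : Type*} [CommRing A] (E : CubicCurve A)

/-- The derivative of the cubic, at the coordinate `x`. -/
def cubicDer : E.Chart₀ := 3 * algebraMap A E.Chart₀ E.a * E.x₀ ^ 2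
  + 2 * algebraMap A E.Chart₀ E.b * E.x₀ + algebraMap A E.Chart₀ E.c

theorem ham_x₀ : ham E.eq₀ E.x₀ = 2 * E.y₀ := by
  have h : innerDer E.eq₀ = -2 * C X := by
    have hX : innerDer (X : A[X][X]) = 0 := coeffDer_X _
    have hC : ∀ p : A[X], innerDer (C p) = C (derivative p) := fun p => coeffDer_C _ _
    rw [eq₀_eq]
    simp only [map_add, Derivation.leibniz, Derivation.leibniz_pow, hX, hC]
    simp
    ring
  rw [x₀, ham_root, h]
  simp [y₀, map_ofNat]

theorem ham_y₀ : ham E.eq₀ E.y₀ = E.cubicDer := by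
  have h : derivative E.eq₀ = 3 * C (C E.a) * X ^ 2 + 2 * C (C E.b) * X + C (C E.c) := by
    rw [eq₀_eq]
    simp only [derivative_add, derivative_mul, derivative_C, derivative_X_pow, derivative_X]
    simp [C_ofNat]
    ring
  rw [y₀, ham_of_X, h, cubicDer]
  simp only [map_add, map_mul, map_pow, AdjoinRoot.mk_X, AdjoinRoot.mk_C, map_ofNat]
  rfl

/-- The vector field on the overlap dual to the invariant differential `dx / 2y`. -/
def ovD : Derivation A E.Overlap E.Overlap := localizeDer E.y₀ (ham E.eq₀)

theorem ovD_chart₀ (b : E.Chart₀) : E.ovD (algebraMap E.Chart₀ E.Overlap b)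
    = algebraMap E.Chart₀ E.Overlap (ham E.eq₀ b) := localizeDer_algebraMap _ _ _

theorem ovD_ovX : E.ovD E.ovX = 2 * ↑E.ovY := by
  rw [ovX, ovD_chart₀, ham_x₀, map_mul, map_ofNat, coe_ovY]

/-- The derivative of the cubic, as a function on the overlap. -/
def ovG : E.Overlap := 3 * algebraMap A E.Overlap E.a * E.ovX ^ 2
  + 2 * algebraMap A E.Overlap E.b * E.ovX + algebraMap A E.Overlap E.c

theorem ovD_ovY : E.ovD ↑E.ovY = E.ovG := by
  rw [coe_ovY, ovD_chart₀, ham_y₀, cubicDer]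
  simp only [map_add, map_mul, map_pow, map_ofNat,
    ← IsScalarTower.algebraMap_apply A E.Chart₀ E.Overlap]
  rfl

theorem ov_eq : algebraMap A E.Overlap E.a * E.ovX ^ 3 + algebraMap A E.Overlap E.b * E.ovX ^ 2
    + algebraMap A E.Overlap E.c * E.ovX + algebraMap A E.Overlap E.d = ↑E.ovY ^ 2 := by
  have h := congrArg (algebraMap E.Chart₀ E.Overlap) E.eq_chart₀
  simp only [map_add, map_mul, map_pow, ← IsScalarTower.algebraMap_apply A E.Chart₀ E.Overlap] at h
  exact h

theorem ovD_zpow (j : ℤ) : E.ovD ↑(E.ovY ^ j) = j * ↑(E.ovY ^ (j - 1)) * E.ovG := by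
  have hs : ∀ j : ℤ, E.ovD ↑(E.ovY ^ (j + 1))
      = ↑E.ovY * E.ovD ↑(E.ovY ^ j) + ↑(E.ovY ^ j) * E.ovG := by
    intro j
    rw [zpow_add_one, Units.val_mul, Derivation.leibniz, ovD_ovY, smul_eq_mul, smul_eq_mul]
    ring
  have hy : ∀ j : ℤ, (↑(E.ovY ^ (j + 1)) : E.Overlap) = ↑E.ovY * ↑(E.ovY ^ j) := by
    intro j
    rw [zpow_add_one, Units.val_mul, mul_comm]
  induction j using Int.induction_on with
  | zero => simp
  | succ i ih =>
    have h1 := hy (i - 1)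
    rw [sub_add_cancel] at h1
    rw [hs, ih, add_sub_cancel_right, h1]
    push_cast
    ring
  | pred i ih =>
    have h0 := hs (-i - 1)
    have h2 := hy (-i - 1 - 1)
    rw [sub_add_cancel] at h0 h2
    rw [ih] at h0
    refine E.ovY.isUnit.mul_left_cancel ?_
    rw [h2] at h0 ⊢
    push_cast at h0 ⊢
    linear_combination -h0

variable {E} in
theorem ovF_mono {M N : ℤ} (h : M ≤ N) : E.ovF M ≤ E.ovF N :=
  Submodule.span_mono (Set.image_mono (Set.Iic_subset_Iic.2 h))

theorem ovE_mem {n N : ℤ} (h : n ≤ N) : E.ovE n ∈ E.ovF N :=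
  Submodule.subset_span ⟨n, h, rfl⟩

theorem mul_mem_ovF {i : ℕ} (hi : i ≤ 2) {j N : ℤ} (h : 2 * i + 3 * j ≤ N) (a : A) :
    algebraMap A E.Overlap a * (E.ovX ^ i * ↑(E.ovY ^ j)) ∈ E.ovF N := by
  rw [← E.ovE_eq hi, ← Algebra.smul_def]
  exact Submodule.smul_mem _ _ (E.ovE_mem h)

/-- The invariant vector field raises pole orders by one, with `n` times a unit as its symbol in
order `n`. -/
theorem exists_symbol (n : ℤ) : ∃ u : A, IsUnit u ∧
    E.ovD (E.ovE n) - (n * u) • E.ovE (n + 1) ∈ E.ovF n := by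
  obtain ⟨i, hi, j, rfl⟩ := exists_index n
  obtain ⟨a', ha'⟩ := E.isUnit_a.exists_left_inv
  have ha := congrArg (algebraMap A E.Overlap) ha'
  rw [map_mul, map_one] at ha
  have hy : (↑(E.ovY ^ j) : E.Overlap) = ↑E.ovY * ↑(E.ovY ^ (j - 1)) := by
    conv_lhs => rw [← sub_add_cancel j 1, zpow_add_one, Units.val_mul, mul_comm]
  have hy' : (↑(E.ovY ^ (j + 1)) : E.Overlap) = ↑E.ovY ^ 2 * ↑(E.ovY ^ (j - 1)) := by
    rw [zpow_add_one, Units.val_mul, hy]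
    ring
  have he := E.ov_eq
  rw [E.ovE_eq hi]
  interval_cases i
  · refine ⟨E.a, E.isUnit_a, ?_⟩
    rw [show 2 * ((0 : ℕ) : ℤ) + 3 * j + 1 = 2 * (2 : ℕ) + 3 * (j - 1) by push_cast; ring,
      E.ovE_eq le_rfl]
    have e : E.ovD (E.ovX ^ 0 * ↑(E.ovY ^ j))
        - (((2 * ((0 : ℕ) : ℤ) + 3 * j : ℤ) : A) * E.a) • (E.ovX ^ 2 * ↑(E.ovY ^ (j - 1)))
        = algebraMap A E.Overlap (2 * j * E.b) * (E.ovX ^ 1 * ↑(E.ovY ^ (j - 1)))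
        + algebraMap A E.Overlap (j * E.c) * (E.ovX ^ 0 * ↑(E.ovY ^ (j - 1))) := by
      rw [pow_zero, one_mul, ovD_zpow, ovG, Algebra.smul_def]
      simp only [map_mul, map_intCast, map_ofNat]
      push_cast
      ring
    rw [e]
    refine Submodule.add_mem _ (E.mul_mem_ovF ?_ ?_ _) (E.mul_mem_ovF ?_ ?_ _)
    all_goals omega
  · refine ⟨1, isUnit_one, ?_⟩
    rw [show 2 * ((1 : ℕ) : ℤ) + 3 * j + 1 = 2 * (0 : ℕ) + 3 * (j + 1) by push_cast; ring,
      E.ovE_eq (Nat.zero_le 2)]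
    have e : E.ovD (E.ovX ^ 1 * ↑(E.ovY ^ j))
        - (((2 * ((1 : ℕ) : ℤ) + 3 * j : ℤ) : A) * 1) • (E.ovX ^ 0 * ↑(E.ovY ^ (j + 1)))
        = algebraMap A E.Overlap (-j * E.b) * (E.ovX ^ 2 * ↑(E.ovY ^ (j - 1)))
        + algebraMap A E.Overlap (-2 * j * E.c) * (E.ovX ^ 1 * ↑(E.ovY ^ (j - 1)))
        + algebraMap A E.Overlap (-3 * j * E.d) * (E.ovX ^ 0 * ↑(E.ovY ^ (j - 1))) := by
      rw [pow_zero, one_mul, pow_one, Derivation.leibniz, ovD_zpow, ovD_ovX, ovG,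
        Algebra.smul_def (R := A) (A := E.Overlap), hy', hy]
      simp only [map_mul, map_neg, map_intCast, map_ofNat, smul_eq_mul, map_one]
      push_cast
      linear_combination (3 * j * ↑(E.ovY ^ (j - 1)) : E.Overlap) * he
    rw [e]
    refine Submodule.add_mem _ (Submodule.add_mem _ (E.mul_mem_ovF ?_ ?_ _)
      (E.mul_mem_ovF ?_ ?_ _)) (E.mul_mem_ovF ?_ ?_ _)
    all_goals omega
  -- Here the derivative contains `x ^ 4`, which is reduced by the equation of the curve; the
  -- inverse `a'` of the leading coefficient of the cubic comes from there.
  · refine ⟨1, isUnit_one, ?_⟩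
    rw [show 2 * ((2 : ℕ) : ℤ) + 3 * j + 1 = 2 * (1 : ℕ) + 3 * (j + 1) by push_cast; ring,
      E.ovE_eq one_le_two]
    have e : E.ovD (E.ovX ^ 2 * ↑(E.ovY ^ j))
        - (((2 * ((2 : ℕ) : ℤ) + 3 * j : ℤ) : A) * 1) • (E.ovX ^ 1 * ↑(E.ovY ^ (j + 1)))
        = algebraMap A E.Overlap (-j * E.b * a') * (E.ovX ^ 0 * ↑(E.ovY ^ (j + 1)))
        + algebraMap A E.Overlap (j * E.b * a' * E.b - 2 * j * E.c)
          * (E.ovX ^ 2 * ↑(E.ovY ^ (j - 1)))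
        + algebraMap A E.Overlap (j * E.b * a' * E.c - 3 * j * E.d)
          * (E.ovX ^ 1 * ↑(E.ovY ^ (j - 1)))
        + algebraMap A E.Overlap (j * E.b * a' * E.d)
          * (E.ovX ^ 0 * ↑(E.ovY ^ (j - 1))) := by
      rw [pow_zero, one_mul, pow_one, Derivation.leibniz, Derivation.leibniz_pow, ovD_zpow, ovD_ovX,
        ovG, Algebra.smul_def (R := A) (A := E.Overlap), hy', hy]
      simp only [map_mul, map_sub, map_neg, map_intCast, map_ofNat, smul_eq_mul, map_one,
        nsmul_eq_mul]
      push_cast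
      linear_combination (3 * j * ↑(E.ovY ^ (j - 1)) * E.ovX : E.Overlap) * he
        - (j * algebraMap A E.Overlap E.b * algebraMap A E.Overlap a' * ↑(E.ovY ^ (j - 1))) * he
        + (j * algebraMap A E.Overlap E.b * ↑(E.ovY ^ (j - 1)) * E.ovX ^ 3) * ha
    rw [e]
    refine Submodule.add_mem _ (Submodule.add_mem _ (Submodule.add_mem _ (E.mul_mem_ovF ?_ ?_ _)
      (E.mul_mem_ovF ?_ ?_ _)) (E.mul_mem_ovF ?_ ?_ _)) (E.mul_mem_ovF ?_ ?_ _)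
    all_goals omega

theorem ovD_mem {N : ℤ} {h : E.Overlap} (hh : h ∈ E.ovF N) : E.ovD h ∈ E.ovF (N + 1) := by
  induction hh using Submodule.span_induction with
  | mem x hx =>
    obtain ⟨n, hn, rfl⟩ := hx
    rw [Set.mem_Iic] at hn
    obtain ⟨u, _, hu⟩ := E.exists_symbol n
    rw [← sub_add_cancel (E.ovD (E.ovE n)) ((n * u) • E.ovE (n + 1))]
    exact Submodule.add_mem _ (ovF_mono (by omega) hu)
      (Submodule.smul_mem _ _ (E.ovE_mem (by omega)))
  | zero => simp
  | add x y _ _ hx hy =>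
    rw [map_add]
    exact Submodule.add_mem _ hx hy
  | smul a x _ hx =>
    rw [Derivation.map_smul]
    exact Submodule.smul_mem _ _ hx

variable [Nontrivial A]

theorem repr_ovE (n m : ℤ) : E.ovBasis.repr (E.ovE n) m = if n = m then 1 else 0 := by
  rw [← ovBasis_apply, Module.Basis.repr_self, Finsupp.single_apply]

theorem sub_repr_mem {N : ℤ} {h : E.Overlap} (hh : h ∈ E.ovF N) :
    h - E.ovBasis.repr h N • E.ovE N ∈ E.ovF (N - 1) := by
  rw [mem_ovF] at hh ⊢
  intro n hn
  rw [map_sub, map_smul, Finsupp.sub_apply, Finsupp.smul_apply, repr_ovE]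
  split_ifs with hnN
  · rw [hnN, smul_eq_mul, mul_one, sub_self]
  · rw [hh n (by omega), smul_zero, sub_zero]

theorem exists_mem_ovF (h : E.Overlap) : ∃ N : ℕ, h ∈ E.ovF N := by
  obtain ⟨N, hN⟩ := (E.ovBasis.repr h).support.bddAbove
  refine ⟨N.toNat, (E.mem_ovF).2 fun n hn => ?_⟩
  by_contra hne
  have := hN (Finsupp.mem_support_iff.2 hne)
  omega

/-- In characteristic zero a function whose derivative has a pole of order at most `M + 1`, where
`0 ≤ M`, has a pole of order at most `M`: a leading term of order `n > M` is multiplied by `n` times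
a unit. -/
theorem mem_ovF_of_ovD_mem (hA : ∀ n : ℕ, n ≠ 0 → IsUnit (n : A)) {M : ℕ} {h : E.Overlap}
    (hh : E.ovD h ∈ E.ovF (M + 1 : ℕ)) : h ∈ E.ovF M := by
  obtain ⟨N, hN⟩ := E.exists_mem_ovF h
  induction N with
  | zero => exact ovF_mono (by omega) hN
  | succ N ih =>
    by_cases hNM : N + 1 ≤ M
    · exact ovF_mono (by omega) hN
    apply ih
    have h1 := E.sub_repr_mem hN
    set c := E.ovBasis.repr h (N + 1 : ℕ)
    obtain ⟨u, hu, hu'⟩ := E.exists_symbol (N + 1 : ℕ)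
    have h2 := E.ovD_mem h1
    rw [map_sub, Derivation.map_smul] at h2
    have h3 : (c * ((N + 1 : ℕ) * u)) • E.ovE ((N + 1 : ℕ) + 1) ∈ E.ovF (N + 1 : ℕ) := by
      have h4 := Submodule.sub_mem _ (Submodule.sub_mem _
        (ovF_mono (show ((M + 1 : ℕ) : ℤ) ≤ (N + 1 : ℕ) by omega) hh)
        (ovF_mono (by omega) h2)) (Submodule.smul_mem _ c hu')
      refine (congrArg (· ∈ E.ovF (N + 1 : ℕ)) ?_).mp h4
      rw [Int.cast_natCast]
      module
    rw [mem_ovF] at h3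
    have h5 := h3 _ (lt_add_one _)
    rw [map_smul, Finsupp.smul_apply, repr_ovE, if_pos rfl, smul_eq_mul, mul_one] at h5
    have hc : c = 0 := ((hA (N + 1) (by omega)).mul hu).mul_left_eq_zero.1 h5
    rw [hc, zero_smul, sub_zero] at h1
    exact ovF_mono (by omega) h1

end Field

end CubicCurve

namespace CubicCurve

/-! ### Relative forms on the charts and on the overlap -/

section Forms

variable {A : Type*} [CommRing A] (E : CubicCurve A)

theorem ham_x₁ : ham E.eq₁ E.x₁ = 1 - algebraMap A E.Chart₁ E.b * E.x₁ ^ 2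
    - 2 * algebraMap A E.Chart₁ E.c * E.x₁ * E.z₁ - 3 * algebraMap A E.Chart₁ E.d * E.z₁ ^ 2 := by
  have hX : innerDer (X : A[X][X]) = 0 := coeffDer_X _
  have hC : ∀ p : A[X], innerDer (C p) = C (derivative p) := fun p => coeffDer_C _ _
  have h : innerDer E.eq₁ = C (C E.b) * X ^ 2 + 2 * C (C E.c) * X * C X
      + 3 * C (C E.d) * C X ^ 2 - 1 := by
    simp only [eq₁, map_add, Derivation.leibniz, Derivation.leibniz_pow, hX, hC]
    simp [C_ofNat]
    ring
  rw [x₁, ham_root, h]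
  simp only [map_add, map_sub, map_mul, map_pow, AdjoinRoot.mk_X, AdjoinRoot.mk_C, map_ofNat,
    map_one]
  change -(algebraMap A E.Chart₁ E.b * E.x₁ ^ 2 + 2 * algebraMap A E.Chart₁ E.c * E.x₁ * E.z₁
    + 3 * algebraMap A E.Chart₁ E.d * E.z₁ ^ 2 - 1) = 1 - algebraMap A E.Chart₁ E.b * E.x₁ ^ 2
    - 2 * algebraMap A E.Chart₁ E.c * E.x₁ * E.z₁ - 3 * algebraMap A E.Chart₁ E.d * E.z₁ ^ 2
  ring

theorem ham_z₁ : ham E.eq₁ E.z₁ = 3 * algebraMap A E.Chart₁ E.a * E.x₁ ^ 2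
    + 2 * algebraMap A E.Chart₁ E.b * E.x₁ * E.z₁ + algebraMap A E.Chart₁ E.c * E.z₁ ^ 2 := by
  have h : derivative E.eq₁ = 3 * C (C E.a) * X ^ 2 + 2 * C (C E.b) * X * C X
      + C (C E.c) * C X ^ 2 := by
    simp only [eq₁, derivative_add, derivative_mul, derivative_C, derivative_X_pow, derivative_X]
    simp [C_ofNat]
    ring
  rw [z₁, ham_of_X, h]
  simp only [map_add, map_mul, map_pow, AdjoinRoot.mk_X, AdjoinRoot.mk_C, map_ofNat]
  rfl

/-- The Hamiltonian vector fields of the two charts differ by a sign on the overlap. -/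
theorem ovD_chart₁ (b : E.Chart₁) : E.ovD (algebraMap E.Chart₁ E.Overlap b)
    = -algebraMap E.Chart₁ E.Overlap (ham E.eq₁ b) := by
  let δ : Derivation A E.Chart₁ E.Overlap := E.ovD.compAlgebraMap E.Chart₁
    + (Algebra.linearMap E.Chart₁ E.Overlap).compDer (ham E.eq₁)
  have hδ : ∀ b, δ b = E.ovD (algebraMap E.Chart₁ E.Overlap b)
    + algebraMap E.Chart₁ E.Overlap (ham E.eq₁ b) := fun b => rfl
  have hy : (↑E.ovY : E.Overlap) * ↑(E.ovY ^ (-1 : ℤ)) = 1 := by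
    rw [zpow_neg_one, Units.mul_inv]
  have hy2 : (↑(E.ovY ^ (-1 - 1 : ℤ)) : E.Overlap) = ↑(E.ovY ^ (-1 : ℤ)) ^ 2 := by
    rw [← Units.val_pow_eq_pow_val, ← zpow_natCast, ← zpow_mul]
    rfl
  have he := E.ov_eq
  have hx : δ (AdjoinRoot.root E.eq₁) = 0 := by
    change δ E.x₁ = 0
    rw [hδ, ham_x₁, restrict₁_x₁, Derivation.leibniz, ovD_zpow, ovD_ovX, ovG, smul_eq_mul,
      smul_eq_mul, hy2]
    simp only [map_sub, map_mul, map_pow, map_ofNat, map_one, restrict₁_x₁, restrict₁_z₁,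
      ← IsScalarTower.algebraMap_apply A E.Chart₁ E.Overlap]
    generalize (↑(E.ovY ^ (-1 : ℤ)) : E.Overlap) = Z at *
    push_cast
    linear_combination (-3 * Z ^ 2) * he + (-3 * (E.ovY : E.Overlap) * Z - 1) * hy
  have hz : δ (AdjoinRoot.of E.eq₁ X) = 0 := by
    change δ E.z₁ = 0
    rw [hδ, ham_z₁, restrict₁_z₁, ovD_zpow, ovG, hy2]
    simp only [map_add, map_mul, map_pow, map_ofNat, restrict₁_x₁, restrict₁_z₁,
      ← IsScalarTower.algebraMap_apply A E.Chart₁ E.Overlap]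
    push_cast
    ring
  have h0 : δ b = 0 := by
    obtain ⟨b, rfl⟩ := AdjoinRoot.mk_surjective b
    rw [der_mk_eq, hx, hz, smul_zero, smul_zero, add_zero]
  exact eq_neg_of_add_eq_zero_left h0

/-- The coefficient of a relative form on the overlap with respect to `dx / 2y`. -/
def ovCoeff : Ω[E.Overlap⁄A] →ₗ[E.Overlap] E.Overlap := E.ovD.liftKaehlerDifferential

theorem ovCoeff_D (h : E.Overlap) : E.ovCoeff (D A _ h) = E.ovD h :=
  Derivation.liftKaehlerDifferential_comp_D _ h

theorem ovCoeff_map₀ (w : Ω[E.Chart₀⁄A]) :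
    E.ovCoeff (KaehlerDifferential.map A A E.Chart₀ E.Overlap w)
      = algebraMap E.Chart₀ E.Overlap (formCoeff E.eq₀ w) := by
  have hw : w ∈ Submodule.span E.Chart₀ (Set.range (D A E.Chart₀)) := by
    rw [span_range_derivation]
    trivial
  induction hw using Submodule.span_induction with
  | mem x hx =>
    obtain ⟨b, rfl⟩ := hx
    rw [map_D, ovCoeff_D, formCoeff_D, ovD_chart₀]
  | zero => simp only [map_zero]
  | add x y _ _ hx hy => simp only [map_add, hx, hy]
  | smul b x _ hx =>
    rw [map_smul, ← algebraMap_smul E.Overlap b, map_smul, map_smul, hx, smul_eq_mul, smul_eq_mul,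
      map_mul]

theorem ovCoeff_map₁ (w : Ω[E.Chart₁⁄A]) :
    E.ovCoeff (KaehlerDifferential.map A A E.Chart₁ E.Overlap w)
      = -algebraMap E.Chart₁ E.Overlap (formCoeff E.eq₁ w) := by
  have hw : w ∈ Submodule.span E.Chart₁ (Set.range (D A E.Chart₁)) := by
    rw [span_range_derivation]
    trivial
  induction hw using Submodule.span_induction with
  | mem x hx =>
    obtain ⟨b, rfl⟩ := hx
    rw [map_D, ovCoeff_D, formCoeff_D, ovD_chart₁]
  | zero => simp only [map_zero, neg_zero]
  | add x y _ _ hx hy =>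
    simp only [map_add, hx, hy]
    ring
  | smul b x _ hx =>
    rw [map_smul, ← algebraMap_smul E.Overlap b, map_smul, map_smul, hx, smul_eq_mul, smul_eq_mul,
      map_mul, mul_neg]

/-- The form `dx / 2y` generates the differentials on the overlap. -/
theorem ovD_smul_form (h : E.Overlap) : D A E.Overlap h
    = E.ovD h • KaehlerDifferential.map A A E.Chart₀ E.Overlap E.isSmooth₀.form := by
  set η := KaehlerDifferential.map A A E.Chart₀ E.Overlap E.isSmooth₀.form
  have h0 : ∀ b : E.Chart₀, D A E.Overlap (algebraMap E.Chart₀ E.Overlap b)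
      = E.ovD (algebraMap E.Chart₀ E.Overlap b) • η := by
    intro b
    rw [← map_D A A, E.isSmooth₀.D_eq, map_smul, ovD_chart₀, algebraMap_smul]
  obtain ⟨n, b, hb⟩ := IsLocalization.Away.surj E.y₀ h
  have h1 := h0 b
  have h2 := h0 (E.y₀ ^ n)
  rw [map_pow] at h2
  rw [← hb, Derivation.leibniz, Derivation.leibniz, h2, add_smul, smul_eq_mul, mul_smul,
    smul_eq_mul, mul_smul] at h1
  have h3 := add_left_cancel h1
  rw [← coe_ovY, ← Units.val_pow_eq_pow_val] at h3
  exact (E.ovY ^ n).isUnit.smul_left_cancel.1 h3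

theorem ovCoeff_smul (w : Ω[E.Overlap⁄A]) : E.ovCoeff w
    • KaehlerDifferential.map A A E.Chart₀ E.Overlap E.isSmooth₀.form = w := by
  have hw : w ∈ Submodule.span E.Overlap (Set.range (D A E.Overlap)) := by
    rw [span_range_derivation]
    trivial
  induction hw using Submodule.span_induction with
  | mem x hx =>
    obtain ⟨b, rfl⟩ := hx
    rw [ovCoeff_D, ← ovD_smul_form]
  | zero => rw [map_zero, zero_smul]
  | add x y _ _ hx hy => rw [map_add, add_smul, hx, hy]
  | smul b x _ hx => rw [map_smul, smul_assoc, hx]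

theorem ovCoeff_injective : Function.Injective E.ovCoeff := fun w w' h => by
  rw [← E.ovCoeff_smul w, h, E.ovCoeff_smul]

end Forms

/-! ### Cohomology as forms on the affine curve modulo exact forms -/

section Affine

variable {A : Type} [CommRing A] (E : CubicCurve A)

/-- The coefficients of the exact forms on the chart `Z ≠ 0`. -/
def exact₀ : Submodule A E.Chart₀ := LinearMap.range (ham E.eq₀ : E.Chart₀ →ₗ[A] E.Chart₀)

theorem mem_exact₀ {b : E.Chart₀} : b ∈ E.exact₀ ↔ ∃ g, ham E.eq₀ g = b := Iff.rfl

/-- The restriction of a cohomology class to the affine curve, as the coefficient of a form modulo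
those of exact forms. -/
def affineClass : E.H1dR →ₗ[A] E.Chart₀ ⧸ E.exact₀ :=
  Submodule.liftQ (LinearMap.range (cechD₀ A E.Chart₀ E.Chart₁ E.Overlap))
    (E.exact₀.mkQ ∘ₗ (formCoeff E.eq₀).restrictScalars A ∘ₗ LinearMap.fst A _ _
      ∘ₗ (CechCocycle A E.Chart₀ E.Chart₁ E.Overlap).subtype) (by
    rintro _ ⟨g, rfl⟩
    rw [LinearMap.mem_ker]
    change E.exact₀.mkQ (formCoeff E.eq₀ (D A E.Chart₀ g.1)) = 0
    rw [formCoeff_D, Submodule.mkQ_apply, Submodule.Quotient.mk_eq_zero]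
    exact ⟨g.1, rfl⟩)

theorem affineClass_cechClass (c : CechCocycle A E.Chart₀ E.Chart₁ E.Overlap) :
    E.affineClass (cechClass c) = E.exact₀.mkQ (formCoeff E.eq₀ c.1.1) := rfl

theorem ovE_zero : E.ovE 0 = 1 := by
  simpa using E.ovE_eq (i := 0) (by omega) 0

theorem ovE_two : E.ovE 2 = E.ovX := by
  simpa using E.ovE_eq (i := 1) (by omega) 0

/-- The form `dX / Y` with `X = u x + r` and `Y = v y` is regular at infinity. -/
theorem exists_isFormClass {u v r κ : A} (hκ : v * κ = 2 * u) :
    ∃ ω, E.IsFormClass (algebraMap A E.Chart₀ u * E.x₀ + algebraMap A E.Chart₀ r)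
      (algebraMap A E.Chart₀ v * E.y₀) ω := by
  let w₀ : Ω[E.Chart₀⁄A] := algebraMap A E.Chart₀ κ • E.isSmooth₀.form
  let w₁ : Ω[E.Chart₁⁄A] := -algebraMap A E.Chart₁ κ • E.isSmooth₁.form
  have h₀ : formCoeff E.eq₀ w₀ = algebraMap A E.Chart₀ κ := by
    rw [map_smul, E.isSmooth₀.formCoeff_form, smul_eq_mul, mul_one]
  have h₁ : formCoeff E.eq₁ w₁ = -algebraMap A E.Chart₁ κ := by
    rw [map_smul, E.isSmooth₁.formCoeff_form, smul_eq_mul, mul_one]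
  refine ⟨_, ⟨⟨(w₀, w₁, 0), ?_⟩, rfl, ?_, rfl⟩⟩
  · rw [mem_cechCocycle]
    apply E.ovCoeff_injective
    change E.ovCoeff (KaehlerDifferential.map A A E.Chart₁ E.Overlap w₁
      - KaehlerDifferential.map A A E.Chart₀ E.Overlap w₀) = E.ovCoeff (D A E.Overlap 0)
    rw [map_sub, ovCoeff_map₀, ovCoeff_map₁, h₀, h₁, map_neg, neg_neg, map_zero, map_zero,
      ← IsScalarTower.algebraMap_apply A E.Chart₀ E.Overlap,
      ← IsScalarTower.algebraMap_apply A E.Chart₁ E.Overlap, sub_self]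
  · apply E.ovCoeff_injective
    change E.ovCoeff (_ • KaehlerDifferential.map A A E.Chart₀ E.Overlap w₀) = _
    rw [map_smul, ovCoeff_map₀, h₀, ovCoeff_D, ovD_chart₀, smul_eq_mul, ← map_mul]
    congr 1
    rw [map_add, Derivation.leibniz, Derivation.map_algebraMap, Derivation.map_algebraMap, ham_x₀,
      smul_zero, add_zero, add_zero, smul_eq_mul]
    have h3 := congrArg (algebraMap A E.Chart₀) hκ
    rw [map_mul, map_mul, map_ofNat] at h3
    linear_combination E.y₀ * h3

variable [Nontrivial A]

/-- A cohomology class is determined by its form on the affine curve: if that form is `dg`, then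
the sum of `g` and the function of the cocycle has a derivative without a pole at infinity, and so
extends to the chart `Y ≠ 0`. -/
theorem affineClass_injective (hA : ∀ n : ℕ, n ≠ 0 → IsUnit (n : A)) :
    Function.Injective E.affineClass := by
  rw [injective_iff_map_eq_zero]
  intro x hx
  obtain ⟨c, rfl⟩ := Submodule.mkQ_surjective _ x
  change E.affineClass (cechClass c) = 0 at hx
  rw [affineClass_cechClass, Submodule.mkQ_apply, Submodule.Quotient.mk_eq_zero] at hx
  obtain ⟨g₀, hg₀⟩ := hx
  have hw₀ : D A E.Chart₀ g₀ = c.1.1 := by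
    apply E.isSmooth₀.formCoeff_injective
    rw [formCoeff_D]
    exact hg₀
  have hc := (mem_cechCocycle c.1).1 c.2
  set h := c.1.2.2 + algebraMap E.Chart₀ E.Overlap g₀ with hh
  have hD : D A E.Overlap h = KaehlerDifferential.map A A E.Chart₁ E.Overlap c.1.2.1 := by
    rw [hh, map_add, ← hc, ← hw₀, map_D, sub_add_cancel]
  have hF : h ∈ E.ovF (0 : ℕ) := by
    refine E.mem_ovF_of_ovD_mem hA (ovF_mono (by omega : (0 : ℤ) ≤ _) ?_)
    rw [mem_ovF_zero, ← ovCoeff_D, hD, ovCoeff_map₁]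
    exact ⟨_, map_neg _ _⟩
  obtain ⟨g₁, hg₁⟩ := E.mem_ovF_zero.1 hF
  have hw₁ : D A E.Chart₁ g₁ = c.1.2.1 := by
    apply E.isSmooth₁.formCoeff_injective
    apply E.chart₁_injective
    rw [← neg_inj, ← ovCoeff_map₁, ← ovCoeff_map₁, map_D, hg₁, hD]
  refine (Submodule.Quotient.mk_eq_zero _).2 ⟨(g₀, g₁), Subtype.ext ?_⟩
  refine Prod.ext hw₀ (Prod.ext hw₁ ?_)
  change algebraMap E.Chart₁ E.Overlap g₁ - algebraMap E.Chart₀ E.Overlap g₀ = c.1.2.2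
  rw [hg₁, hh, add_sub_cancel_right]

/-- The classes of `dx / 2y` and `x dx / 2y` on the affine curve are independent. -/
theorem exact₀_independent (hA : ∀ n : ℕ, n ≠ 0 → IsUnit (n : A)) {α β : A}
    (h : algebraMap A E.Chart₀ α + algebraMap A E.Chart₀ β * E.x₀ ∈ E.exact₀) :
    α = 0 ∧ β = 0 := by
  obtain ⟨g, hg⟩ := E.mem_exact₀.1 h
  have e : E.ovD (algebraMap E.Chart₀ E.Overlap g) = α • E.ovE 0 + β • E.ovE 2 := by
    rw [ovD_chart₀, hg, map_add, map_mul, ← IsScalarTower.algebraMap_apply A E.Chart₀ E.Overlap,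
      ← IsScalarTower.algebraMap_apply A E.Chart₀ E.Overlap, E.ovE_zero, E.ovE_two,
      Algebra.smul_def, Algebra.smul_def, mul_one]
    rfl
  have h1 : algebraMap E.Chart₀ E.Overlap g ∈ E.ovF (1 : ℕ) := by
    refine E.mem_ovF_of_ovD_mem hA ?_
    rw [e]
    exact Submodule.add_mem _ (Submodule.smul_mem _ _ (E.ovE_mem (by omega)))
      (Submodule.smul_mem _ _ (E.ovE_mem (by omega)))
  have h2 : algebraMap E.Chart₀ E.Overlap g ∈ E.ovF (0 : ℕ) := by
    rw [mem_ovF] at h1 ⊢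
    intro n hn
    by_cases hn1 : n = 1
    · exact E.repr_chart₀ g (Or.inr hn1)
    · exact h1 n (by omega)
  have h3 : E.ovD (algebraMap E.Chart₀ E.Overlap g) = 0 := by
    have h4 := E.sub_repr_mem h2
    have h5 : algebraMap E.Chart₀ E.Overlap g
        - E.ovBasis.repr (algebraMap E.Chart₀ E.Overlap g) (0 : ℕ) • E.ovE (0 : ℕ) = 0 := by
      rw [← E.ovBasis.repr.map_eq_zero_iff]
      ext n
      by_cases hn : n < 0
      · rw [map_sub, map_smul, Finsupp.sub_apply, Finsupp.smul_apply, repr_ovE,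
          E.repr_chart₀ g (Or.inl hn), if_neg (by omega)]
        simp
      · exact E.mem_ovF.1 h4 n (by omega)
    rw [sub_eq_zero.1 h5, Nat.cast_zero, E.ovE_zero, Derivation.map_smul,
      Derivation.map_one_eq_zero, smul_zero]
  rw [e] at h3
  have h6 := congrArg E.ovBasis.repr h3
  have h7 := congrArg (· 0) h6
  have h8 := congrArg (· 2) h6
  simp only [map_add, map_smul, map_zero, Finsupp.add_apply, Finsupp.smul_apply, repr_ovE] at h7 h8
  simpa using And.intro h7 h8

/-- The classes of `dx / 2y` and `x dx / 2y` on the affine curve generate. -/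
theorem exists_sub_mem_exact₀ (hA : ∀ n : ℕ, n ≠ 0 → IsUnit (n : A)) (b : E.Chart₀) :
    ∃ α β : A,
    b - (algebraMap A E.Chart₀ α + algebraMap A E.Chart₀ β * E.x₀) ∈ E.exact₀ := by
  obtain ⟨N, hN⟩ := E.exists_mem_ovF (algebraMap E.Chart₀ E.Overlap b)
  induction N using Nat.strong_induction_on generalizing b with
  | _ N ih =>
  by_cases hN2 : N ≤ 2
  · set φ := E.ovBasis.repr (algebraMap E.Chart₀ E.Overlap b) with hφ
    refine ⟨φ 0, φ 2, ?_⟩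
    have : b = algebraMap A E.Chart₀ (φ 0) + algebraMap A E.Chart₀ (φ 2) * E.x₀ := by
      apply E.chart₀_injective
      have e : algebraMap E.Chart₀ E.Overlap
          (algebraMap A E.Chart₀ (φ 0) + algebraMap A E.Chart₀ (φ 2) * E.x₀)
          = φ 0 • E.ovE 0 + φ 2 • E.ovE 2 := by
        rw [map_add, map_mul, ← IsScalarTower.algebraMap_apply A E.Chart₀ E.Overlap,
          ← IsScalarTower.algebraMap_apply A E.Chart₀ E.Overlap, E.ovE_zero, E.ovE_two,
          Algebra.smul_def, Algebra.smul_def, mul_one]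
        rfl
      rw [e]
      apply E.ovBasis.repr.injective
      ext n
      rw [← hφ]
      simp only [map_add, map_smul, Finsupp.add_apply, Finsupp.smul_apply, repr_ovE, smul_eq_mul]
      by_cases h0 : n = 0
      · simp [h0]
      by_cases h2 : n = 2
      · simp [h2]
      rw [if_neg (Ne.symm h0), if_neg (Ne.symm h2), mul_zero, mul_zero, add_zero]
      by_cases h3 : 2 < n
      · exact E.mem_ovF.1 hN n (by omega)
      · exact E.repr_chart₀ b (by omega)
    rw [← this, sub_self]
    exact Submodule.zero_mem _
  · push Not at hN2
    obtain ⟨M, rfl⟩ : ∃ M, N = M + 1 := ⟨N - 1, by omega⟩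
    -- As `2 ≤ M`, there is a function `x ^ i y ^ j` on the affine curve with a pole of order `M`; a
    -- multiple of its derivative removes the leading term of order `M + 1`.
    obtain ⟨i, hi, j, hij⟩ := exists_index (M : ℤ)
    obtain ⟨u, hu, hu'⟩ := E.exists_symbol M
    obtain ⟨m, hm⟩ := ((hA M (by omega)).mul hu).exists_right_inv
    have hg : algebraMap E.Chart₀ E.Overlap (E.x₀ ^ i * E.y₀ ^ j.toNat) = E.ovE M := by
      rw [hij, E.ovE_eq hi, map_mul, map_pow, map_pow, ← coe_ovY, ← Units.val_pow_eq_pow_val,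
        ← zpow_natCast, Int.toNat_of_nonneg (by omega)]
      rfl
    set g := E.x₀ ^ i * E.y₀ ^ j.toNat
    have h1 := E.sub_repr_mem hN
    set c := E.ovBasis.repr (algebraMap E.Chart₀ E.Overlap b) (M + 1 : ℕ)
    obtain ⟨α, β, h⟩ := ih M (by omega) (b - (c * m) • ham E.eq₀ g) (by
      have h2 := Submodule.sub_mem _ (ovF_mono (by omega : ((M + 1 : ℕ) : ℤ) - 1 ≤ M) h1)
        (Submodule.smul_mem _ (c * m) hu')
      refine (congrArg (· ∈ E.ovF M) ?_).mp h2
      rw [map_sub, ← IsScalarTower.coe_toAlgHom' A E.Chart₀ E.Overlap, map_smul,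
        IsScalarTower.coe_toAlgHom', ← ovD_chart₀, hg]
      have hm' : c * m * ((M : ℤ) * u) = c := by
        rw [Int.cast_natCast]
        linear_combination c * hm
      rw [smul_sub, ← mul_smul, hm', Nat.cast_add, Nat.cast_one]
      abel)
    refine ⟨α, β, ?_⟩
    have h3 := Submodule.add_mem _ h (Submodule.smul_mem _ (c * m) (E.mem_exact₀.2 ⟨g, rfl⟩))
    refine (congrArg (· ∈ E.exact₀) ?_).mp h3
    abel

/-- A class of `dX / Y` with `X = u x + r` and `Y = v y` restricts to `κ dx / 2y` with
`κ = 2 u / v`. -/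
theorem affineClass_of_isFormClass {u v r κ : A} (hκ : v * κ = 2 * u) (hv : IsUnit v) {ω : E.H1dR}
    (h : E.IsFormClass (algebraMap A E.Chart₀ u * E.x₀ + algebraMap A E.Chart₀ r)
      (algebraMap A E.Chart₀ v * E.y₀) ω) :
    E.affineClass ω = E.exact₀.mkQ (algebraMap A E.Chart₀ κ) := by
  obtain ⟨w, -, hw, rfl⟩ := h
  rw [affineClass_cechClass]
  congr 1
  have h1 := congrArg E.ovCoeff hw
  rw [map_smul, ovCoeff_map₀, ovCoeff_D, ovD_chart₀, smul_eq_mul, ← map_mul] at h1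
  have h2 := E.chart₀_injective h1
  rw [map_add, Derivation.leibniz, Derivation.map_algebraMap, Derivation.map_algebraMap, ham_x₀,
    smul_zero, add_zero, add_zero, smul_eq_mul] at h2
  have h3 := congrArg (algebraMap A E.Chart₀) hκ
  rw [map_mul, map_mul, map_ofNat] at h3
  refine (hv.map (algebraMap A E.Chart₀)).mul_left_cancel (sub_eq_zero.1 (E.y₀_mul_eq_zero ?_))
  linear_combination h2 - E.y₀ * h3

end Affine

end CubicCurve

namespace CubicCurve

/-! ### The Gauss–Manin connection on the affine curve -/

section GaussManin

variable {k : Type*} {A : Type} [CommRing k] [CommRing A] [Algebra k A] (E : CubicCurve A)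
  (θ : Derivation k A A)

/-- The class of the form `(α + β x) dx / 2y` on the affine curve. -/
def linClass (α β : A) : E.Chart₀ ⧸ E.exact₀ :=
  E.exact₀.mkQ (algebraMap A E.Chart₀ α + algebraMap A E.Chart₀ β * E.x₀)

theorem smul_linClass (c α β : A) : c • E.linClass α β = E.linClass (c * α) (c * β) := by
  rw [linClass, linClass, ← map_smul]
  congr 1
  rw [Algebra.smul_def, map_mul, map_mul]
  ring

theorem linClass_add (α β α' β' : A) :
    E.linClass α β + E.linClass α' β' = E.linClass (α + α') (β + β') := by
  rw [linClass, linClass, linClass, ← map_add]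
  congr 1
  rw [map_add, map_add]
  ring

/-- On the class of `b η`, where `η = dx / 2y`, the connection is the Lie derivative along the lift
`L`: it is `L(b) η + b L(η)`. -/
theorem affineClass_gaussManin {ω : E.H1dR} {b : E.Chart₀} (h : E.affineClass ω = E.exact₀.mkQ b) :
    E.affineClass ((E.gaussManin θ).toHom ω) = E.exact₀.mkQ ((E.lift₀ θ).toDer b
      + b * formCoeff E.eq₀ ((E.lift₀ θ).lie E.isSmooth₀.form)) := by
  obtain ⟨c, rfl⟩ := Submodule.mkQ_surjective _ ω
  change E.affineClass (cechClass c) = _ at h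
  change E.exact₀.mkQ (formCoeff E.eq₀ ((E.lift₀ θ).lie c.1.1)) = _
  rw [affineClass_cechClass, Submodule.mkQ_apply, Submodule.mkQ_apply, Submodule.Quotient.eq,
    mem_exact₀] at h
  obtain ⟨g, hg⟩ := h
  have hc : c.1.1 = (b + ham E.eq₀ g) • E.isSmooth₀.form := by
    rw [hg, add_sub_cancel, E.isSmooth₀.formCoeff_smul]
  rw [hc, DerivLift.lie_smul, map_add, map_smul, map_smul, E.isSmooth₀.formCoeff_form,
    Submodule.mkQ_apply, Submodule.mkQ_apply, Submodule.Quotient.eq, mem_exact₀]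
  refine ⟨(E.lift₀ θ).toDer g, ?_⟩
  rw [E.isSmooth₀.ham_lift, map_add, smul_eq_mul, smul_eq_mul]
  ring

/-- A vector `(ξ, ζ)` tangent to the curve is a multiple of the Hamiltonian vector field. -/
theorem exists_eq_mul_ham {ξ ζ : E.Chart₀} (h : E.cubicDer * ξ = 2 * E.y₀ * ζ) :
    ∃ g, ξ = 2 * E.y₀ * g ∧ ζ = E.cubicDer * g := by
  obtain ⟨p, q, hpq⟩ := E.isSmooth₀
  have hx := ham_root E.eq₀
  have hy := ham_of_X E.eq₀
  change ham E.eq₀ E.x₀ = _ at hx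
  change ham E.eq₀ E.y₀ = _ at hy
  rw [ham_x₀] at hx
  rw [ham_y₀] at hy
  rw [map_add, map_mul, map_mul, ← hy, ← neg_eq_iff_eq_neg.2 hx] at hpq
  refine ⟨-AdjoinRoot.mk E.eq₀ p * ξ + AdjoinRoot.mk E.eq₀ q * ζ, ?_, ?_⟩
  · linear_combination -ξ * hpq + AdjoinRoot.mk E.eq₀ q * h
  · linear_combination -ζ * hpq + AdjoinRoot.mk E.eq₀ p * h

/-- A solution of `f^θ = 2 r f - σ f'` for the cubic `f`, with `r = r₀ + r₁ x` and
`σ = s₀ + s₁ x + s₂ x²`, so that `x ↦ σ`, `y ↦ r y` lifts `θ` to the affine curve. The last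
field lets `x² dx / 2y` be reduced modulo exact forms. -/
structure LiftData where
  (r₀ r₁ s₀ s₁ s₂ e : A)
  h₄ : 2 * r₁ * E.a = 3 * s₂ * E.a
  h₃ : θ E.a = 2 * r₀ * E.a + 2 * r₁ * E.b - 3 * s₁ * E.a - 2 * s₂ * E.b
  h₂ : θ E.b = 2 * r₀ * E.b + 2 * r₁ * E.c - 3 * s₀ * E.a - 2 * s₁ * E.b - s₂ * E.c
  h₁ : θ E.c = 2 * r₀ * E.c + 2 * r₁ * E.d - 2 * s₀ * E.b - s₁ * E.c
  h₀ : θ E.d = 2 * r₀ * E.d - s₀ * E.c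
  he : 3 * s₂ - r₁ = 3 * E.a * e

variable {E θ}

/-- The Gauss–Manin connection in the basis `dx / 2y`, `x dx / 2y`. -/
theorem LiftData.affineClass_gaussManin [Nontrivial A] (l : E.LiftData θ) {ω : E.H1dR} {α β : A}
    (h : E.affineClass ω = E.linClass α β) :
    E.affineClass ((E.gaussManin θ).toHom ω) = E.linClass
      (θ α + α * (l.s₁ - l.r₀) + β * (l.s₀ - l.e * E.c))
      (θ β + α * (2 * l.s₂ - l.r₁) + β * (2 * l.s₁ - l.r₀ - 2 * l.e * E.b)) := by
  obtain ⟨r₀, r₁, s₀, s₁, s₂, e, h₄, h₃, h₂, h₁, h₀, he⟩ := l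
  rw [E.affineClass_gaussManin θ h, linClass, Submodule.mkQ_apply, Submodule.mkQ_apply,
    Submodule.Quotient.eq, mem_exact₀]
  dsimp only
  set L := (E.lift₀ θ).toDer
  have hL : ∀ a, L (algebraMap A E.Chart₀ a) = algebraMap A E.Chart₀ (θ a) :=
    (E.lift₀ θ).lift_algebraMap
  set μ := formCoeff E.eq₀ ((E.lift₀ θ).lie E.isSmooth₀.form)
  have hμ := E.isSmooth₀.ham_lift (E.lift₀ θ) E.x₀
  change ham E.eq₀ (L E.x₀) = ham E.eq₀ E.x₀ * μ + L (ham E.eq₀ E.x₀) at hμ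
  have hE := E.eq_chart₀
  have hLE := congrArg L hE
  simp only [map_add, Derivation.leibniz, Derivation.leibniz_pow, hL, smul_eq_mul,
    nsmul_eq_mul] at hLE
  rw [h₃, h₂, h₁, h₀] at hLE
  replace h₄ := congrArg (algebraMap A E.Chart₀) h₄
  replace he := congrArg (algebraMap A E.Chart₀) he
  simp only [map_add, map_sub, map_mul, map_ofNat] at hLE h₄ he
  push_cast at hLE
  have hhx := E.ham_x₀
  have hhy := E.ham_y₀
  have hf : E.cubicDer = 3 * algebraMap A E.Chart₀ E.a * E.x₀ ^ 2
    + 2 * algebraMap A E.Chart₀ E.b * E.x₀ + algebraMap A E.Chart₀ E.c := rfl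
  obtain ⟨g, hg1, hg2⟩ := E.exists_eq_mul_ham
    (ξ := L E.x₀ - (algebraMap A E.Chart₀ s₀ + algebraMap A E.Chart₀ s₁ * E.x₀
      + algebraMap A E.Chart₀ s₂ * E.x₀ ^ 2))
    (ζ := L E.y₀ - (algebraMap A E.Chart₀ r₀ + algebraMap A E.Chart₀ r₁ * E.x₀) * E.y₀) (by
      rw [hf]
      linear_combination hLE + (-2 * (algebraMap A E.Chart₀ r₀ + algebraMap A E.Chart₀ r₁ * E.x₀))
        * hE + E.x₀ ^ 4 * h₄)
  rw [sub_eq_iff_eq_add] at hg1 hg2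
  have hh : ∀ a, ham E.eq₀ (algebraMap A E.Chart₀ a) = 0 := (ham E.eq₀).map_algebraMap
  have hμ' : μ = algebraMap A E.Chart₀ s₁ + 2 * algebraMap A E.Chart₀ s₂ * E.x₀
      - (algebraMap A E.Chart₀ r₀ + algebraMap A E.Chart₀ r₁ * E.x₀) + ham E.eq₀ g := by
    obtain ⟨t, ht⟩ := E.isUnit_six.exists_left_inv
    have ht' := congrArg (algebraMap A E.Chart₀) ht
    rw [map_mul, map_ofNat, map_one] at ht'
    have h2 : (2 : E.Chart₀) = algebraMap A E.Chart₀ 2 := (map_ofNat _ 2).symm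
    have hL2 : L 2 = 0 := mod_cast L.map_natCast 2
    have hh2 : ham E.eq₀ 2 = 0 := by rw [h2, hh]
    rw [hg1, hhx, Derivation.leibniz, hg2, hL2] at hμ
    simp only [map_add, Derivation.leibniz, Derivation.leibniz_pow, hh, hhx, hhy, hh2, smul_eq_mul,
      nsmul_eq_mul] at hμ
    push_cast at hμ
    refine sub_eq_zero.1 (E.y₀_mul_eq_zero ?_)
    linear_combination (-3 * algebraMap A E.Chart₀ t) * hμ
      + (E.y₀ * (algebraMap A E.Chart₀ s₁ + 2 * algebraMap A E.Chart₀ s₂ * E.x₀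
      - (algebraMap A E.Chart₀ r₀ + algebraMap A E.Chart₀ r₁ * E.x₀) + ham E.eq₀ g - μ)) * ht'
  -- `L` is the lift `x ↦ σ`, `y ↦ r y` plus `g` times the Hamiltonian field, which accounts for the
  -- first two terms; the last one reduces `x²` by `d(y) = f' dx / 2y`.
  refine ⟨algebraMap A E.Chart₀ α * g + algebraMap A E.Chart₀ β * E.x₀ * g
    + algebraMap A E.Chart₀ β * algebraMap A E.Chart₀ e * E.y₀, ?_⟩
  rw [hμ']
  simp only [map_add, map_sub, map_mul, map_ofNat, Derivation.leibniz, hh, hhx, hhy, smul_eq_mul,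
    hL, hg1, hf]
  linear_combination (-algebraMap A E.Chart₀ β * E.x₀ ^ 2) * he

variable [Nontrivial A] {ω ω' : E.H1dR} {κ γ δ : A}

theorem linClass_injective (hA : ∀ n : ℕ, n ≠ 0 → IsUnit (n : A)) {α β α' β' : A}
    (h : E.linClass α β = E.linClass α' β') : α = α' ∧ β = β' := by
  rw [linClass, linClass, Submodule.mkQ_apply, Submodule.mkQ_apply, Submodule.Quotient.eq] at h
  have := E.exact₀_independent hA (α := α - α') (β := β - β')
    ((congrArg (· ∈ E.exact₀) (by rw [map_sub, map_sub]; ring)).mp h)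
  exact ⟨sub_eq_zero.1 this.1, sub_eq_zero.1 this.2⟩

theorem exists_linClass (hA : ∀ n : ℕ, n ≠ 0 → IsUnit (n : A)) (m : E.Chart₀ ⧸ E.exact₀) :
    ∃ α β, m = E.linClass α β := by
  obtain ⟨b, rfl⟩ := Submodule.mkQ_surjective _ m
  obtain ⟨α, β, h⟩ := E.exists_sub_mem_exact₀ hA b
  refine ⟨α, β, ?_⟩
  rw [linClass, Submodule.mkQ_apply, Submodule.mkQ_apply, Submodule.Quotient.eq]
  exact h

theorem H1dR_independent (hA : ∀ n : ℕ, n ≠ 0 → IsUnit (n : A))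
    (hω : E.affineClass ω = E.linClass κ 0)
    (hω' : E.affineClass ω' = E.linClass γ δ) (hκ : IsUnit κ) (hδ : IsUnit δ) {a b : A}
    (h : a • ω + b • ω' = 0) : a = 0 ∧ b = 0 := by
  have h1 := congrArg E.affineClass h
  rw [map_add, map_smul, map_smul, hω, hω', smul_linClass, smul_linClass, linClass_add, map_zero,
    show (0 : E.Chart₀ ⧸ E.exact₀) = E.linClass 0 0 by simp [linClass]] at h1
  obtain ⟨h2, h3⟩ := linClass_injective hA h1
  rw [mul_zero, zero_add, hδ.mul_left_eq_zero] at h3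
  rw [h3, zero_mul, add_zero, hκ.mul_left_eq_zero] at h2
  exact ⟨h2, h3⟩

theorem H1dR_generated (hA : ∀ n : ℕ, n ≠ 0 → IsUnit (n : A))
    (hω : E.affineClass ω = E.linClass κ 0)
    (hω' : E.affineClass ω' = E.linClass γ δ) (hκ : IsUnit κ) (hδ : IsUnit δ) (m : E.H1dR) :
    ∃ a b : A, m = a • ω + b • ω' := by
  obtain ⟨α, β, h⟩ := exists_linClass hA (E.affineClass m)
  obtain ⟨i, hi⟩ := hκ.exists_left_inv
  obtain ⟨j, hj⟩ := hδ.exists_left_inv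
  refine ⟨(α - β * j * γ) * i, β * j, E.affineClass_injective hA ?_⟩
  rw [map_add, map_smul, map_smul, hω, hω', smul_linClass, smul_linClass, linClass_add, h]
  congr 1
  · linear_combination (-(α - β * j * γ)) * hi
  · linear_combination (-β) * hj

end GaussManin

end CubicCurve

/-! ### Cyclic modules over a ring of differential operators -/

section DiffOps

variable {k A : Type*} [CommRing k] [CommRing A] [Algebra k A] {θ : Derivation k A A}

namespace DiffOp

/-- The order filtration: operators `∑ aᵢ ∂ⁱ` with `i < n`. -/
def lowOrder (θ : Derivation k A A) (n : ℕ) : Submodule A (DiffOp θ) :=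
  Submodule.span A ((fun i => partial_ θ ^ i) '' Set.Iio n)

theorem pow_mem_lowOrder {i n : ℕ} (h : i < n) : partial_ θ ^ i ∈ lowOrder θ n :=
  Submodule.subset_span ⟨i, h, rfl⟩

theorem lowOrder_mono {m n : ℕ} (h : m ≤ n) : lowOrder θ m ≤ lowOrder θ n :=
  Submodule.span_mono (Set.image_mono (Set.Iio_subset_Iio h))

theorem partial_mul_mem {n : ℕ} {x : DiffOp θ} (hx : x ∈ lowOrder θ n) :
    partial_ θ * x ∈ lowOrder θ (n + 1) := by
  induction hx using Submodule.span_induction with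
  | mem x hx =>
    obtain ⟨i, hi, rfl⟩ := hx
    rw [Set.mem_Iio] at hi
    rw [← pow_succ']
    exact pow_mem_lowOrder (by omega)
  | zero => simp
  | add x y _ _ hx hy =>
    rw [mul_add]
    exact Submodule.add_mem _ hx hy
  | smul a x hx' hx =>
    rw [smul_def, ← mul_assoc, partial_mul_coeff, add_mul, mul_assoc, ← smul_def, ← smul_def]
    exact Submodule.add_mem _ (Submodule.smul_mem _ _ hx)
      (Submodule.smul_mem _ _ (lowOrder_mono (by omega) hx'))

/-- Additive induction on differential operators by left multiplication. -/
theorem induction_left {S : AddSubgroup (DiffOp θ)} (h1 : 1 ∈ S)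
    (hc : ∀ (a : A) (x), x ∈ S → coeff θ a * x ∈ S) (hp : ∀ x, x ∈ S → partial_ θ * x ∈ S)
    (x : DiffOp θ) : x ∈ S := by
  obtain ⟨x, rfl⟩ := RingQuot.mkRingHom_surjective (DiffOp.Rel θ) x
  change mk θ x ∈ S
  have key : ∀ y ∈ S, mk θ x * y ∈ S := by
    induction x using FreeAlgebra.induction with
    | grade0 r =>
      intro y hy
      rw [eq_intCast, map_intCast, ← zsmul_eq_mul]
      exact S.zsmul_mem hy r
    | grade1 o =>
      intro y hy
      cases o with
      | none => exact hp y hy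
      | some a => exact hc a y hy
    | mul p q hp hq =>
      intro y hy
      rw [map_mul, mul_assoc]
      exact hp _ (hq _ hy)
    | add p q hp hq =>
      intro y hy
      rw [map_add, add_mul]
      exact S.add_mem (hp _ hy) (hq _ hy)
  simpa using key 1 h1

/-- Division with remainder by an operator of order `n` whose leading coefficient is a unit. -/
theorem exists_remainder {n : ℕ} {P : DiffOp θ} {u : A} (hu : IsUnit u)
    (hP : P - u • partial_ θ ^ n ∈ lowOrder θ n) (x : DiffOp θ) :
    ∃ y ∈ lowOrder θ n, x - y ∈ Submodule.span (DiffOp θ) {P} := by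
  set I := Submodule.span (DiffOp θ) {P} with hI
  obtain ⟨v, hv⟩ := hu.exists_left_inv
  have hn : ∃ y ∈ lowOrder θ n, partial_ θ ^ n - y ∈ I := by
    refine ⟨-(v • (P - u • partial_ θ ^ n)), Submodule.neg_mem _ (Submodule.smul_mem _ _ hP), ?_⟩
    rw [smul_sub, ← mul_smul, hv, one_smul, sub_neg_eq_add, add_sub_cancel, smul_def]
    exact Submodule.smul_mem _ _ (Submodule.mem_span_singleton_self P)
  have hlow : ∀ z ∈ lowOrder θ (n + 1), ∃ y ∈ lowOrder θ n, z - y ∈ I := by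
    intro z hz
    induction hz using Submodule.span_induction with
    | mem z hz =>
      obtain ⟨i, hi, rfl⟩ := hz
      rw [Set.mem_Iio] at hi
      rcases Nat.lt_succ_iff_lt_or_eq.1 hi with h | rfl
      · exact ⟨_, pow_mem_lowOrder h, by simp⟩
      · exact hn
    | zero => exact ⟨0, Submodule.zero_mem _, by simp⟩
    | add z w _ _ hz hw =>
      obtain ⟨y, hy, hy'⟩ := hz
      obtain ⟨y', hz, hz'⟩ := hw
      refine ⟨y + y', Submodule.add_mem _ hy hz, ?_⟩
      rw [add_sub_add_comm]
      exact Submodule.add_mem _ hy' hz'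
    | smul a z _ hz =>
      obtain ⟨y, hy, hy'⟩ := hz
      refine ⟨a • y, Submodule.smul_mem _ _ hy, ?_⟩
      rw [← smul_sub, smul_def]
      exact Submodule.smul_mem _ _ hy'
  let S : AddSubgroup (DiffOp θ) :=
    { carrier := {x | ∃ y ∈ lowOrder θ n, x - y ∈ I}
      zero_mem' := ⟨0, Submodule.zero_mem _, by simp⟩
      add_mem' := by
        rintro z w ⟨y, hy, hy'⟩ ⟨y', hz, hz'⟩
        refine ⟨y + y', Submodule.add_mem _ hy hz, ?_⟩
        rw [add_sub_add_comm]
        exact Submodule.add_mem _ hy' hz'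
      neg_mem' := by
        rintro z ⟨y, hy, hy'⟩
        refine ⟨-y, Submodule.neg_mem _ hy, ?_⟩
        rw [neg_sub_neg, ← neg_sub]
        exact Submodule.neg_mem _ hy' }
  have hS : ∀ z ∈ lowOrder θ (n + 1), ∀ w, w - z ∈ I → w ∈ S := by
    intro z hz w hw
    obtain ⟨y, hy, hy'⟩ := hlow z hz
    exact ⟨y, hy, by simpa using Submodule.add_mem _ hw hy'⟩
  refine induction_left (S := S) ?_ ?_ ?_ x
  · exact hS 1 (by simpa using pow_mem_lowOrder (θ := θ) (Nat.succ_pos n)) 1 (by simp)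
  · rintro a x ⟨y, hy, hy'⟩
    refine ⟨a • y, Submodule.smul_mem _ _ hy, ?_⟩
    rw [smul_def, ← mul_sub]
    exact Submodule.smul_mem _ _ hy'
  · rintro x ⟨y, hy, hy'⟩
    refine hS _ (partial_mul_mem hy) _ ?_
    rw [← mul_sub]
    exact Submodule.smul_mem _ _ hy'

/-- An operator of order `n` with a unit as its coefficient of highest order presents any module
which is generated by a solution `m` with `m, ∂m, …, ∂ⁿ⁻¹m` independent. -/
theorem exists_quotient_equiv {M : Type*} [AddCommGroup M] [Module A M] [Module (DiffOp θ) M]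
    [IsScalarTower A (DiffOp θ) M] {n : ℕ} {P : DiffOp θ} {u : A} (hu : IsUnit u)
    (hP : P - u • partial_ θ ^ n ∈ lowOrder θ n) {m : M} (hm : P • m = 0)
    (hli : ∀ x ∈ lowOrder θ n, x • m = 0 → x = 0) (hsp : ∀ z : M, ∃ x : DiffOp θ, x • m = z) :
    ∃ e : (DiffOp θ ⧸ Submodule.span (DiffOp θ) {P}) ≃ₗ[DiffOp θ] M,
      e (Submodule.Quotient.mk 1) = m := by
  have hle : Submodule.span (DiffOp θ) {P}
      ≤ LinearMap.ker (LinearMap.toSpanSingleton (DiffOp θ) M m) := by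
    rw [Submodule.span_singleton_le_iff_mem, LinearMap.mem_ker, LinearMap.toSpanSingleton_apply, hm]
  refine ⟨LinearEquiv.ofBijective (Submodule.liftQ _ (LinearMap.toSpanSingleton (DiffOp θ) M m) hle)
    ⟨?_, fun z => ?_⟩, ?_⟩
  · rw [injective_iff_map_eq_zero]
    intro x hx
    obtain ⟨x, rfl⟩ := Submodule.mkQ_surjective _ x
    obtain ⟨y, hy, hxy⟩ := exists_remainder hu hP x
    have h1 : x • m = 0 := hx
    have h2 : (x - y) • m = 0 := hle hxy
    rw [sub_smul, h1, zero_sub, neg_eq_zero] at h2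
    rw [hli y hy h2, sub_zero] at hxy
    exact (Submodule.Quotient.mk_eq_zero _).2 hxy
  · obtain ⟨x, hx⟩ := hsp z
    exact ⟨Submodule.Quotient.mk x, hx⟩
  · exact one_smul _ m

end DiffOp

end DiffOps

/-! ### The symmetric square of a free module of rank two -/

section SymSq

variable {A : Type} [CommRing A] {M : Type*} [AddCommGroup M] [Module A M]

theorem exists_symSq_eq {m₀ m₁ : M} (h : ∀ m : M, ∃ a b : A, m = a • m₀ + b • m₁)
    (x : Sym[A]^2 M) : ∃ a b c : A, x = a • symMul m₀ m₀ + b • symMul m₀ m₁ + c • symMul m₁ m₁ := by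
  have hx : x ∈ Submodule.span A (Set.range (SymmetricPower.tprod A (ι := Fin 2) (M := M))) := by
    rw [SymmetricPower.span_tprod_eq_top]
    trivial
  induction hx using Submodule.span_induction with
  | mem x hx =>
    obtain ⟨f, rfl⟩ := hx
    rw [tprod_two]
    obtain ⟨a, b, h0⟩ := h (f 0)
    obtain ⟨c, d, h1⟩ := h (f 1)
    rw [h0, h1]
    refine ⟨a * c, a * d + b * c, b * d, ?_⟩
    simp only [symMul_add, add_symMul, symMul_smul, smul_symMul, symMul_comm m₁ m₀]
    module
  | zero => exact ⟨0, 0, 0, by simp⟩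
  | add x y _ _ hx hy =>
    obtain ⟨a, b, c, rfl⟩ := hx
    obtain ⟨a', b', c', rfl⟩ := hy
    exact ⟨a + a', b + b', c + c', by module⟩
  | smul r x _ hx =>
    obtain ⟨a, b, c, rfl⟩ := hx
    exact ⟨r * a, r * b, r * c, by module⟩

/-- The map on the symmetric square induced by multiplying the values of a linear map to a
commutative algebra. -/
def symSqLift {R : Type*} [CommRing R] [Algebra A R] (φ : M →ₗ[A] R) : Sym[A]^2 M →+ R :=
  AddCon.lift (addConGen (SymmetricPower.Rel A (Fin 2) M))
    (PiTensorProduct.lift ((MultilinearMap.mkPiAlgebra A (Fin 2) R).compLinearMap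
      fun _ => φ)).toAddMonoidHom (by
      refine AddCon.addConGen_le.2 ?_
      rintro _ _ ⟨e, f⟩
      rw [AddCon.ker_rel, LinearMap.toAddMonoidHom_coe, PiTensorProduct.lift.tprod,
        PiTensorProduct.lift.tprod]
      simp only [MultilinearMap.compLinearMap_apply, MultilinearMap.mkPiAlgebra_apply]
      exact (Equiv.prod_comp e fun i => φ (f i)).symm)

theorem symSqLift_smul_symMul {R : Type*} [CommRing R] [Algebra A R] (φ : M →ₗ[A] R) (a : A)
    (x y : M) : symSqLift φ (a • symMul x y) = a • (φ x * φ y) := by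
  rw [← symMul_smul]
  change PiTensorProduct.lift ((MultilinearMap.mkPiAlgebra A (Fin 2) R).compLinearMap
    fun _ => φ) (PiTensorProduct.tprod A ![a • x, y]) = _
  rw [PiTensorProduct.lift.tprod]
  simp

theorem symSq_independent {m₀ m₁ : M} (h : ∀ m : M, ∃ a b : A, m = a • m₀ + b • m₁)
    (h' : ∀ a b : A, a • m₀ + b • m₁ = 0 → a = 0 ∧ b = 0) {a b c : A}
    (hx : a • symMul (A := A) m₀ m₀ + b • symMul m₀ m₁ + c • symMul m₁ m₁ = 0) :
    a = 0 ∧ b = 0 ∧ c = 0 := by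
  let B : Module.Basis (Fin 2) A M := Module.Basis.mk (v := ![m₀, m₁])
    (LinearIndependent.pair_iff.2 h') (by
      intro m _
      obtain ⟨a, b, rfl⟩ := h m
      rw [Matrix.range_cons, Matrix.range_cons, Matrix.range_empty, Set.union_empty,
        Set.singleton_union, Submodule.mem_span_pair]
      exact ⟨a, b, rfl⟩)
  have hB0 : B 0 = m₀ := by simp [B]
  have hB1 : B 1 = m₁ := by simp [B]
  -- the values `1` and `X` identify the symmetric square with the polynomials of degree at most two
  let φ : M →ₗ[A] A[X] := B.constr ℕ ![1, X]
  have h0 : φ m₀ = 1 := by rw [← hB0, Module.Basis.constr_basis]; rfl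
  have h1 : φ m₁ = X := by rw [← hB1, Module.Basis.constr_basis]; rfl
  have h2 := congrArg (symSqLift φ) hx
  rw [map_add, map_add, symSqLift_smul_symMul, symSqLift_smul_symMul, symSqLift_smul_symMul, h0,
    h1, map_zero, one_mul, one_mul, ← pow_two] at h2
  have hc := fun n => congrArg (fun P => P.coeff n) h2
  have c0 := hc 0
  have c1 := hc 1
  have c2 := hc 2
  simp [coeff_X, coeff_one] at c0 c1 c2
  exact ⟨c0, c1, c2⟩

end SymSq

/-! ### Horizontal maps and base change -/

section Horizontal

variable {k A : Type*} [CommRing k] [CommRing A] [Algebra k A] {θ : Derivation k A A}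

namespace DiffOp

/-- A horizontal linear map commutes with all differential operators. -/
theorem map_action {M N : Type*} [AddCommGroup M] [Module A M] [AddCommGroup N] [Module A N]
    {c : Connection θ M} {c' : Connection θ N} (f : M →ₗ[A] N)
    (hf : ∀ m, f (c.toHom m) = c'.toHom (f m)) (x : DiffOp θ) (m : M) :
    f (action c x m) = action c' x (f m) := by
  let S : AddSubgroup (DiffOp θ) :=
    { carrier := {x | ∀ m, f (action c x m) = action c' x (f m)}
      zero_mem' := fun m => by simp
      add_mem' := fun {x y} hx hy m => by
        rw [map_add, map_add]
        change f (action c x m + action c y m) = action c' x (f m) + action c' y (f m)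
        rw [map_add, hx, hy]
      neg_mem' := fun {x} hx m => by
        rw [map_neg, map_neg]
        change f (-action c x m) = -action c' x (f m)
        rw [map_neg, hx] }
  have : x ∈ S := by
    refine induction_left (S := S) (fun m => ?_) (fun a x hx m => ?_) (fun x hx m => ?_) x
    · rw [map_one, map_one]
      rfl
    · rw [map_mul, map_mul]
      change f (action c (coeff θ a) (action c x m)) = action c' (coeff θ a) (action c' x (f m))
      rw [action_coeff, action_coeff, map_smul, hx]
    · rw [map_mul, map_mul]
      change f (action c (partial_ θ) (action c x m)) = action c' (partial_ θ) (action c' x (f m))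
      rw [action_partial, action_partial, hf, hx]
  exact this m

/-- An operator of order one with symbol `e` multiplies the leading coefficient by `e`. -/
theorem symbol_mul {n : ℕ} {x : DiffOp θ} {a : A} (e b : A)
    (hx : x - a • partial_ θ ^ n ∈ lowOrder θ n) :
    (coeff θ e * partial_ θ + coeff θ b) * x - (e * a) • partial_ θ ^ (n + 1)
      ∈ lowOrder θ (n + 1) := by
  have h1 := Submodule.smul_mem _ e (partial_mul_mem hx)
  have h2 := Submodule.smul_mem _ (e * θ a) (pow_mem_lowOrder (θ := θ) (Nat.lt_succ_self n))
  have h3 := Submodule.smul_mem _ b (Submodule.add_mem _ (lowOrder_mono (Nat.le_succ n) hx)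
    (Submodule.smul_mem _ a (pow_mem_lowOrder (θ := θ) (Nat.lt_succ_self n))))
  rw [sub_add_cancel] at h3
  refine (congrArg (· ∈ lowOrder θ (n + 1)) ?_).mp
    (Submodule.add_mem _ (Submodule.add_mem _ h1 h2) h3)
  have h4 : partial_ θ * a • partial_ θ ^ n = a • partial_ θ ^ (n + 1) + θ a • partial_ θ ^ n := by
    rw [smul_def, ← mul_assoc, partial_mul_coeff, add_mul, mul_assoc, ← pow_succ', ← smul_def,
      ← smul_def]
  rw [mul_sub, h4, add_mul, mul_assoc, ← smul_def, ← smul_def]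
  module

theorem symbol_mul_mul (e b b' : A) :
    (coeff θ e * partial_ θ + coeff θ b) * (coeff θ e * partial_ θ + coeff θ b')
      - (e * e) • partial_ θ ^ 2 ∈ lowOrder θ 2 := by
  have h0 : (1 : DiffOp θ) - (1 : A) • partial_ θ ^ 0 ∈ lowOrder θ 0 := by simp
  have h := symbol_mul e b (symbol_mul e b' h0)
  rwa [mul_one, mul_one] at h

theorem symbol_mul_mul_mul (e b b' b'' : A) :
    (coeff θ e * partial_ θ + coeff θ b) * ((coeff θ e * partial_ θ + coeff θ b')
      * (coeff θ e * partial_ θ + coeff θ b'')) - (e * (e * e)) • partial_ θ ^ 3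
      ∈ lowOrder θ 3 :=
  symbol_mul e b (symbol_mul_mul e b' b'')

theorem mem_lowOrder_two {x : DiffOp θ} (hx : x ∈ lowOrder θ 2) :
    ∃ a b : A, x = coeff θ a + coeff θ b * partial_ θ := by
  induction hx using Submodule.span_induction with
  | mem x hx =>
    obtain ⟨i, hi, rfl⟩ := hx
    rw [Set.mem_Iio] at hi
    interval_cases i
    · exact ⟨1, 0, by simp⟩
    · exact ⟨0, 1, by simp⟩
  | zero => exact ⟨0, 0, by simp⟩
  | add x y _ _ hx hy =>
    obtain ⟨a, b, rfl⟩ := hx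
    obtain ⟨a', b', rfl⟩ := hy
    exact ⟨a + a', b + b', by
      rw [map_add, map_add]
      noncomm_ring⟩
  | smul r x _ hx =>
    obtain ⟨a, b, rfl⟩ := hx
    exact ⟨r * a, r * b, by rw [smul_def, map_mul, map_mul, mul_add, mul_assoc]⟩

theorem mem_lowOrder_three {x : DiffOp θ} (hx : x ∈ lowOrder θ 3) :
    ∃ a b c : A, x = coeff θ a + coeff θ b * partial_ θ
      + coeff θ c * (partial_ θ * partial_ θ) := by
  induction hx using Submodule.span_induction with
  | mem x hx =>
    obtain ⟨i, hi, rfl⟩ := hx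
    rw [Set.mem_Iio] at hi
    interval_cases i
    · exact ⟨1, 0, 0, by simp⟩
    · exact ⟨0, 1, 0, by simp⟩
    · exact ⟨0, 0, 1, by simp [pow_two]⟩
  | zero => exact ⟨0, 0, 0, by simp⟩
  | add x y _ _ hx hy =>
    obtain ⟨a, b, c, rfl⟩ := hx
    obtain ⟨a', b', c', rfl⟩ := hy
    exact ⟨a + a', b + b', c + c', by
      rw [map_add, map_add, map_add]
      noncomm_ring⟩
  | smul r x _ hx =>
    obtain ⟨a, b, c, rfl⟩ := hx
    exact ⟨r * a, r * b, r * c, by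
      rw [smul_def, map_mul, map_mul, map_mul, mul_add, mul_add, mul_assoc, mul_assoc]⟩

end DiffOp

variable {A' : Type*} [CommRing A'] [Algebra k A'] [Algebra A A'] {θ' : Derivation k A' A'}
  (h : ∀ a, θ' (algebraMap A A' a) = algebraMap A A' (θ a))
  {N : Type*} [AddCommGroup N] [Module A' N] [Module A N] [IsScalarTower A A' N]

/-- A module with connection over `A'`, as a module with connection over `A`. -/
def Connection.restrict (c : Connection θ' N) : Connection θ N where
  toHom := c.toHom
  leibniz a m := by
    rw [← algebraMap_smul A' a m, c.leibniz, h, algebraMap_smul, algebraMap_smul]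

theorem Connection.liftBaseChange_baseChange {M : Type*} [AddCommGroup M] [Module A M]
    {c : Connection θ M} {c' : Connection θ' N} (f : M →ₗ[A] N)
    (hf : ∀ m, f (c.toHom m) = c'.toHom (f m)) (z : A' ⊗[A] M) :
    f.liftBaseChange A' ((c.baseChange θ' h).toHom z)
      = c'.toHom (f.liftBaseChange A' z) := by
  induction z using TensorProduct.induction_on with
  | zero => simp
  | add x y hx hy => simp only [map_add, hx, hy]
  | tmul a m =>
    have : (c.baseChange θ' h).toHom (a ⊗ₜ[A] m) = a ⊗ₜ[A] c.toHom m + θ' a ⊗ₜ[A] m := rfl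
    rw [this, map_add, LinearMap.liftBaseChange_tmul, LinearMap.liftBaseChange_tmul,
      LinearMap.liftBaseChange_tmul, c'.leibniz, hf]

end Horizontal

/-! ### Lifts of `d/dt` to the four families -/

section Base

variable (K : Type) [Field K]

/-- The function `1 / (4 (1 - 2 s)) = ds / dt`. -/
def dsdt : OS K := Ring.inverse (4 * (1 - 2 * sS K))

/-- The function `1 / (s (1 - s))`. -/
def invDisc : OS K := Ring.inverse (sS K * (1 - sS K))

theorem dsdt_mul : 4 * (1 - 2 * sS K) * dsdt K = 1 :=
  Ring.mul_inverse_cancel _ ((isUnit_four K).mul (isUnit_one_sub_two_s K))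

theorem invDisc_mul : sS K * (1 - sS K) * invDisc K = 1 :=
  Ring.mul_inverse_cancel _ ((isUnit_s K).mul (isUnit_one_sub_s K))

theorem ddtS_s : ddtS K (sS K) = dsdt K := by
  rw [ddtS, Derivation.smul_apply, ddsS, sS, localizeDer_algebraMap]
  change _ • algebraMap K[X] (OS K) (derivative X) = _
  rw [derivative_X, map_one, smul_eq_mul, mul_one, dsdt, sS]

/-- The constant `1 / 6`. It is the only denominator in what follows, so that all identities have
integer coefficients. -/
def sixInv : OS K := algebraMap K (OS K) (1 / 6)

theorem ddtS_sixInv : ddtS K (sixInv K) = 0 := Derivation.map_algebraMap _ _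

theorem ddtS_natCast (n : ℕ) : ddtS K n = 0 := Derivation.map_natCast _ _

theorem ddtS_numerals : ddtS K 2 = 0 ∧ ddtS K 3 = 0 ∧ ddtS K 4 = 0 ∧ ddtS K 6 = 0 ∧
    ddtS K 9 = 0 :=
  ⟨mod_cast ddtS_natCast K 2, mod_cast ddtS_natCast K 3, mod_cast ddtS_natCast K 4,
    mod_cast ddtS_natCast K 6, mod_cast ddtS_natCast K 9⟩

variable [CharZero K]

instance : Nontrivial (OS K) := by
  have hX : (X : K[X]) ≠ 0 := X_ne_zero
  have h1 : (1 - X : K[X]) ≠ 0 := fun h => by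
    have := congrArg (eval 0) h
    simp at this
  have h2 : (1 - 2 * X : K[X]) ≠ 0 := fun h => by
    have := congrArg (eval 0) h
    simp at this
  have h4 : (4 : K[X]) ≠ 0 := by exact_mod_cast (by norm_num : (4 : ℕ) ≠ 0)
  have hne : tOfS K - tOfS K ^ 2 ≠ 0 := by
    have : tOfS K - tOfS K ^ 2 = 4 * X * (1 - X) * (1 - 2 * X) ^ 2 := by
      rw [tOfS]
      ring
    rw [this]
    exact mul_ne_zero (mul_ne_zero (mul_ne_zero h4 hX) h1) (pow_ne_zero 2 h2)
  exact (IsLocalization.injective (OS K)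
    (powers_le_nonZeroDivisors_of_noZeroDivisors hne)).nontrivial

theorem six_mul_sixInv : 6 * sixInv K = 1 := by
  rw [sixInv, ← map_ofNat (algebraMap K (OS K)) 6, ← map_mul, mul_one_div_cancel (by norm_num),
    map_one]

/-- A lift of `d/dt` to the affine part of the family of type `half`. As for the other families, its
coefficients solve the linear system of `LiftData`, for which the discriminant has to be inverted;
hence the factor `1 / (s (1 - s))`. -/
def liftHalf : (curve K .half).LiftData (ddtS K) := by
  have h6 := six_mul_sixInv K
  have hp := invDisc_mul K
  refine
    { s₂ := -(dsdt K * invDisc K)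
      s₁ := dsdt K * invDisc K
      s₀ := 0
      r₁ := -9 * sixInv K * (dsdt K * invDisc K)
      r₀ := 3 * sixInv K * (2 - sS K) * (dsdt K * invDisc K)
      e := -3 * sixInv K * (dsdt K * invDisc K)
      h₄ := ?_, h₃ := ?_, h₂ := ?_, h₁ := ?_, h₀ := ?_, he := ?_ } <;>
  simp only [curve, cubicOf, map_add, map_neg, map_zero, Derivation.map_one_eq_zero, ddtS_s] <;>
  grind

/-- A lift of `d/dt` to the affine part of the family of type `third`. -/
def liftThird : (curve K .third).LiftData (ddtS K) := by
  have h6 := six_mul_sixInv K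
  have hp := invDisc_mul K
  have n4 := (ddtS_numerals K).2.2.1
  have n6 := (ddtS_numerals K).2.2.2.1
  have n9 := (ddtS_numerals K).2.2.2.2
  refine
    { s₂ := -sixInv K * (dsdt K * invDisc K)
      s₁ := -(5 + 4 * sS K) * sixInv K * (dsdt K * invDisc K)
      s₀ := -4 * sixInv K * (1 - sS K) * (dsdt K * invDisc K)
      r₁ := -9 * sixInv K ^ 2 * (dsdt K * invDisc K)
      r₀ := -3 * sixInv K * (1 + 2 * sS K) * (dsdt K * invDisc K)
      e := -3 * sixInv K ^ 2 * (dsdt K * invDisc K)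
      h₄ := ?_, h₃ := ?_, h₂ := ?_, h₁ := ?_, h₀ := ?_, he := ?_ } <;>
  simp only [curve, cubicOf, map_sub, Derivation.map_one_eq_zero, Derivation.leibniz,
    Derivation.leibniz_pow, n4, n6, n9, ddtS_s, smul_eq_mul, nsmul_eq_mul, Nat.cast_ofNat] <;>
  grind

/-- A lift of `d/dt` to the affine part of the family of type `quarter`. -/
def liftQuarter : (curve K .quarter).LiftData (ddtS K) := by
  have h6 := six_mul_sixInv K
  have hp := invDisc_mul K
  have n2 := (ddtS_numerals K).1
  refine
    { s₂ := 3 * sixInv K * (dsdt K * invDisc K)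
      s₁ := -3 * sixInv K * (1 + sS K) * (dsdt K * invDisc K)
      s₀ := 0
      r₁ := 27 * sixInv K ^ 2 * (dsdt K * invDisc K)
      r₀ := -9 * sixInv K ^ 2 * (1 + 3 * sS K) * (dsdt K * invDisc K)
      e := 9 * sixInv K ^ 2 * (dsdt K * invDisc K)
      h₄ := ?_, h₃ := ?_, h₂ := ?_, h₁ := ?_, h₀ := ?_, he := ?_ } <;>
  simp only [curve, cubicOf, map_sub, map_neg, map_zero, Derivation.map_one_eq_zero, n2,
    ddtS_s] <;>
  grind

/-- A lift of `d/dt` to the affine part of the family of type `sixth`. -/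
def liftSixth : (curve K .sixth).LiftData (ddtS K) := by
  have h6 := six_mul_sixInv K
  have hp := invDisc_mul K
  have n2 := (ddtS_numerals K).1
  have n3 := (ddtS_numerals K).2.1
  have n4 := (ddtS_numerals K).2.2.1
  refine
    { s₂ := 2 * sixInv K * (dsdt K * invDisc K)
      s₁ := sixInv K * (1 - 2 * sS K) * (dsdt K * invDisc K)
      s₀ := -sixInv K * (dsdt K * invDisc K)
      r₁ := 3 * sixInv K * (dsdt K * invDisc K)
      r₀ := 9 * sixInv K ^ 2 * (1 - 2 * sS K) * (dsdt K * invDisc K)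
      e := 9 * sixInv K ^ 3 * (dsdt K * invDisc K)
      h₄ := ?_, h₃ := ?_, h₂ := ?_, h₁ := ?_, h₀ := ?_, he := ?_ } <;>
  simp only [curve, cubicOf, map_sub, map_neg, map_zero, Derivation.map_one_eq_zero,
    Derivation.leibniz, n2, n3, n4, ddtS_s, smul_eq_mul] <;>
  grind

/-- A lift of `d/dt` to the affine part of each of the four families. -/
def liftData : (α : HGType) → (curve K α).LiftData (ddtS K)
  | .half => liftHalf K
  | .third => liftThird K
  | .quarter => liftQuarter K
  | .sixth => liftSixth K

/-- The coefficient `s dt/ds` of the operator `D_s = s d/ds`, as a multiple of `d/dt`. -/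
def eulerCoeff : OS K := sS K * (4 * (1 - 2 * sS K))

theorem param_add (α : HGType) :
    algebraMap K (OS K) α.α₀ + algebraMap K (OS K) α.α₁ = 1 := by
  rw [← map_add, ← map_one (algebraMap K (OS K))]
  congr 1
  cases α <;> norm_num [HGType.α₀, HGType.α₁]

theorem param_mul (α : HGType) :
    algebraMap K (OS K) α.α₀ * algebraMap K (OS K) α.α₁ = match α with
      | .half => 9 * sixInv K ^ 2
      | .third => 8 * sixInv K ^ 2
      | .quarter => 243 * sixInv K ^ 4
      | .sixth => 5 * sixInv K ^ 2 := by
  cases α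
  all_goals
    simp only [sixInv, HGType.α₀, HGType.α₁, ← map_pow, ← map_mul,
      ← map_ofNat (algebraMap K (OS K))]
    congr 1
    norm_num

end Base

/-! ### The Picard–Fuchs equations -/

section Base
variable (K : Type) [Field K]

/-- The function `1 / (1 - s)`. -/
def oneSubInv : OS K := sS K * invDisc K

theorem oneSubInv_mul : oneSubInv K * (1 - sS K) = 1 := by
  rw [oneSubInv]
  linear_combination invDisc_mul K

theorem eulerCoeff_mul : eulerCoeff K * (dsdt K * invDisc K) = oneSubInv K := by
  rw [eulerCoeff, oneSubInv]
  linear_combination sS K * invDisc K * dsdt_mul K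

theorem eulerCoeff_ddtS_s : eulerCoeff K * ddtS K (sS K) = sS K := by
  rw [eulerCoeff, ddtS_s]
  linear_combination sS K * dsdt_mul K

theorem eulerCoeff_ddtS_oneSubInv :
    eulerCoeff K * ddtS K (oneSubInv K) = sS K * oneSubInv K ^ 2 := by
  have h := congrArg (ddtS K) (oneSubInv_mul K)
  simp only [Derivation.leibniz, map_sub, Derivation.map_one_eq_zero, smul_eq_mul] at h
  linear_combination eulerCoeff K * oneSubInv K * h
    + oneSubInv K ^ 2 * eulerCoeff_ddtS_s K
    - eulerCoeff K * ddtS K (oneSubInv K) * oneSubInv_mul K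

/-- An entry of the matrix of the Gauss–Manin connection along `D_s` in the basis `dx / 2y`,
`x dx / 2y`: the coefficient of `dx / 2y` in the derivative of `dx / 2y`. -/
def matA : HGType → OS K
  | .half => 3 * sixInv K * (sS K * oneSubInv K)
  | .third => -2 * sixInv K
  | .quarter => -9 * sixInv K ^ 2
  | .sixth => -3 * sixInv K ^ 2 * ((1 - 2 * sS K) * oneSubInv K)

/-- The constant factor of the coefficient of `x dx / 2y` in the derivative of `dx / 2y` along
`D_s`, which is this multiple of `1 / (1 - s)`. -/
def matB : HGType → OS K
  | .half => -3 * sixInv K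
  | .third => -3 * sixInv K ^ 2
  | .quarter => 9 * sixInv K ^ 2
  | .sixth => sixInv K

/-- The coefficient of `dx / 2y` in the derivative of `x dx / 2y` along `D_s`. -/
def matC : HGType → OS K
  | .half => 3 * sixInv K * (sS K * oneSubInv K)
  | .third => 8 * sixInv K
  | .quarter => -9 * sixInv K ^ 2
  | .sixth => -9 * sixInv K ^ 3 * oneSubInv K

theorem ddtS_matB (α : HGType) : ddtS K (matB K α) = 0 := by
  have hc := ddtS_sixInv K
  obtain ⟨n2, n3, -, -, n9⟩ := ddtS_numerals K
  cases α <;>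
  simp only [matB, Derivation.leibniz, Derivation.leibniz_pow, map_neg, n3, n9, hc, smul_zero,
    neg_zero, add_zero]

variable [CharZero K]

/-- The matrix of the connection along `D_s = s d/ds`; its trace is zero. -/
theorem liftData_matrix (α : HGType) :
    eulerCoeff K * ((liftData K α).s₁ - (liftData K α).r₀) = matA K α ∧
    eulerCoeff K * (2 * (liftData K α).s₂ - (liftData K α).r₁) = matB K α * oneSubInv K ∧
    eulerCoeff K * ((liftData K α).s₀ - (liftData K α).e * (curve K α).c) = matC K α ∧
    eulerCoeff K * (2 * (liftData K α).s₁ - (liftData K α).r₀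
      - 2 * (liftData K α).e * (curve K α).b) = -matA K α := by
  have hu := eulerCoeff_mul K
  have hq := oneSubInv_mul K
  have h6 := six_mul_sixInv K
  cases α
  · simp only [liftData, liftHalf, curve, cubicOf, matA, matB, matC]
    generalize dsdt K * invDisc K = u at *
    refine ⟨?_, ?_, ?_, ?_⟩ <;> grind
  · simp only [liftData, liftThird, curve, cubicOf, matA, matB, matC]
    generalize dsdt K * invDisc K = u at *
    refine ⟨?_, ?_, ?_, ?_⟩ <;> grind
  · simp only [liftData, liftQuarter, curve, cubicOf, matA, matB, matC]
    generalize dsdt K * invDisc K = u at *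
    refine ⟨?_, ?_, ?_, ?_⟩ <;> grind
  · simp only [liftData, liftSixth, curve, cubicOf, matA, matB, matC]
    generalize dsdt K * invDisc K = u at *
    refine ⟨?_, ?_, ?_, ?_⟩ <;> grind

theorem isUnit_matB (α : HGType) : IsUnit (matB K α) := by
  have hc : IsUnit (sixInv K) := IsUnit.of_mul_eq_one_right _ (six_mul_sixInv K)
  have h3 : IsUnit (3 : OS K) := mod_cast isUnit_natCast K 3 (by norm_num)
  have h9 : IsUnit (9 : OS K) := mod_cast isUnit_natCast K 9 (by norm_num)
  cases α
  · exact h3.neg.mul hc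
  · exact h3.neg.mul (hc.pow 2)
  · exact h9.mul (hc.pow 2)
  · exact hc

/-- The relation between the matrix entries `A`, `B / (1 - s)`, `C` and `-A` of the connection that
makes `dx / 2y` a solution of the Picard–Fuchs equation. -/
theorem matrix_identity (α : HGType) :
    (1 - sS K) * (eulerCoeff K * ddtS K (matA K α) + matA K α ^ 2
      + matB K α * oneSubInv K * matC K α)
      = sS K * matA K α + sS K * (algebraMap K (OS K) α.α₀ * algebraMap K (OS K) α.α₁) := by
  have hc := ddtS_sixInv K
  have hq := oneSubInv_mul K
  have h6 := six_mul_sixInv K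
  have hs' := eulerCoeff_ddtS_s K
  have hq' := eulerCoeff_ddtS_oneSubInv K
  obtain ⟨n2, n3, -, -, n9⟩ := ddtS_numerals K
  rw [param_mul]
  cases α <;>
  simp only [matA, matB, matC, Derivation.leibniz, Derivation.leibniz_pow, map_neg, map_sub,
    Derivation.map_one_eq_zero, n2, n3, n9, hc, smul_zero, neg_zero, add_zero, smul_eq_mul,
    mul_zero, zero_add, zero_sub] <;>
  generalize ddtS K (sS K) = ds at * <;>
  generalize ddtS K (oneSubInv K) = dq at * <;>
  generalize sS K = s at * <;>
  generalize oneSubInv K = q at * <;>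
  generalize eulerCoeff K = e at * <;>
  generalize sixInv K = c at * <;>
  grind

variable {K}

theorem affineClass_euler {α : HGType} {κ : OS K} (hκ : ddtS K κ = 0) {ω : H1E K α}
    (hω : (curve K α).affineClass ω = (curve K α).linClass κ 0) :
    (curve K α).affineClass (eulerCoeff K • ((curve K α).gaussManin (ddtS K)).toHom ω)
      = (curve K α).linClass (κ * matA K α) (κ * (matB K α * oneSubInv K)) := by
  obtain ⟨hA, hB, -, -⟩ := liftData_matrix K α
  rw [LinearMap.map_smul, (liftData K α).affineClass_gaussManin hω, hκ, map_zero,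
    CubicCurve.smul_linClass]
  congr 1
  · linear_combination κ * hA
  · linear_combination κ * hB

/-- The Picard–Fuchs equation of the class of a constant multiple of `dx / 2y`. -/
theorem picardFuchs {α : HGType} {κ : OS K} (hκ : ddtS K κ = 0) {ω : H1E K α}
    (hω : (curve K α).affineClass ω = (curve K α).linClass κ 0) :
    (1 - sS K) • eulerCoeff K • ((curve K α).gaussManin (ddtS K)).toHom
        (eulerCoeff K • ((curve K α).gaussManin (ddtS K)).toHom ω)
      = sS K • eulerCoeff K • ((curve K α).gaussManin (ddtS K)).toHom ω
        + (sS K * (algebraMap K (OS K) α.α₀ * algebraMap K (OS K) α.α₁)) • ω := by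
  apply (curve K α).affineClass_injective (isUnit_natCast K)
  have h2 := affineClass_euler hκ hω
  have h3 := (liftData K α).affineClass_gaussManin h2
  obtain ⟨hA, hB, hC, hD⟩ := liftData_matrix K α
  have hi := matrix_identity K α
  have hq := oneSubInv_mul K
  have hq' := eulerCoeff_ddtS_oneSubInv K
  rw [LinearMap.map_add, LinearMap.map_smul, LinearMap.map_smul, h3, LinearMap.map_smul _ (sS K),
    h2, LinearMap.map_smul, hω, CubicCurve.smul_linClass, CubicCurve.smul_linClass,
    CubicCurve.smul_linClass, CubicCurve.smul_linClass, CubicCurve.linClass_add]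
  have hB' := ddtS_matB K α
  simp only [Derivation.leibniz, hκ, hB', smul_eq_mul, mul_zero, add_zero]
  congr 1
  · linear_combination κ * hi + (1 - sS K) * κ * matA K α * hA
      + (1 - sS K) * κ * (matB K α * oneSubInv K) * hC
  · linear_combination (1 - sS K) * κ * matA K α * hB + (1 - sS K) * κ * matB K α * hq'
      + (1 - sS K) * κ * (matB K α * oneSubInv K) * hD + κ * matB K α * sS K * oneSubInv K * hq

end Base

/-! ### Base change of a cyclic module over a ring of differential operators -/

section CyclicBaseChange

variable {k A : Type*} [CommRing k] [CommRing A] [Algebra k A] {θ : Derivation k A A}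

namespace DiffOp

theorem coeff_smul {M : Type*} [AddCommGroup M] [Module A M] [Module (DiffOp θ) M]
    [IsScalarTower A (DiffOp θ) M] (a : A) (m : M) : coeff θ a • m = a • m := by
  have h := smul_assoc a (1 : DiffOp θ) m
  rwa [smul_def, mul_one, one_smul] at h

theorem partial_smul_smul {M : Type*} [AddCommGroup M] [Module A M] [Module (DiffOp θ) M]
    [IsScalarTower A (DiffOp θ) M] (a : A) (m : M) :
    partial_ θ • a • m = a • partial_ θ • m + θ a • m :=
  (Connection.ofDiffOp θ M).leibniz a m

theorem add_action {M : Type*} [AddCommGroup M] [Module A M] (c : Connection θ M)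
    (x y : DiffOp θ) (m : M) : action c (x + y) m = action c x m + action c y m := by
  rw [map_add]
  rfl

theorem action_smul {M : Type*} [AddCommGroup M] [Module A M] (c : Connection θ M) (a : A)
    (x : DiffOp θ) (m : M) : action c (a • x) m = a • action c x m := by
  rw [smul_def, map_mul]
  exact action_coeff c a _

theorem action_partial_mul {M : Type*} [AddCommGroup M] [Module A M] (c : Connection θ M)
    (x : DiffOp θ) (m : M) : action c (partial_ θ * x) m = c.toHom (action c x m) := by
  rw [map_mul]
  exact action_partial c _

variable {A' : Type*} [CommRing A'] [Algebra k A'] [Algebra A A'] {θ' : Derivation k A' A'}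
  (h : ∀ a, θ' (algebraMap A A' a) = algebraMap A A' (θ a)) {n : ℕ} {P : DiffOp θ} {u : A}

theorem action_baseChange_one_tmul {M : Type*} [AddCommGroup M] [Module A M]
    [Module (DiffOp θ) M] [IsScalarTower A (DiffOp θ) M] (m : M) (i : ℕ) :
    action ((Connection.ofDiffOp θ M).baseChange θ' h) (partial_ θ' ^ i) ((1 : A') ⊗ₜ[A] m)
      = 1 ⊗ₜ[A] (partial_ θ ^ i • m) := by
  induction i with
  | zero => simp
  | succ i ih =>
    rw [pow_succ', action_partial_mul, ih]
    change (1 : A') ⊗ₜ[A] (partial_ θ • partial_ θ ^ i • m)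
      + θ' 1 ⊗ₜ[A] (partial_ θ ^ i • m) = _
    rw [Derivation.map_one_eq_zero, zero_tmul, add_zero, pow_succ', mul_smul]

/-- The pullback of `A⟨∂⟩ / A⟨∂⟩ P` is spanned over the new base by the derivatives, of order less
than that of `P`, of its canonical element. -/
theorem exists_action_one_tmul (hu : IsUnit u) (hP : P - u • partial_ θ ^ n ∈ lowOrder θ n)
    (z : A' ⊗[A] (DiffOp θ ⧸ Submodule.span (DiffOp θ) {P})) :
    ∃ x ∈ lowOrder θ' n,
      action ((Connection.ofDiffOp θ (DiffOp θ ⧸ Submodule.span (DiffOp θ) {P})).baseChange θ' h) x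
        (1 ⊗ₜ[A] Submodule.Quotient.mk 1) = z := by
  induction z using TensorProduct.induction_on with
  | zero => exact ⟨0, Submodule.zero_mem _, by simp⟩
  | add y z hy hz =>
    obtain ⟨x, hx, rfl⟩ := hy
    obtain ⟨x', hx', rfl⟩ := hz
    exact ⟨x + x', Submodule.add_mem _ hx hx', by rw [map_add]; rfl⟩
  | tmul a v =>
    obtain ⟨x, rfl⟩ := Submodule.Quotient.mk_surjective _ v
    obtain ⟨y, hy, hxy⟩ := exists_remainder hu hP x
    rw [(Submodule.Quotient.eq _).2 hxy]
    clear hxy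
    induction hy using Submodule.span_induction with
    | mem y hy =>
      obtain ⟨i, hi, rfl⟩ := hy
      refine ⟨a • partial_ θ' ^ i, Submodule.smul_mem _ _ (pow_mem_lowOrder hi), ?_⟩
      rw [action_smul, action_baseChange_one_tmul, smul_tmul', smul_eq_mul, mul_one,
        ← Submodule.Quotient.mk_smul, smul_eq_mul, mul_one]
    | zero => exact ⟨0, Submodule.zero_mem _, by simp⟩
    | add y z _ _ hy hz =>
      obtain ⟨x, hx, hx1⟩ := hy
      obtain ⟨x', hx', hx1'⟩ := hz
      refine ⟨x + x', Submodule.add_mem _ hx hx', ?_⟩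
      rw [map_add, Submodule.Quotient.mk_add, tmul_add, ← hx1, ← hx1']
      rfl
    | smul r y _ hy =>
      obtain ⟨x, hx, hx1⟩ := hy
      refine ⟨algebraMap A A' r • x, Submodule.smul_mem _ _ hx, ?_⟩
      rw [action_smul, hx1, Submodule.Quotient.mk_smul, tmul_smul, algebraMap_smul]

/-- A solution `w` of `P` in a module with connection over the new base defines a horizontal map
from the pullback of `A⟨∂⟩ / A⟨∂⟩ P`. -/
theorem exists_horizontal {N : Type*} [AddCommGroup N] [Module A' N] [Module A N]
    [IsScalarTower A A' N] (c : Connection θ' N) {w : N} (hw : action (c.restrict h) P w = 0) :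
    ∃ f : A' ⊗[A] (DiffOp θ ⧸ Submodule.span (DiffOp θ) {P}) →ₗ[A'] N,
      (∀ z, f (((Connection.ofDiffOp θ (DiffOp θ ⧸ Submodule.span (DiffOp θ) {P})).baseChange
        θ' h).toHom z) = c.toHom (f z)) ∧ f (1 ⊗ₜ[A] Submodule.Quotient.mk 1) = w := by
  let _ : Module (DiffOp θ) N := DiffOp.module (c.restrict h)
  have hle : Submodule.span (DiffOp θ) {P}
      ≤ LinearMap.ker (LinearMap.toSpanSingleton (DiffOp θ) N w) := by
    rw [Submodule.span_singleton_le_iff_mem, LinearMap.mem_ker, LinearMap.toSpanSingleton_apply]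
    exact hw
  let F := Submodule.liftQ _ (LinearMap.toSpanSingleton (DiffOp θ) N w) hle
  let f : (DiffOp θ ⧸ Submodule.span (DiffOp θ) {P}) →ₗ[A] N :=
    { toFun := F
      map_add' := map_add F
      map_smul' := fun a v => by
        rw [← coeff_smul (θ := θ) a v, map_smul, RingHom.id_apply]
        exact action_coeff (c.restrict h) a _ }
  refine ⟨f.liftBaseChange A', Connection.liftBaseChange_baseChange h f fun m => ?_, ?_⟩
  · change F (partial_ θ • m) = _
    rw [map_smul]
    exact action_partial (c.restrict h) _
  · rw [LinearMap.liftBaseChange_tmul, one_smul]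
    exact one_smul (DiffOp θ) w

/-- If `P` has a unit as its coefficient of highest order and the module `N` with connection over
the new base has the first derivatives of a solution of `P` as a basis, then `N` is the pullback
of `A⟨∂⟩ / A⟨∂⟩ P`. -/
theorem exists_baseChange_equiv {N : Type*} [AddCommGroup N] [Module A' N] [Module A N]
    [IsScalarTower A A' N] (c : Connection θ' N) (hu : IsUnit u)
    (hP : P - u • partial_ θ ^ n ∈ lowOrder θ n) {w : N}
    (hw : action (c.restrict h) P w = 0)
    (hli : ∀ x ∈ lowOrder θ' n, action c x w = 0 → x = 0)
    (hsp : ∀ z : N, ∃ x : DiffOp θ', action c x w = z) :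
    letI := DiffOp.module
      ((Connection.ofDiffOp θ (DiffOp θ ⧸ Submodule.span (DiffOp θ) {P})).baseChange θ' h)
    letI := DiffOp.module c
    ∃ e : (A' ⊗[A] (DiffOp θ ⧸ Submodule.span (DiffOp θ) {P})) ≃ₗ[DiffOp θ'] N,
      e (1 ⊗ₜ[A] Submodule.Quotient.mk 1) = w := by
  obtain ⟨f, hf, hf1⟩ := exists_horizontal h c hw
  let _ := DiffOp.module
    ((Connection.ofDiffOp θ (DiffOp θ ⧸ Submodule.span (DiffOp θ) {P})).baseChange θ' h)
  let _ := DiffOp.module c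
  let F : (A' ⊗[A] (DiffOp θ ⧸ Submodule.span (DiffOp θ) {P})) →ₗ[DiffOp θ'] N :=
    { toFun := f
      map_add' := map_add f
      map_smul' := map_action f hf }
  refine ⟨LinearEquiv.ofBijective F ⟨?_, fun z => ?_⟩, hf1⟩
  · rw [injective_iff_map_eq_zero]
    intro z hz
    obtain ⟨x, hx, rfl⟩ := exists_action_one_tmul h hu hP z
    have h1 : f (action _ x _) = 0 := hz
    rw [map_action f hf, hf1] at h1
    rw [hli x hx h1, map_zero]
    rfl
  · obtain ⟨x, hx⟩ := hsp z
    refine ⟨action _ x (1 ⊗ₜ[A] Submodule.Quotient.mk 1), (map_action f hf x _).trans ?_⟩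
    rw [hf1, hx]

end DiffOp

end CyclicBaseChange

/-! ### The elliptic operator and the first isomorphism -/

section Elliptic

variable (K : Type) [Field K]

theorem eulerS_smul_smul {M : Type*} [AddCommGroup M] [Module (OS K) M] [Module (DS K) M]
    [IsScalarTower (OS K) (DS K) M] (a : OS K) (m : M) :
    eulerS K • a • m = a • eulerS K • m + (eulerCoeff K * ddtS K a) • m := by
  rw [eulerS, mul_smul, mul_smul, DiffOp.coeff_smul, DiffOp.coeff_smul, DiffOp.partial_smul_smul,
    eulerCoeff, smul_add, smul_smul, smul_smul, smul_smul, mul_comm (sS K * _) a]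

theorem constS_smul {M : Type*} [AddCommGroup M] [Module (OS K) M] [Module (DS K) M]
    [IsScalarTower (OS K) (DS K) M] (a : K) (m : M) :
    constS K a • m = algebraMap K (OS K) a • m := DiffOp.coeff_smul _ _

theorem isUnit_eulerCoeff : IsUnit (eulerCoeff K) :=
  (isUnit_s K).mul ((isUnit_four K).mul (isUnit_one_sub_two_s K))

/-- The expansion of `δ² - s (δ + c₀) (δ + c₁)`, applied to `m` with `m₁ = δ m` and `m₂ = δ² m`. -/
theorem second_order_smul {R M : Type*} [CommRing R] [AddCommGroup M] [Module R M] {s c₀ c₁ : R}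
    (h : c₀ + c₁ = 1) (m m₁ m₂ : M) :
    m₂ - s • (m₂ + c₁ • m₁ + c₀ • (m₁ + c₁ • m))
      = (1 - s) • m₂ - s • m₁ - (s * (c₀ * c₁)) • m := by
  obtain rfl := eq_sub_of_add_eq h
  module

variable (α : HGType)

theorem opS_symbol :
    opS K α - ((1 - sS K) * (eulerCoeff K * eulerCoeff K)) • DiffOp.partial_ (ddtS K) ^ 2
      ∈ DiffOp.lowOrder (ddtS K) 2 := by
  have h := fun b b' => DiffOp.symbol_mul_mul (θ := ddtS K) (eulerCoeff K) b b'
  have h3 := Submodule.sub_mem _ (h 0 0) (Submodule.smul_mem _ (sS K)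
    (h (algebraMap K (OS K) α.α₀) (algebraMap K (OS K) α.α₁)))
  refine (congrArg (· ∈ DiffOp.lowOrder (ddtS K) 2) ?_).mp h3
  rw [map_zero, add_zero, smul_sub, DiffOp.smul_def (ddtS K) (sS K) (_ * _),
    sub_sub_sub_comm, ← mul_smul, ← sub_smul, ← one_sub_mul, opS, pow_two (eulerS K),
    mul_assoc (DiffOp.coeff (ddtS K) (sS K))]
  rfl

variable [CharZero K]

theorem opS_smul {M : Type*} [AddCommGroup M] [Module (OS K) M] [Module (DS K) M]
    [IsScalarTower (OS K) (DS K) M] (m : M) :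
    opS K α • m = (1 - sS K) • eulerS K • eulerS K • m - sS K • eulerS K • m
      - (sS K * (algebraMap K (OS K) α.α₀ * algebraMap K (OS K) α.α₁)) • m := by
  rw [opS, pow_two (eulerS K), sub_smul, mul_smul, mul_smul, mul_smul, DiffOp.coeff_smul, add_smul,
    add_smul, smul_add (eulerS K), constS_smul, constS_smul, eulerS_smul_smul,
    Derivation.map_algebraMap, mul_zero, zero_smul, add_zero]
  exact second_order_smul (param_add K α) _ _ _

instance : IsScalarTower (OS K) (DS K) (H1E K α) :=
  ⟨fun a x m => DiffOp.action_smul ((curve K α).gaussManin (ddtS K)) a x m⟩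

instance : IsScalarTower (OS K) (DS K) (Sym[OS K]^2 (H1E K α)) :=
  ⟨fun a x m => DiffOp.action_smul ((curve K α).gaussManin (ddtS K)).symSq a x m⟩

theorem partial_smul_H1E (m : H1E K α) :
    DiffOp.partial_ (ddtS K) • m = ((curve K α).gaussManin (ddtS K)).toHom m :=
  DiffOp.action_partial _ m

theorem eulerS_smul_H1E (m : H1E K α) :
    eulerS K • m = eulerCoeff K • ((curve K α).gaussManin (ddtS K)).toHom m := by
  rw [eulerS, mul_smul, DiffOp.coeff_smul, partial_smul_H1E, eulerCoeff]

variable {K α} {κ : OS K} {ω : H1E K α}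

theorem opS_smul_eq_zero (hκ : ddtS K κ = 0)
    (hω : (curve K α).affineClass ω = (curve K α).linClass κ 0) : opS K α • ω = 0 := by
  rw [opS_smul, eulerS_smul_H1E, eulerS_smul_H1E, picardFuchs hκ hω]
  abel

/-- `ω` and `∇ω` form a basis of the cohomology. -/
theorem H1E_basis (hκ' : IsUnit κ)
    (hω : (curve K α).affineClass ω = (curve K α).linClass κ 0) :
    (∀ a b : OS K, a • ω + b • ((curve K α).gaussManin (ddtS K)).toHom ω = 0 → a = 0 ∧ b = 0) ∧
    ∀ m : H1E K α, ∃ a b : OS K,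
      m = a • ω + b • ((curve K α).gaussManin (ddtS K)).toHom ω := by
  have h := (liftData K α).affineClass_gaussManin hω
  have hu : IsUnit (2 * (liftData K α).s₂ - (liftData K α).r₁) := by
    refine isUnit_of_mul_isUnit_right (x := eulerCoeff K) ?_
    rw [(liftData_matrix K α).2.1]
    exact (isUnit_matB K α).mul (IsUnit.of_mul_eq_one _ (oneSubInv_mul K))
  rw [zero_mul, zero_mul, add_zero, map_zero, zero_add, add_zero] at h
  have hδ := hκ'.mul hu
  exact ⟨fun a b => CubicCurve.H1dR_independent (isUnit_natCast K) hω h hκ' hδ,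
    CubicCurve.H1dR_generated (isUnit_natCast K) hω h hκ' hδ⟩

/-- The cohomology of the elliptic family is the cyclic module of the operator `opS`. -/
theorem exists_elliptic_equiv (hκ : ddtS K κ = 0) (hκ' : IsUnit κ)
    (hω : (curve K α).affineClass ω = (curve K α).linClass κ 0) :
    ∃ e : (DS K ⧸ Submodule.span (DS K) {opS K α}) ≃ₗ[DS K] H1E K α,
      e (Submodule.Quotient.mk 1) = ω := by
  obtain ⟨hli, hsp⟩ := H1E_basis hκ' hω
  refine DiffOp.exists_quotient_equiv
    ((isUnit_one_sub_s K).mul ((isUnit_eulerCoeff K).mul (isUnit_eulerCoeff K)))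
    (opS_symbol K α) (opS_smul_eq_zero hκ hω) (fun x hx h => ?_) fun z => ?_
  · obtain ⟨a, b, rfl⟩ := DiffOp.mem_lowOrder_two hx
    rw [add_smul, mul_smul, DiffOp.coeff_smul, DiffOp.coeff_smul, partial_smul_H1E] at h
    obtain ⟨rfl, rfl⟩ := hli a b h
    simp
  · obtain ⟨a, b, rfl⟩ := hsp z
    exact ⟨DiffOp.coeff _ a + DiffOp.coeff _ b * DiffOp.partial_ _, by
      rw [add_smul, mul_smul, DiffOp.coeff_smul, DiffOp.coeff_smul, partial_smul_H1E]⟩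

end Elliptic

/-! ### Clausen's identity and the symmetric square -/

section Clausen

/-- Clausen's identity. The hypotheses `hx`, `hy`, `hz` are the system of `x = w²`, `y = w δw`,
`z = (δw)²` for a solution `w` of the equation of order two, where `δ = s d/ds`, written in terms of
the derivation `d = t d/dt` with `t = 4 s (1 - s)`; here `J = 1 / (1 - 2 s)` and
`d = (1 - s) J δ`. They imply the hypergeometric equation of order three for `x`. -/
theorem clausen {k R : Type*} [CommRing k] [CommRing R] [Algebra k R] {d : Derivation k R R}
    {N : Type*} [AddCommGroup N] [Module R N] (c : Connection d N) {s J c₀ c₁ h : R}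
    (hJ : J * (1 - 2 * s) = 1) (hs : d s = s * (1 - s) * J) (hdJ : d J = 2 * s * (1 - s) * J ^ 3)
    (h₀ : d c₀ = 0) (h₁ : d c₁ = 0) (hh : d h = 0) (hc : c₀ + c₁ = 1) (h2 : 2 * h = 1) {x y z : N}
    (hx : c.toHom x = (2 * (1 - s) * J) • y)
    (hy : c.toHom y = (s * J * (c₀ * c₁)) • x + (s * J) • y + ((1 - s) * J) • z)
    (hz : c.toHom z = (2 * s * J * (c₀ * c₁)) • y + (2 * s * J) • z) :
    c.toHom (c.toHom (c.toHom x)) - (4 * s * (1 - s)) • (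
      c.toHom (c.toHom (c.toHom x + h • x) + c₁ • (c.toHom x + h • x))
      + c₀ • (c.toHom (c.toHom x + h • x) + c₁ • (c.toHom x + h • x))) = 0 := by
  have hd2 : d 2 = 0 := mod_cast d.map_natCast 2
  have hd4 : d 4 = 0 := mod_cast d.map_natCast 4
  have hD : ∀ a b e : R, c.toHom (a • x + b • y + e • z)
      = (d a + b * (s * J * (c₀ * c₁))) • x
        + (d b + a * (2 * (1 - s) * J) + b * (s * J) + e * (2 * s * J * (c₀ * c₁))) • y
        + (d e + b * ((1 - s) * J) + e * (2 * s * J)) • z := by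
    intro a b e
    rw [map_add, map_add, c.leibniz, c.leibniz, c.leibniz, hx, hy, hz]
    module
  have e1 : c.toHom x = (0 : R) • x + (2 * (1 - s) * J) • y + (0 : R) • z := by
    rw [hx]
    module
  have e2 : c.toHom (c.toHom x) = (2 * s * (1 - s) * J ^ 2 * (c₀ * c₁)) • x
      + (4 * s * (1 - s) ^ 2 * J ^ 3) • y + (2 * (1 - s) ^ 2 * J ^ 2) • z := by
    rw [e1, hD]
    simp only [Derivation.leibniz, map_sub, Derivation.map_one_eq_zero, hd2, hs, hdJ, map_zero,
      smul_eq_mul]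
    module
  have e3 : c.toHom (c.toHom (c.toHom x))
      = ((c₀ * c₁) * (2 * s * (1 - s) * (1 - 2 * s) * J ^ 3 + 12 * s ^ 2 * (1 - s) ^ 2 * J ^ 4)) • x
        + (4 * s * (1 - s) ^ 3 * J ^ 4 - 4 * s ^ 2 * (1 - s) ^ 2 * J ^ 4
          + 24 * s ^ 2 * (1 - s) ^ 3 * J ^ 5 + 8 * s * (1 - s) ^ 2 * J ^ 3 * (c₀ * c₁)) • y
        + (12 * s * (1 - s) ^ 3 * J ^ 4) • z := by
    rw [e2, hD]
    simp only [Derivation.leibniz, Derivation.leibniz_pow, map_sub, Derivation.map_one_eq_zero, hd2,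
      hd4, hs, hdJ, h₀, h₁, smul_eq_mul, nsmul_eq_mul]
    push_cast
    module
  obtain rfl : c₀ = 1 - c₁ := eq_sub_of_add_eq hc
  -- the parameters enter the expanded equation only through their sum, which is `1`, and their
  -- product
  have e4 : c.toHom (c.toHom (c.toHom x)) - (4 * s * (1 - s)) • (
      c.toHom (c.toHom (c.toHom x + h • x) + c₁ • (c.toHom x + h • x))
      + (1 - c₁) • (c.toHom (c.toHom x + h • x) + c₁ • (c.toHom x + h • x)))
      = (1 - 2 * s) ^ 2 • c.toHom (c.toHom (c.toHom x)) - (4 * s * (1 - s)) • (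
        (h + 1) • c.toHom (c.toHom x) + ((1 - c₁) * c₁ + h) • c.toHom x
        + (h * ((1 - c₁) * c₁)) • x) := by
    simp only [map_add, c.leibniz, hh, h₁, zero_smul, add_zero]
    module
  rw [e4, e3, e2, e1]
  have key : ∀ {a₀ a₁ a₂ b₀ b₁ b₂ e₁ f p q r₁ r₀ : R},
      f * a₀ - p * (q * b₀ + r₀) = 0 → f * a₁ - p * (q * b₁ + r₁ * e₁) = 0 →
      f * a₂ - p * (q * b₂) = 0 →
      f • (a₀ • x + a₁ • y + a₂ • z) - p • (q • (b₀ • x + b₁ • y + b₂ • z)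
        + r₁ • ((0 : R) • x + e₁ • y + (0 : R) • z) + r₀ • x) = 0 := by
    intro a₀ a₁ a₂ b₀ b₁ b₂ e₁ f p q r₁ r₀ k₀ k₁ k₂
    have h3 := congrArg₂ (· + ·) (congrArg₂ (· + ·) (congrArg (· • x) k₀) (congrArg (· • y) k₁))
      (congrArg (· • z) k₂)
    simp only [zero_smul, add_zero] at h3
    rw [← h3]
    module
  have hJ2 : J ^ 2 * (1 - 2 * s) ^ 2 = 1 := by rw [← mul_pow, hJ, one_pow]
  have hJ3 : J ^ 3 * (1 - 2 * s) ^ 3 = 1 := by rw [← mul_pow, hJ, one_pow]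
  apply key
  · linear_combination (1 - c₁) * c₁ * (2 * s * (1 - s) * hJ3
      + 12 * s ^ 2 * (1 - s) ^ 2 * J ^ 2 * hJ2
      - 2 * s * (1 - s) * (2 * s * (1 - s) * J ^ 2 + 1) * h2)
  · linear_combination (4 * s * (1 - s) ^ 3 * J ^ 2 - 4 * s ^ 2 * (1 - s) ^ 2 * J ^ 2
      + 24 * s ^ 2 * (1 - s) ^ 3 * J ^ 3 + 8 * s * (1 - s) ^ 2 * J * ((1 - c₁) * c₁)) * hJ2
      - 2 * s * (1 - s) * (4 * s * (1 - s) ^ 2 * J ^ 3 + 2 * (1 - s) * J) * h2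
      + 4 * s * (1 - s) ^ 2 * J * hJ
  · linear_combination 12 * s * (1 - s) ^ 3 * J ^ 2 * hJ2
      - 4 * s * (1 - s) ^ 3 * J ^ 2 * h2

/-- The connection `a ∇` along `a θ`. -/
def Connection.smul {k A M : Type*} [CommRing k] [CommRing A] [Algebra k A] [AddCommGroup M]
    [Module A M] {θ : Derivation k A A} (a : A) (c : Connection θ M) : Connection (a • θ) M where
  toHom := (DistribSMul.toAddMonoidHom M a).comp c.toHom
  leibniz b m := by
    change a • c.toHom (b • m) = b • a • c.toHom m + (a * θ b) • m
    rw [c.leibniz]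
    module

variable {k A : Type} [CommRing k] [CommRing A] [Algebra k A] {θ : Derivation k A A}
  {M : Type*} [AddCommGroup M] [Module A M] (c : Connection θ M) {w : M}

/-- The derivatives along `t ∇`, with `t = 4 s (1 - s)`, of `w²`, `w δw` and `(δw)²`, where
`δ = e ∇` and `w` is a solution of the elliptic Picard–Fuchs equation. -/
theorem symSq_system {s J e c₀ c₁ : A} (he : 4 * s = J * e)
    (hw : (1 - s) • e • c.toHom (e • c.toHom w)
      = s • e • c.toHom w + (s * (c₀ * c₁)) • w) :
    (4 * s * (1 - s)) • c.symSq.toHom (symMul w w)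
        = (2 * (1 - s) * J) • symMul w (e • c.toHom w) ∧
    (4 * s * (1 - s)) • c.symSq.toHom (symMul w (e • c.toHom w))
        = (s * J * (c₀ * c₁)) • symMul w w + (s * J) • symMul w (e • c.toHom w)
          + ((1 - s) * J) • symMul (e • c.toHom w) (e • c.toHom w) ∧
    (4 * s * (1 - s)) • c.symSq.toHom (symMul (e • c.toHom w) (e • c.toHom w))
        = (2 * s * J * (c₀ * c₁)) • symMul w (e • c.toHom w)
          + (2 * s * J) • symMul (e • c.toHom w) (e • c.toHom w) := by
  have hC : ∀ a b : M, (4 * s * (1 - s)) • c.symSq.toHom (symMul a b)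
      = symMul (((1 - s) * J) • e • c.toHom a) b
        + symMul a (((1 - s) * J) • e • c.toHom b) := by
    intro a b
    rw [c.symSq_symMul, ← mul_smul, ← mul_smul, symMul_smul, smul_symMul, ← smul_add]
    congr 1
    linear_combination (1 - s) * he
  have hw' : ((1 - s) * J) • e • c.toHom (e • c.toHom w)
      = (J * s) • e • c.toHom w + (J * (s * (c₀ * c₁))) • w := by
    rw [mul_comm, mul_smul, hw]
    module
  refine ⟨?_, ?_, ?_⟩
  · rw [hC, symMul_comm _ w]
    simp only [smul_symMul]
    module
  · rw [hC, hw']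
    simp only [add_symMul, symMul_smul, smul_symMul]
    module
  · rw [hC, hw', symMul_comm _ (e • c.toHom w)]
    simp only [add_symMul, smul_symMul, symMul_comm (e • c.toHom w) w]
    module

/-- If `w` and `∇w` are a basis of `M`, then `w²` and its first two derivatives are a basis of the
symmetric square. -/
theorem symSq_cyclic {h : A} (h2 : 2 * h = 1)
    (hli : ∀ a b : A, a • w + b • c.toHom w = 0 → a = 0 ∧ b = 0)
    (hsp : ∀ m : M, ∃ a b : A, m = a • w + b • c.toHom w) :
    (∀ x ∈ DiffOp.lowOrder θ 3, DiffOp.action c.symSq x (symMul w w) = 0 → x = 0) ∧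
    ∀ z, ∃ x, DiffOp.action c.symSq x (symMul w w) = z := by
  obtain ⟨p, q, hpq⟩ := hsp (c.toHom (c.toHom w))
  have hact : ∀ a b d : A, DiffOp.action c.symSq (DiffOp.coeff θ a
      + DiffOp.coeff θ b * DiffOp.partial_ θ
      + DiffOp.coeff θ d * (DiffOp.partial_ θ * DiffOp.partial_ θ)) (symMul w w)
      = (a + 2 * p * d) • symMul w w + (2 * b + 2 * q * d) • symMul w (c.toHom w)
        + (2 * d) • symMul (c.toHom w) (c.toHom w) := by
    intro a b d
    rw [DiffOp.add_action, DiffOp.add_action, DiffOp.action_coeff,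
      ← DiffOp.smul_def, ← DiffOp.smul_def, DiffOp.action_smul, DiffOp.action_smul,
      DiffOp.action_partial_mul, DiffOp.action_partial, c.symSq_symMul, map_add,
      c.symSq_symMul, c.symSq_symMul, hpq, symMul_comm (_ + _) w, symMul_comm (c.toHom w) w]
    simp only [add_symMul, smul_symMul]
    module
  refine ⟨fun x hx h0 => ?_, fun z => ?_⟩
  · obtain ⟨a, b, d, rfl⟩ := DiffOp.mem_lowOrder_three hx
    rw [hact] at h0
    obtain ⟨k0, k1, k2⟩ := symSq_independent hsp hli h0
    obtain rfl : d = 0 := by linear_combination h * k2 - d * h2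
    obtain rfl : b = 0 := by linear_combination h * k1 - b * h2
    obtain rfl : a = 0 := by linear_combination k0
    simp
  · obtain ⟨a, b, d, rfl⟩ := exists_symSq_eq hsp z
    refine ⟨_, (hact (a - p * d) (h * (b - q * d)) (h * d)).trans ?_⟩
    congr 1
    · congr 1
      · congr 1
        linear_combination p * d * h2
      · congr 1
        linear_combination b * h2
    · congr 1
      linear_combination d * h2

end Clausen

/-! ### The hypergeometric operator of order three and the second isomorphism -/

section HypergeometricThree

variable (K : Type) [Field K]

theorem isUnit_tT : IsUnit (tT K) ∧ IsUnit (1 - tT K) := by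
  have h := IsLocalization.Away.algebraMap_isUnit (S := OT K) (X - X ^ 2 : K[X])
  have e : algebraMap K[X] (OT K) (X - X ^ 2) = tT K * (1 - tT K) := by
    rw [map_sub, map_pow, tT]
    ring
  rw [e] at h
  exact ⟨isUnit_of_mul_isUnit_left h, isUnit_of_mul_isUnit_right h⟩

theorem algebraMap_tT : algebraMap (OT K) (OS K) (tT K) = 4 * sS K * (1 - sS K) := by
  rw [tT, algebraMap_OT, aeval_X]
  simp only [tOfS, sS, map_sub, map_mul, map_ofNat, map_one]

theorem algebraMap_const (a : K) :
    algebraMap (OT K) (OS K) (algebraMap K (OT K) a) = algebraMap K (OS K) a := by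
  rw [IsScalarTower.algebraMap_apply K K[X] (OT K), algebraMap_OT,
    IsScalarTower.algebraMap_apply K K[X] (OS K)]
  congr 1
  exact aeval_C (tOfS K) a

theorem ddtS_dsdt : ddtS K (dsdt K) = 8 * dsdt K ^ 3 := by
  have h := congrArg (ddtS K) (dsdt_mul K)
  obtain ⟨n2, -, n4, -⟩ := ddtS_numerals K
  simp only [Derivation.leibniz, map_sub, Derivation.map_one_eq_zero, smul_eq_mul, n2, n4,
    ddtS_s] at h
  have hi := dsdt_mul K
  linear_combination dsdt K * h - ddtS K (dsdt K) * hi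

variable (α : HGType)

theorem opT_symbol :
    opT K α - ((1 - tT K) * (tT K * (tT K * tT K))) • DiffOp.partial_ (ddtT K) ^ 3
      ∈ DiffOp.lowOrder (ddtT K) 3 := by
  have h := fun b b' b'' => DiffOp.symbol_mul_mul_mul (θ := ddtT K) (tT K) b b' b''
  have h3 := Submodule.sub_mem _ (h 0 0 0) (Submodule.smul_mem _ (tT K)
    (h (algebraMap K (OT K) α.α₀) (algebraMap K (OT K) α.α₁) (algebraMap K (OT K) (1 / 2))))
  refine (congrArg (· ∈ DiffOp.lowOrder (ddtT K) 3) ?_).mp h3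
  rw [map_zero, add_zero, smul_sub, DiffOp.smul_def (ddtT K) (tT K) (_ * _),
    sub_sub_sub_comm, ← mul_smul, ← sub_smul, ← one_sub_mul, opT, pow_succ' (eulerT K) 2,
    pow_two (eulerT K), mul_assoc (DiffOp.coeff (ddtT K) (tT K) * _),
    mul_assoc (DiffOp.coeff (ddtT K) (tT K)) (eulerT K + constT K α.α₀)]
  rfl

/-- The pullback of the hypergeometric module of order three is generated by its canonical
element. -/
theorem span_one_tmul : Submodule.span (DS K) {(1 : OS K) ⊗ₜ[OT K] ωV K α} = ⊤ := by
  obtain ⟨ht, ht'⟩ := isUnit_tT K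
  refine Submodule.eq_top_iff'.2 fun z => Submodule.mem_span_singleton.2 ?_
  obtain ⟨x, -, hx⟩ := DiffOp.exists_action_one_tmul (ddtS_algebraMap K)
    (ht'.mul (ht.mul (ht.mul ht))) (opT_symbol K α) z
  exact ⟨x, hx⟩

variable {K} in
/-- The action of the hypergeometric operator of order three on a module with connection over `S`,
in terms of the operator `D = t d/dt` with `t = 4 s (1 - s)`. -/
theorem opT_action {N : Type*} [AddCommGroup N] [Module (OS K) N] [Module (OT K) N]
    [IsScalarTower (OT K) (OS K) N] (c : Connection (ddtS K) N) {D : N → N}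
    (hD : ∀ z, D z = (4 * sS K * (1 - sS K)) • c.toHom z) (w : N) :
    DiffOp.action (c.restrict (ddtS_algebraMap K)) (opT K α) w
      = D (D (D w)) - (4 * sS K * (1 - sS K)) • (
        D (D (D w + algebraMap K (OS K) (1 / 2) • w)
          + algebraMap K (OS K) α.α₁ • (D w + algebraMap K (OS K) (1 / 2) • w))
        + algebraMap K (OS K) α.α₀ • (D (D w + algebraMap K (OS K) (1 / 2) • w)
          + algebraMap K (OS K) α.α₁ • (D w + algebraMap K (OS K) (1 / 2) • w))) := by
  let _ : Module (DT K) N := DiffOp.module (c.restrict (ddtS_algebraMap K))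
  have hc : ∀ (a : OT K) (z : N),
      DiffOp.coeff (ddtT K) a • z = algebraMap (OT K) (OS K) a • z := fun a z =>
    (DiffOp.action_coeff (c.restrict (ddtS_algebraMap K)) a z).trans (algebraMap_smul _ _ _).symm
  have hE : ∀ z : N, eulerT K • z = D z := by
    intro z
    rw [eulerT, mul_smul, hc, hD, algebraMap_tT]
    congr 1
    exact DiffOp.action_partial (c.restrict (ddtS_algebraMap K)) z
  have hk : ∀ (a : K) (z : N), constT K a • z = algebraMap K (OS K) a • z := by
    intro a z
    rw [constT, hc, algebraMap_const]
  change opT K α • w = _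
  rw [opT, sub_smul, pow_succ' (eulerT K) 2, pow_two (eulerT K)]
  simp only [mul_smul, add_smul _ _ w, hE, hk, hc, algebraMap_tT, add_smul (eulerT K)]

variable [CharZero K]

theorem two_mul_half : 2 * algebraMap K (OS K) (1 / 2) = 1 := by
  rw [← map_ofNat (algebraMap K (OS K)) 2, ← map_mul, mul_one_div_cancel (by norm_num), map_one]

variable {K}

/-- The hypergeometric operator of order three annihilates `x` if `x`, `y`, `z` satisfy the system
of `w²`, `w δw`, `(δw)²`. -/
theorem opT_action_eq_zero {N : Type*} [AddCommGroup N] [Module (OS K) N] [Module (OT K) N]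
    [IsScalarTower (OT K) (OS K) N] (c : Connection (ddtS K) N) {x y z : N}
    (hx : (4 * sS K * (1 - sS K)) • c.toHom x = (2 * (1 - sS K) * (4 * dsdt K)) • y)
    (hy : (4 * sS K * (1 - sS K)) • c.toHom y
      = (sS K * (4 * dsdt K) * (algebraMap K (OS K) α.α₀ * algebraMap K (OS K) α.α₁)) • x
        + (sS K * (4 * dsdt K)) • y + ((1 - sS K) * (4 * dsdt K)) • z)
    (hz : (4 * sS K * (1 - sS K)) • c.toHom z
      = (2 * sS K * (4 * dsdt K) * (algebraMap K (OS K) α.α₀ * algebraMap K (OS K) α.α₁)) • y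
        + (2 * sS K * (4 * dsdt K)) • z) :
    DiffOp.action (c.restrict (ddtS_algebraMap K)) (opT K α) x = 0 := by
  have h1 := dsdt_mul K
  have h4 := (ddtS_numerals K).2.2.1
  have hJ : 4 * dsdt K * (1 - 2 * sS K) = 1 := by linear_combination h1
  have hs : 4 * sS K * (1 - sS K) * ddtS K (sS K) = sS K * (1 - sS K) * (4 * dsdt K) := by
    rw [ddtS_s]
    ring
  have hdJ : 4 * sS K * (1 - sS K) * ddtS K (4 * dsdt K)
      = 2 * sS K * (1 - sS K) * (4 * dsdt K) ^ 3 := by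
    rw [Derivation.leibniz, h4, ddtS_dsdt, smul_eq_mul, smul_zero]
    ring
  have hd : ∀ a : K, ((4 * sS K * (1 - sS K)) • ddtS K) (algebraMap K (OS K) a) = 0 :=
    ((4 * sS K * (1 - sS K)) • ddtS K).map_algebraMap
  have hD : ∀ z, (c.smul (4 * sS K * (1 - sS K))).toHom z
      = (4 * sS K * (1 - sS K)) • c.toHom z := fun _ => rfl
  exact (opT_action α c hD x).trans (clausen (c.smul (4 * sS K * (1 - sS K))) hJ hs hdJ
    (hd _) (hd _) (hd _) (param_add K α) (two_mul_half K) hx hy hz)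

end HypergeometricThree

section SecondIsomorphism

variable {K : Type} [Field K] [CharZero K] {α : HGType} {κ : OS K} {ω : H1E K α}

/-- The pullback of the hypergeometric module of order three is the symmetric square of the
cohomology of the elliptic family. -/
theorem exists_symSq_equiv (hκ : ddtS K κ = 0) (hκ' : IsUnit κ)
    (hω : (curve K α).affineClass ω = (curve K α).linClass κ 0) :
    ∃ e : (OS K ⊗[OT K] V K α) ≃ₗ[DS K] Sym[OS K]^2 (H1E K α),
      e ((1 : OS K) ⊗ₜ[OT K] ωV K α) = symMul ω ω := by
  let _ : Module (OT K) (Sym[OS K]^2 (H1E K α)) := Module.compHom _ (algebraMap (OT K) (OS K))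
  have : IsScalarTower (OT K) (OS K) (Sym[OS K]^2 (H1E K α)) :=
    ⟨fun a b z => by
      rw [Algebra.smul_def, mul_smul]
      rfl⟩
  obtain ⟨hli, hsp⟩ := H1E_basis hκ' hω
  obtain ⟨hli', hsp'⟩ := symSq_cyclic _ (two_mul_half K) hli hsp
  obtain ⟨ht, ht'⟩ := isUnit_tT K
  have he : 4 * sS K = 4 * dsdt K * eulerCoeff K := by
    rw [eulerCoeff]
    linear_combination (-4 * sS K) * dsdt_mul K
  obtain ⟨hx, hy, hz⟩ := symSq_system _ he (picardFuchs hκ hω)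
  have hw := opT_action_eq_zero α ((curve K α).gaussManin (ddtS K)).symSq hx hy hz
  exact DiffOp.exists_baseChange_equiv (ddtS_algebraMap K)
    ((curve K α).gaussManin (ddtS K)).symSq (ht'.mul (ht.mul (ht.mul ht))) (opT_symbol K α)
    hw hli' hsp'

/-- The class of `dX / Y`, where `X = u x + r` and `Y = v y`, is the class of `κ dx / 2y` with
`κ = 2 u / v`. -/
theorem affineClass_form {u v : K} (hv : v ≠ 0) {r : OS K}
    (h : (curve K α).IsFormClass
      (constE K α u * (curve K α).x₀ + algebraMap (OS K) (curve K α).Chart₀ r)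
      (constE K α v * (curve K α).y₀) ω) :
    (curve K α).affineClass ω = (curve K α).linClass (algebraMap K (OS K) (2 * u / v)) 0 := by
  have hκ : algebraMap K (OS K) v * algebraMap K (OS K) (2 * u / v)
      = 2 * algebraMap K (OS K) u := by
    rw [← map_mul, mul_div_cancel₀ _ hv, map_mul, map_ofNat]
  rw [(curve K α).affineClass_of_isFormClass hκ (hv.isUnit.map _) h, CubicCurve.linClass, map_zero,
    zero_mul, add_zero]

/-- `dX / Y` has a well-defined cohomology class. -/
theorem existsUnique_form {u v : K} (hv : v ≠ 0) (r : OS K) :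
    ∃! ω : H1E K α, (curve K α).IsFormClass
      (constE K α u * (curve K α).x₀ + algebraMap (OS K) (curve K α).Chart₀ r)
      (constE K α v * (curve K α).y₀) ω := by
  have hκ : algebraMap K (OS K) v * algebraMap K (OS K) (2 * u / v)
      = 2 * algebraMap K (OS K) u := by
    rw [← map_mul, mul_div_cancel₀ _ hv, map_mul, map_ofNat]
  obtain ⟨ω, h⟩ := (curve K α).exists_isFormClass (r := r) hκ
  refine ⟨ω, h, fun ω' h' => (curve K α).affineClass_injective (isUnit_natCast K) ?_⟩
  rw [affineClass_form hv h, affineClass_form hv h']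

end SecondIsomorphism

end HGClausen

end

open HGClausen Polynomial TensorProduct

theorem lemma2 (K : Type) [Field K] [CharZero K] (α : HGType)
    -- a Weierstrass equation `Y² = 4 X³ - g₂ X - g₃` of the curve, with `X = u x + r`, `Y = v y`
    (u v : K) (hu : u ≠ 0) (hv : v ≠ 0) (r g₂ g₃ : OS K)
    (hW : 4 * (C (algebraMap K (OS K) u) * X + C r) ^ 3
        - C g₂ * (C (algebraMap K (OS K) u) * X + C r) - C g₃
      = C (algebraMap K (OS K) v ^ 2) * (curve K α).toPoly) :
    -- the class of `dX / Y`
    (∃! ω : H1E K α, (curve K α).IsFormClass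
      (constE K α u * (curve K α).x₀ + algebraMap (OS K) (curve K α).Chart₀ r)
      (constE K α v * (curve K α).y₀) ω) ∧
    ∀ ω : H1E K α, (curve K α).IsFormClass
      (constE K α u * (curve K α).x₀ + algebraMap (OS K) (curve K α).Chart₀ r)
      (constE K α v * (curve K α).y₀) ω →
    (∃ e : (DS K ⧸ Submodule.span (DS K) {opS K α}) ≃ₗ[DS K] H1E K α,
      e (Submodule.Quotient.mk 1) = ω) ∧
    Submodule.span (DS K) {(1 : OS K) ⊗ₜ[OT K] ωV K α} = ⊤ ∧
    (∃ e : (OS K ⊗[OT K] V K α) ≃ₗ[DS K] Sym[OS K]^2 (H1E K α),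
      e ((1 : OS K) ⊗ₜ[OT K] ωV K α) = symMul ω ω) := by
  refine ⟨existsUnique_form hv r, fun ω hω => ?_⟩
  have hκ : ddtS K (algebraMap K (OS K) (2 * u / v)) = 0 := Derivation.map_algebraMap _ _
  have hκ' : IsUnit (algebraMap K (OS K) (2 * u / v)) :=
    (div_ne_zero (mul_ne_zero two_ne_zero hu) hv).isUnit.map _
  have h := affineClass_form hv hω
  exact ⟨exists_elliptic_equiv hκ hκ' h, span_one_tmul K α, exists_symSq_equiv hκ hκ' h⟩
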